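/- Let $k$ be a field of characteristic not $2$, let $K$ be a nonzero étale $k$-algebra and let $\iota$ be a $k$-algebra automorphism of $K$ with $\iota^2=\mathrm{Id}$ whose ring of fixed points is $k$ (so either $K=k$ and $\iota=\mathrm{Id}$, or $K$ is a quadratic étale $k$-algebra). Let $A$ be an Azumaya algebra over $K$. All modules are finitely generated over $K$. Notation. For a right $A$-module $V$ put $B=\mathrm{End}_A(V)$, and let $g_B\in B\otimes_K B$ be the Goldman element, i.e. the preimage of the reduced trace $\mathrm{Trd}_B:B\to K\to B$ under the isomorphism $B\otimes_K B\to\mathrm{End}_K(B)$, $a\otimes b\mapsto(x\mapsto axb)$. (Over a point of $\mathrm{Spec}(K)$ where $V$ vanishes, $B$ is the zero ring and $\mathrm{Trd}_B=0$, $g_B=0$ there.) The group morphism $\mathfrak S_d\to (B^{\otimes d})^\times$ sending each transposition $(i,\,i+1)$ to $1\otimes\cdots\otimes g_B\otimes\cdots\otimes1$ ($g_B$ in positions $i,i+1$) makes $V^{\otimes d}$ (tensor power over $K$) a left $K[\mathfrak S_d]$-module; this action commutes with the right action of $A^{\otimes d}$. Put $s_d=\sum_{g\in\mathfrak S_d}(-1)^g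 g$ and $\mathrm{Alt}^d(V)=s_dV^{\otimes d}$, a right $A^{\otimes d}$-submodule of $V^{\otimes d}$. For $p+q=d$, $x\in V^{\otimes p}$ and $y\in V^{\otimes q}$, the shuffle product is $x\#y=\sum_\pi(-1)^\pi\,\pi\cdot(x\otimes y)\in V^{\otimes d}$, where $\pi$ runs over the permutations of $\{1,\dots,d\}$ that are increasing on $\{1,\dots,p\}$ and on $\{p+1,\dots,d\}$. If $\sigma$ is an involution on $A$ with $\sigma|_K=\iota$ and $\varepsilon\in K$ satisfies $\varepsilon\,\iota(\varepsilon)=1$, an $\varepsilon$-hermitian module $(V,h)$ over $(A,\sigma)$ is a right $A$-module $V$ with a nondegenerate bi-additive map $h:V\times V\to A$ such that $h(xa,yb)=\sigma(a)h(x,y)b$ and $\sigma(h(x,y))=\varepsilon h(y,x)$. Then $\mathrm{Alt}^d(h):\mathrm{Alt}^d(V)\times\mathrm{Alt}^d(V)\to A^{\otimes d}$ is the form defined by $\mathrm{Alt}^d(h)(s_dx,s_dy)=h^{\otimes d}(s_dx,y)=h^{\otimes d}(x,s_dy)$. Proposition. Let $d\in\mathbb N$. (1) For all right $A$-modules $U$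 and $V$, the shuffle product of tensor powers of $U\oplus V$, applied to $x\in \mathrm{Alt}^p(U)\subseteq(U\oplus V)^{\otimes p}$ and $y\in\mathrm{Alt}^q(V)\subseteq(U\oplus V)^{\otimes q}$, induces an isomorphism of right $A^{\otimes d}$-modules $$\Phi:\bigoplus_{p+q=d}\mathrm{Alt}^p(U)\otimes_K\mathrm{Alt}^q(V)\xrightarrow{\ \sim\ }\mathrm{Alt}^d(U\oplus V),\qquad x\otimes y\mapsto x\#y,$$ where $A^{\otimes d}=A^{\otimes p}\otimes_K A^{\otimes q}$ acts on $\mathrm{Alt}^p(U)\otimes_K\mathrm{Alt}^q(V)$ factorwise. (2) For every involution $\sigma$ on $A$ with $\sigma|_K=\iota$, every $\varepsilon\in K$ with $\varepsilon\,\iota(\varepsilon)=1$ and all $\varepsilon$-hermitian forms $h$ on $U$ and $h'$ on $V$ over $(A,\sigma)$, the isomorphism $\Phi$ is an isometry of $\varepsilon^d$-hermitian modules over $(A^{\otimes d},\sigma^{\otimes d})$ from $\bigoplus_{p+q=d}\mathrm{Alt}^p(h)\otimes_K\mathrm{Alt}^q(h')$ (orthogonal sum) onto $\mathrm{Alt}^d(h\perp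 h')$; that is, both are nondegenerate $\varepsilon^d$-hermitian forms over $(A^{\otimes d},\sigma^{\otimes d})$, and $\Phi$ carries the first to the second. -/

import Mathlib

open scoped TensorProduct DirectSum

noncomputable section

namespace AzumayaAlt

universe uK uA uU uV uB

/-! ### Reduced trace, Goldman element, Goldman morphism -/

section Goldman

variable (K : Type uK) [CommRing K] (B : Type uB) [Ring B] [Algebra K B]

variable {K B} in
/-- `t : B → K` is the reduced trace: whenever `B` becomes a matrix algebra over a field `L`
over `K`, the map `t` becomes the trace of matrices. (Over each residue field of `K` the algebra
`B` is allowed to be the zero ring, which is the algebra of matrices of size `0`.) -/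
def IsReducedTrace (t : B →ₗ[K] K) : Prop :=
  ∀ (L : Type uK) [Field L] [Algebra K L] (n : ℕ)
    (φ : (L ⊗[K] B) ≃ₐ[L] Matrix (Fin n) (Fin n) L) (b : B),
    (φ (1 ⊗ₜ[K] b)).trace = algebraMap K L (t b)

/-- The reduced trace `Trd_B : B → K`. -/
def reducedTrace : B →ₗ[K] K :=
  Classical.epsilon fun t : B →ₗ[K] K => IsReducedTrace t

/-- The canonical linear map `B ⊗ B → B ⊗ Bᵐᵒᵖ → End_K(B)`, `a ⊗ b ↦ (x ↦ a x b)`. -/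
def sandwich : B ⊗[K] B →ₗ[K] Module.End K B :=
  (AlgHom.mulLeftRight K B).toLinearMap ∘ₗ
    TensorProduct.map LinearMap.id (MulOpposite.opLinearEquiv K).toLinearMap

/-- The Goldman element `g_B ∈ B ⊗ B`: the preimage under `sandwich` of the reduced trace,
seen as a map `B → K → B`. -/
def goldman : B ⊗[K] B :=
  Classical.epsilon fun g : B ⊗[K] B =>
    sandwich K B g = (Algebra.linearMap K B) ∘ₗ (reducedTrace K B)

/-- The Goldman element placed in positions `i` and `j` of `B^{⊗ d}`, with `1` elsewhere. -/
def goldmanAt {d : ℕ} (i j : Fin d) : ⨂[K]^d B :=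
  LinearMap.mul' K (⨂[K]^d B)
    (TensorProduct.map
      (PiTensorProduct.singleAlgHom (R := K) (A := fun _ : Fin d => B) i).toLinearMap
      (PiTensorProduct.singleAlgHom (R := K) (A := fun _ : Fin d => B) j).toLinearMap
      (goldman K B))

/-- The group morphism from the symmetric group to `B^{⊗ d}` that sends the transposition
`(i, i+1)` to `1 ⊗ ⋯ ⊗ g_B ⊗ ⋯ ⊗ 1`. -/
def goldmanHom (d : ℕ) : Equiv.Perm (Fin d) →* ⨂[K]^d B :=
  Classical.epsilon fun φ : Equiv.Perm (Fin d) →* ⨂[K]^d B =>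
    ∀ i j : Fin d, (j : ℕ) = (i : ℕ) + 1 → φ (Equiv.swap i j) = goldmanAt K B i j

end Goldman

/-! ### Tensor powers of right modules. A right `A`-module is an `Aᵐᵒᵖ`-module. -/

section TensorPowers

variable (K : Type uK) [CommRing K] (A : Type uA) [Ring A] [Algebra K A]
  (V : Type uV) [AddCommGroup V] [Module K V] [Module Aᵐᵒᵖ V] [IsScalarTower K Aᵐᵒᵖ V]

/-- `a ↦ (v ↦ v a)`. -/
def rightMul : A →ₗ[K] Module.End K V :=
  (Algebra.lsmul K K V).toLinearMap ∘ₗ (MulOpposite.opLinearEquiv K).toLinearMap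

variable {A V} in
@[simp] lemma rightMul_apply (a : A) (v : V) : rightMul K A V a v = MulOpposite.op a • v := rfl

/-- The right multiplication of `A^{⊗ d}` on `V^{⊗ d}`:
`(v₁ ⊗ ⋯ ⊗ v_d) (a₁ ⊗ ⋯ ⊗ a_d) = v₁ a₁ ⊗ ⋯ ⊗ v_d a_d`. -/
def tensorRightMul (d : ℕ) : ⨂[K]^d A →ₗ[K] Module.End K (⨂[K]^d V) :=
  PiTensorProduct.piTensorHomMap ∘ₗ PiTensorProduct.map fun _ => rightMul K A V

variable {A V} in
@[simp] lemma tensorRightMul_tprod {d : ℕ} (a : Fin d → A) (v : Fin d → V) :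
    tensorRightMul K A V d (PiTensorProduct.tprod K a) (PiTensorProduct.tprod K v)
      = PiTensorProduct.tprod K fun i => MulOpposite.op (a i) • v i := by
  simp [tensorRightMul]

lemma tensorRightMul_one (d : ℕ) : tensorRightMul K A V d 1 = 1 := by
  apply PiTensorProduct.ext
  ext v
  simp [PiTensorProduct.one_def]

lemma tensorRightMul_mul {d : ℕ} (a b : ⨂[K]^d A) :
    tensorRightMul K A V d (a * b) = tensorRightMul K A V d b * tensorRightMul K A V d a := by
  induction a using PiTensorProduct.induction_on with
  | add x y hx hy => simp [add_mul, mul_add, hx, hy]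
  | smul_tprod r a =>
    induction b using PiTensorProduct.induction_on with
    | add x y hx hy => simp only [mul_add, map_add, add_mul, hx, hy]
    | smul_tprod s b =>
      apply PiTensorProduct.ext
      ext v
      simp [smul_smul, mul_comm r s]

/-- The right `A^{⊗ d}`-module `V^{⊗ d}`. -/
instance tensorModule (d : ℕ) : Module (⨂[K]^d A)ᵐᵒᵖ (⨂[K]^d V) where
  smul a x := tensorRightMul K A V d a.unop x
  one_smul x := by
    change tensorRightMul K A V d 1 x = x
    rw [tensorRightMul_one]; rfl
  mul_smul a b x := by
    change tensorRightMul K A V d (b.unop * a.unop) x = _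
    rw [tensorRightMul_mul]; rfl
  smul_zero a := map_zero _
  smul_add a := map_add _
  add_smul a b x := by
    change tensorRightMul K A V d (a.unop + b.unop) x = _
    rw [map_add]; rfl
  zero_smul x := by
    change tensorRightMul K A V d 0 x = 0
    rw [map_zero]; rfl

lemma tensor_smul_def {d : ℕ} (a : (⨂[K]^d A)ᵐᵒᵖ) (x : ⨂[K]^d V) :
    a • x = tensorRightMul K A V d a.unop x := rfl

instance tensorModule_isScalarTower (d : ℕ) :
    IsScalarTower K (⨂[K]^d A)ᵐᵒᵖ (⨂[K]^d V) where
  smul_assoc r a x := by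
    simp [tensor_smul_def]

/-- The left action of `End_A(V)^{⊗ d}` on `V^{⊗ d}`. -/
def endTensorAct (d : ℕ) :
    ⨂[K]^d (Module.End Aᵐᵒᵖ V) →ₗ[K] Module.End K (⨂[K]^d V) :=
  PiTensorProduct.piTensorHomMap ∘ₗ
    PiTensorProduct.map fun _ => LinearMap.restrictScalarsₗ K Aᵐᵒᵖ V V K

variable {A V} in
@[simp] lemma endTensorAct_tprod {d : ℕ} (b : Fin d → Module.End Aᵐᵒᵖ V) (v : Fin d → V) :
    endTensorAct K A V d (PiTensorProduct.tprod K b) (PiTensorProduct.tprod K v)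
      = PiTensorProduct.tprod K fun i => b i (v i) := by
  simp [endTensorAct]

lemma endTensorAct_comm {d : ℕ} (b : ⨂[K]^d (Module.End Aᵐᵒᵖ V)) (a : ⨂[K]^d A) :
    endTensorAct K A V d b * tensorRightMul K A V d a
      = tensorRightMul K A V d a * endTensorAct K A V d b := by
  induction a using PiTensorProduct.induction_on with
  | add x y hx hy => simp only [map_add, mul_add, add_mul, hx, hy]
  | smul_tprod r a =>
    induction b using PiTensorProduct.induction_on with
    | add x y hx hy => simp only [map_add, mul_add, add_mul, hx, hy]
    | smul_tprod s b =>
      apply PiTensorProduct.ext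
      ext v
      simp [smul_smul, mul_comm r s]

/-- The (left) Goldman action of a permutation on `V^{⊗ d}`, through the morphism from the
symmetric group to `End_A(V)^{⊗ d}`; it is `A^{⊗ d}`-linear. -/
def goldmanAct {d : ℕ} (g : Equiv.Perm (Fin d)) :
    ⨂[K]^d V →ₗ[(⨂[K]^d A)ᵐᵒᵖ] ⨂[K]^d V where
  toFun := endTensorAct K A V d (goldmanHom K (Module.End Aᵐᵒᵖ V) d g)
  map_add' := map_add _
  map_smul' a x := LinearMap.congr_fun (endTensorAct_comm K A V _ a.unop) x

/-- The action on `V^{⊗ d}` of the alternating element `alt(Y) = ∑_{g ∈ Y} (-1)^g g`. -/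
def altAct {d : ℕ} (Y : Finset (Equiv.Perm (Fin d))) :
    ⨂[K]^d V →ₗ[(⨂[K]^d A)ᵐᵒᵖ] ⨂[K]^d V :=
  ∑ g ∈ Y, ((Equiv.Perm.sign g : ℤˣ) : ℤ) • goldmanAct K A V g

/-- The action on `V^{⊗ d}` of the anti-symmetrizer `s_d = ∑_g (-1)^g g`. -/
def antisymm (d : ℕ) : ⨂[K]^d V →ₗ[(⨂[K]^d A)ᵐᵒᵖ] ⨂[K]^d V :=
  altAct K A V Finset.univ

/-- The alternating power `Alt^d(V) = s_d V^{⊗ d}`, a right `A^{⊗ d}`-submodule of `V^{⊗ d}`. -/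
def Alt (d : ℕ) : Submodule (⨂[K]^d A)ᵐᵒᵖ (⨂[K]^d V) :=
  LinearMap.range (antisymm K A V d)

/-- `s_d` as a map from `V^{⊗ d}` onto `Alt^d(V)`. -/
def toAlt (d : ℕ) : ⨂[K]^d V →ₗ[(⨂[K]^d A)ᵐᵒᵖ] Alt K A V d :=
  (antisymm K A V d).rangeRestrict

/-- The `(p, d - p)`-shuffles: the permutations of `d` positions that are increasing on the
first `p` positions and on the remaining ones. -/
def shuffles (p d : ℕ) : Finset (Equiv.Perm (Fin d)) :=
  {π | (∀ i j : Fin d, i < j → (j : ℕ) < p → π i < π j) ∧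
    (∀ i j : Fin d, i < j → p ≤ (i : ℕ) → π i < π j)}

/-- The concatenation of tensors `W^{⊗ p} ⊗ W^{⊗ q} ≃ W^{⊗ d}` for `p + q = d`. -/
def concat (W : Type*) [AddCommGroup W] [Module K W] {p q d : ℕ} (h : p + q = d) :
    (⨂[K]^p W) ⊗[K] (⨂[K]^q W) ≃ₗ[K] ⨂[K]^d W :=
  (PiTensorProduct.tmulEquiv K W).trans
    (PiTensorProduct.reindex K (fun _ => W) (finSumFinEquiv.trans (finCongr h)))

/-- The shuffle product `x # y = sh_{p,q} (x ⊗ y)` on tensor powers of `V`, for `p + q = d`. -/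
def shuffleProd {p q d : ℕ} (h : p + q = d) (x : ⨂[K]^p V) (y : ⨂[K]^q V) : ⨂[K]^d V :=
  altAct K A V (shuffles p d) (concat K V h (x ⊗ₜ[K] y))

lemma concat_tprod (W : Type*) [AddCommGroup W] [Module K W] {p q d : ℕ} (h : p + q = d)
    (a : Fin p → W) (b : Fin q → W) :
    concat K W h (PiTensorProduct.tprod K a ⊗ₜ[K] PiTensorProduct.tprod K b)
      = PiTensorProduct.tprod K fun i =>
          Sum.elim a b ((finSumFinEquiv.trans (finCongr h)).symm i) := by
  simp only [concat, LinearEquiv.trans_apply]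
  rw [PiTensorProduct.tmulEquiv_apply]
  exact PiTensorProduct.reindex_tprod _ _

/-- The concatenation `A^{⊗ p} ⊗ A^{⊗ q} ≃ A^{⊗ d}` is an isomorphism of algebras. -/
def concatAlg {p q d : ℕ} (h : p + q = d) :
    (⨂[K]^p A) ⊗[K] (⨂[K]^q A) ≃ₐ[K] ⨂[K]^d A :=
  AlgEquiv.ofLinearEquiv (concat K A h)
    (by
      rw [Algebra.TensorProduct.one_def, PiTensorProduct.one_def, PiTensorProduct.one_def,
        PiTensorProduct.one_def, concat_tprod]
      congr 1
      funext i
      rcases (finSumFinEquiv.trans (finCongr h)).symm i with j | j <;> rfl)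
    (by
      intro x y
      induction x using TensorProduct.induction_on with
      | zero => simp
      | add x x' hx hx' => simp only [add_mul, map_add, hx, hx']
      | tmul a b =>
      induction y using TensorProduct.induction_on with
      | zero => simp
      | add x x' hx hx' => simp only [mul_add, map_add, hx, hx']
      | tmul a' b' =>
      induction a using PiTensorProduct.induction_on with
      | add x x' hx hx' => simp only [TensorProduct.add_tmul, add_mul, map_add, hx, hx']
      | smul_tprod r a =>
      induction b using PiTensorProduct.induction_on with
      | add x x' hx hx' => simp only [TensorProduct.tmul_add, add_mul, map_add, hx, hx']
      | smul_tprod s b =>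
      induction a' using PiTensorProduct.induction_on with
      | add x x' hx hx' => simp only [TensorProduct.add_tmul, mul_add, map_add, hx, hx']
      | smul_tprod r' a' =>
      induction b' using PiTensorProduct.induction_on with
      | add x x' hx hx' => simp only [TensorProduct.tmul_add, mul_add, map_add, hx, hx']
      | smul_tprod s' b' =>
      simp only [Algebra.TensorProduct.tmul_mul_tmul, smul_mul_assoc, mul_smul_comm,
        ← TensorProduct.smul_tmul', TensorProduct.tmul_smul, map_smul,
        PiTensorProduct.tprod_mul_tprod, concat_tprod]
      congr 5
      funext i
      simp only [Pi.mul_apply]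
      rcases (finSumFinEquiv.trans (finCongr h)).symm i with j | j <;> rfl)

end TensorPowers

/-! ### The right `A^{⊗ d}`-module `Alt^p(U) ⊗ Alt^q(V)` for `p + q = d` -/

section Summands

variable (K : Type uK) [CommRing K] (A : Type uA) [Ring A] [Algebra K A]
  (U : Type uU) [AddCommGroup U] [Module K U] [Module Aᵐᵒᵖ U] [IsScalarTower K Aᵐᵒᵖ U]
  (V : Type uV) [AddCommGroup V] [Module K V] [Module Aᵐᵒᵖ V] [IsScalarTower K Aᵐᵒᵖ V]

/-- `Alt^p(U) ⊗_K Alt^q(V)`, for a pair `(p, q)` with `p + q = d`. -/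
def AltSummand (d : ℕ) (pq : Finset.HasAntidiagonal.antidiagonal d) : Type _ :=
  (Alt K A U pq.1.1) ⊗[K] (Alt K A V pq.1.2)

variable {d : ℕ} (pq : Finset.HasAntidiagonal.antidiagonal d)

instance : AddCommGroup (AltSummand K A U V d pq) :=
  inferInstanceAs (AddCommGroup ((Alt K A U pq.1.1) ⊗[K] (Alt K A V pq.1.2)))

instance : Module K (AltSummand K A U V d pq) :=
  inferInstanceAs (Module K ((Alt K A U pq.1.1) ⊗[K] (Alt K A V pq.1.2)))

variable {K A U V} {pq} in
/-- The pure tensor `x ⊗ y` in `Alt^p(U) ⊗_K Alt^q(V)`. -/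
def altTmul (x : Alt K A U pq.1.1) (y : Alt K A V pq.1.2) : AltSummand K A U V d pq :=
  x ⊗ₜ[K] y

/-- The action of `A^{⊗ d} = A^{⊗ p} ⊗ A^{⊗ q}` on `Alt^p(U) ⊗ Alt^q(V)`:
`(x ⊗ y) (a ⊗ b) = x a ⊗ y b`. -/
def altSummandAct : (⨂[K]^d A)ᵐᵒᵖ →ₐ[K] Module.End K (AltSummand K A U V d pq) :=
  (Module.endTensorEndAlgHom (R := K) (S := K) (A := K)
      (M := Alt K A U pq.1.1) (N := Alt K A V pq.1.2)).comp <|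
    (Algebra.TensorProduct.map (Algebra.lsmul K K (Alt K A U pq.1.1))
      (Algebra.lsmul K K (Alt K A V pq.1.2))).comp <|
    (Algebra.TensorProduct.opAlgEquiv K K (⨂[K]^pq.1.1 A) (⨂[K]^pq.1.2 A)).symm.toAlgHom.comp <|
    (AlgEquiv.op (concatAlg K A (Finset.HasAntidiagonal.mem_antidiagonal.1 pq.2)).symm).toAlgHom

instance : Module (⨂[K]^d A)ᵐᵒᵖ (AltSummand K A U V d pq) :=
  Module.compHom _ (altSummandAct K A U V pq).toRingHom

lemma altSummand_smul_tmul (a : ⨂[K]^pq.1.1 A) (b : ⨂[K]^pq.1.2 A)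
    (x : Alt K A U pq.1.1) (y : Alt K A V pq.1.2) :
    MulOpposite.op (concat K A (Finset.HasAntidiagonal.mem_antidiagonal.1 pq.2) (a ⊗ₜ[K] b)) •
        (altTmul x y : AltSummand K A U V d pq)
      = altTmul (MulOpposite.op a • x) (MulOpposite.op b • y) := by
  have hpq := Finset.HasAntidiagonal.mem_antidiagonal.1 pq.2
  change Module.endTensorEndAlgHom (R := K) (S := K) (A := K)
      (M := Alt K A U pq.1.1) (N := Alt K A V pq.1.2)
    (Algebra.TensorProduct.map (Algebra.lsmul K K (Alt K A U pq.1.1))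
      (Algebra.lsmul K K (Alt K A V pq.1.2))
      ((Algebra.TensorProduct.opAlgEquiv K K (⨂[K]^pq.1.1 A) (⨂[K]^pq.1.2 A)).symm
        (MulOpposite.op ((concatAlg K A hpq).symm (concatAlg K A hpq (a ⊗ₜ[K] b))))))
    (x ⊗ₜ[K] y) = _
  rw [AlgEquiv.symm_apply_apply, Algebra.TensorProduct.opAlgEquiv_symm_apply]
  rfl

end Summands

/-! ### Hermitian forms -/

section Forms

variable {K : Type uK} [CommRing K] (ι : K →+* K)

section Hermitian

variable {R : Type*} [Ring R] [Algebra K R] {M : Type*} [AddCommGroup M] [Module K M]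
  [Module Rᵐᵒᵖ M]

variable {ι} in
/-- An `ι`-semilinear involution of `R`, that is an involution that restricts to `ι` on `K`. -/
structure IsInvolution (σ : R →ₛₗ[ι] R) : Prop where
  map_mul : ∀ a b, σ (a * b) = σ b * σ a
  involutive : ∀ a, σ (σ a) = a

variable {ι} in
/-- `h` is a (nondegenerate) `ε`-hermitian form on the right `R`-module `M`
over `(R, σ)`. -/
structure IsHermitian (σ : R →ₛₗ[ι] R) (ε : K) (h : M →ₛₗ[ι] M →ₗ[K] R) : Prop where
  sesquilinear : ∀ (x y : M) (a b : R),
    h (MulOpposite.op a • x) (MulOpposite.op b • y) = σ a * h x y * b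
  hermitian : ∀ x y : M, σ (h x y) = ε • h y x
  nondegenerate : ∀ x : M, (∀ y : M, h x y = 0) → x = 0

end Hermitian

section Semilinear

/-- The `K`-module `W` with its structure twisted by `ι`. -/
def Twist (_ : K →+* K) (W : Type*) : Type _ := W

instance (W : Type*) [AddCommMonoid W] : AddCommMonoid (Twist ι W) :=
  inferInstanceAs (AddCommMonoid W)

instance (W : Type*) [AddCommMonoid W] [Module K W] : Module K (Twist ι W) :=
  Module.compHom W ι

variable {ι} {V W : Type*} [AddCommGroup V] [Module K V] [AddCommGroup W] [Module K W]

/-- The multilinear map `(v₁, …, v_d) ↦ f v₁ ⊗ ⋯ ⊗ f v_d` into the twist of `W^{⊗ d}`. -/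
def semilinearTprod (f : V →ₛₗ[ι] W) (d : ℕ) :
    MultilinearMap K (fun _ : Fin d => V) (Twist ι (⨂[K]^d W)) where
  toFun v := (PiTensorProduct.tprod K fun i => f (v i) : ⨂[K]^d W)
  map_update_add' v i x y := by
    have key : ∀ z : V, (fun j => f (Function.update v i z j))
        = Function.update (fun j => f (v j)) i (f z) :=
      fun z => funext fun j => Function.apply_update (fun _ => (f : V → W)) v i z j
    simp only [key, map_add]
    exact (PiTensorProduct.tprod K (s := fun _ : Fin d => W)).map_update_add _ _ _ _
  map_update_smul' v i c x := by
    have key : ∀ z : V, (fun j => f (Function.update v i z j))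
        = Function.update (fun j => f (v j)) i (f z) :=
      fun z => funext fun j => Function.apply_update (fun _ => (f : V → W)) v i z j
    simp only [key, map_smulₛₗ]
    exact (PiTensorProduct.tprod K (s := fun _ : Fin d => W)).map_update_smul _ _ _ _

/-- The tensor power `f^{⊗ d}` of a semilinear map. -/
def semilinearPow (f : V →ₛₗ[ι] W) (d : ℕ) : ⨂[K]^d V →ₛₗ[ι] ⨂[K]^d W where
  toFun x := PiTensorProduct.lift (semilinearTprod f d) x
  map_add' := map_add (PiTensorProduct.lift (semilinearTprod f d))
  map_smul' := map_smul (PiTensorProduct.lift (semilinearTprod f d))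

lemma semilinearPow_tprod (f : V →ₛₗ[ι] W) {d : ℕ} (v : Fin d → V) :
    semilinearPow f d (PiTensorProduct.tprod K v)
      = PiTensorProduct.tprod K fun i => f (v i) :=
  PiTensorProduct.lift.tprod (φ := semilinearTprod f d) v

end Semilinear

variable {ι} {A : Type uA} [Ring A] [Algebra K A]

/-- `h^{⊗ d}`, with
`h^{⊗ d}(x₁ ⊗ ⋯ ⊗ x_d, y₁ ⊗ ⋯ ⊗ y_d) = h(x₁, y₁) ⊗ ⋯ ⊗ h(x_d, y_d)`. -/
def formPow {V : Type*} [AddCommGroup V] [Module K V] (h : V →ₛₗ[ι] V →ₗ[K] A) (d : ℕ) :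
    ⨂[K]^d V →ₛₗ[ι] ⨂[K]^d V →ₗ[K] ⨂[K]^d A :=
  PiTensorProduct.piTensorHomMap.comp (semilinearPow h d)

lemma formPow_tprod {V : Type*} [AddCommGroup V] [Module K V] (h : V →ₛₗ[ι] V →ₗ[K] A)
    {d : ℕ} (x y : Fin d → V) :
    formPow h d (PiTensorProduct.tprod K x) (PiTensorProduct.tprod K y)
      = PiTensorProduct.tprod K fun i => h (x i) (y i) := by
  simp [formPow, semilinearPow_tprod]

variable {U : Type uU} [AddCommGroup U] [Module K U] [Module Aᵐᵒᵖ U] [IsScalarTower K Aᵐᵒᵖ U]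
  {V : Type uV} [AddCommGroup V] [Module K V] [Module Aᵐᵒᵖ V] [IsScalarTower K Aᵐᵒᵖ V]

/-- `Alt^d(h)`: the form on `Alt^d(V)` defined by
`Alt^d(h)(s_d x, s_d y) = h^{⊗ d}(s_d x, y) = h^{⊗ d}(x, s_d y)`. -/
def altForm (h : V →ₛₗ[ι] V →ₗ[K] A) (d : ℕ) :
    Alt K A V d →ₛₗ[ι] Alt K A V d →ₗ[K] ⨂[K]^d A :=
  Classical.epsilon fun b : Alt K A V d →ₛₗ[ι] Alt K A V d →ₗ[K] ⨂[K]^d A =>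
    ∀ x y : ⨂[K]^d V,
      b (toAlt K A V d x) (toAlt K A V d y) = formPow h d (antisymm K A V d x) y ∧
      b (toAlt K A V d x) (toAlt K A V d y) = formPow h d x (antisymm K A V d y)

/-- The orthogonal sum `h ⊥ h'` on `U ⊕ V`. -/
def orthSum {U V : Type*} [AddCommGroup U] [Module K U] [AddCommGroup V] [Module K V]
    (h : U →ₛₗ[ι] U →ₗ[K] A) (h' : V →ₛₗ[ι] V →ₗ[K] A) :
    (U × V) →ₛₗ[ι] (U × V) →ₗ[K] A :=
  LinearMap.mk₂'ₛₗ ι (RingHom.id K) (fun x y => h x.1 y.1 + h' x.2 y.2)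
    (fun x x' y => by simp only [Prod.fst_add, Prod.snd_add, map_add, LinearMap.add_apply]; abel)
    (fun c x y => by simp)
    (fun x y y' => by simp only [Prod.fst_add, Prod.snd_add, map_add]; abel)
    (fun c x y => by simp)

/-- The tensor product `Alt^p(h) ⊗_K Alt^q(h')` on `Alt^p(U) ⊗ Alt^q(V)`, with values in
`A^{⊗ p} ⊗ A^{⊗ q} = A^{⊗ d}`. -/
def altSummandForm (h : U →ₛₗ[ι] U →ₗ[K] A) (h' : V →ₛₗ[ι] V →ₗ[K] A) {d : ℕ}
    (pq : Finset.HasAntidiagonal.antidiagonal d) :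
    AltSummand K A U V d pq →ₛₗ[ι] AltSummand K A U V d pq →ₗ[K] ⨂[K]^d A :=
  ((LinearMap.compRight K (concat K A (Finset.HasAntidiagonal.mem_antidiagonal.1 pq.2)).toLinearMap).comp
    (TensorProduct.homTensorHomMap (RingHom.id K) (Alt K A U pq.1.1) (Alt K A V pq.1.2)
        (⨂[K]^pq.1.1 A) (⨂[K]^pq.1.2 A))).comp
    (TensorProduct.map (altForm h pq.1.1) (altForm h' pq.1.2))

lemma altSummandForm_tmul (h : U →ₛₗ[ι] U →ₗ[K] A) (h' : V →ₛₗ[ι] V →ₗ[K] A) {d : ℕ}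
    (pq : Finset.HasAntidiagonal.antidiagonal d) (x x' : Alt K A U pq.1.1)
    (y y' : Alt K A V pq.1.2) :
    altSummandForm h h' pq (altTmul x y) (altTmul x' y')
      = concat K A (Finset.HasAntidiagonal.mem_antidiagonal.1 pq.2)
          (altForm h pq.1.1 x x' ⊗ₜ[K] altForm h' pq.1.2 y y') := rfl

/-- The orthogonal sum `⊕_{p+q=d} Alt^p(h) ⊗_K Alt^q(h')`. -/
def altSumForm (h : U →ₛₗ[ι] U →ₗ[K] A) (h' : V →ₛₗ[ι] V →ₗ[K] A) (d : ℕ) :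
    (⨁ pq, AltSummand K A U V d pq) →ₛₗ[ι] (⨁ pq, AltSummand K A U V d pq) →ₗ[K] ⨂[K]^d A :=
  ∑ pq : Finset.HasAntidiagonal.antidiagonal d,
    ((altSummandForm h h' pq).compl₂ (DirectSum.component K _ _ pq)).comp
      (DirectSum.component K _ _ pq)

lemma altSumForm_apply (h : U →ₛₗ[ι] U →ₗ[K] A) (h' : V →ₛₗ[ι] V →ₗ[K] A) (d : ℕ)
    (z z' : ⨁ pq, AltSummand K A U V d pq) :
    altSumForm h h' d z z' = ∑ pq, altSummandForm h h' pq (z pq) (z' pq) := by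
  simp only [altSumForm, LinearMap.sum_apply]
  rfl

end Forms

end AzumayaAlt

end

/-!
The proof replaces the Goldman elements of the various endomorphism algebras by the single Goldman
element `g` of `A`. As `K` is a finite product of fields with `2` invertible, the Azumaya algebra
`A` has a reduced trace `t` (`exists_isSplitTrace`): traces in a splitting over the algebraic
closure of a residue field are fixed by the automorphisms over that field, and their squares, being
traces of the maps `x ↦ a x a`, lie in it; as `2 ≠ 0`, so do the traces. The preimage `g` of `t`
under the sandwich map satisfies `g z = z' g`, with `z'` the exchange of the two factors of `z`,
and `g ^ 2 = 1` (`IsSplitTrace.exists_isGoldman`). For a right `A`-module `V`, the twisted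
exchange `v ⊗ w ↦ (w ⊗ v) g` commutes with `A ⊗ A`, hence comes
from `End_A(V) ⊗ End_A(V)`, and the element that induces it is the Goldman element of `End_A(V)`
(`endAct₂_goldman`). So a permutation `π` acts on `V^{⊗ d}` by permuting the factors and then
multiplying on the right with an element of `A^{⊗ d}` that depends only on `π` and not on `V`
(`ActsBy`, `actsBy_of_isSplitTrace`). This yields naturality in `V` (`ActsBy.goldmanAct_mapPow`),
compatibility with Young subgroups (`ActsBy.goldmanAct_blockPerm`) and, because an involution of
`A` that is semilinear over `K` fixes `g`, the adjointness of `π` and `π⁻¹` for tensor powers of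
hermitian forms (`ActsBy.formPow_goldmanAct`).

Each permutation is uniquely a shuffle times a permutation of the two blocks, so the shuffle
product of `s_p x` and `s_q y` is `s_d (x ⊗ y)` (`altAct_shuffles_concat`); it lies in
`Alt^d(U ⊕ V)`. The power `(U ⊕ V)^{⊗ d}` is the direct sum of the tensor products of `d` factors
`U` or `V`, and permutations permute these summands. Any summand can be moved to
`U^{⊗ p} ⊗ V^{⊗ q}`, which changes `s_d z` only by a sign; this gives surjectivity. The component of
a shuffle product `x # y` in `U^{⊗ p} ⊗ V^{⊗ q}` is `x ⊗ y`, because only the identity shuffle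
preserves the blocks; this gives injectivity (`ActsBy.shuffleSum_bijective`).

The forms on alternating powers are well defined because `s_d` is self-adjoint, and they are
nondegenerate because tensor powers of nondegenerate forms over the semisimple ring `K` are
(`formPow_nondegenerate`). For the isometry, `Alt^d(h ⊥ h')` of `x # y` and `s_d (x' ⊗ y')` is the
value of `(h ⊥ h')^{⊗ d}` at `x # y` and `x' ⊗ y'`, which only depends on the component of `x # y`
in the summand of `x' ⊗ y'` (`ActsBy.altForm_shuffleSum`). The form on the direct sum inherits its
properties along the isometry.
-/

noncomputable section

namespace AzumayaAlt

universe uK uA uU uV uB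

/-! ### Traces of endomorphisms of finite projective modules -/

section ProjTrace

variable (K : Type*) [CommRing K] (M : Type*) [AddCommGroup M] [Module K M]
  [Module.Finite K M] [Module.Projective K M]

/-- The trace of an endomorphism of a finite projective module: evaluation of functionals on
vectors, transported along `M^* ⊗ M ≃ End_K(M)`. On free modules it is `LinearMap.trace`, which
is the zero map on modules that are not free. -/
def projTrace : Module.End K M →ₗ[K] K :=
  contractLeft K M ∘ₗ (dualTensorHomEquiv K M M).symm.toLinearMap

/-- A finite projective module has a dual basis. -/
lemma exists_dual_basis : ∃ (n : ℕ) (v : Fin n → M) (f : Fin n → Module.Dual K M),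
    ∀ x, ∑ i, f i x • v i = x := by
  obtain ⟨n, f, g, -, -, h⟩ := Module.Finite.exists_comp_eq_id_of_projective K M
  refine ⟨n, fun i => f (Pi.single i 1), fun i => LinearMap.proj i ∘ₗ g, fun x => ?_⟩
  have h1 : f (g x) = x := LinearMap.congr_fun h x
  conv_rhs => rw [← h1, ← Finset.univ_sum_single (g x), map_sum]
  refine Finset.sum_congr rfl fun i _ => ?_
  rw [← map_smul]
  congr 1
  ext j
  simp [Pi.single_apply]

variable {K M}

lemma projTrace_dualTensorHom (z : Module.Dual K M ⊗[K] M) :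
    projTrace K M (dualTensorHom K M M z) = contractLeft K M z := by
  exact congrArg (contractLeft K M) ((dualTensorHomEquiv K M M).symm_apply_apply z)

lemma projTrace_eq_sum {n : ℕ} {v : Fin n → M} {f : Fin n → Module.Dual K M}
    (hvf : ∀ x, ∑ i, f i x • v i = x) (α : Module.End K M) :
    projTrace K M α = ∑ i, f i (α (v i)) := by
  have : α = dualTensorHom K M M (∑ i, f i ⊗ₜ[K] α (v i)) := by
    ext x
    conv_lhs => rw [← hvf x]
    simp [dualTensorHom_apply]
  refine (congrArg (projTrace K M) this).trans ?_
  rw [projTrace_dualTensorHom]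
  simp

lemma projTrace_mul_comm (α β : Module.End K M) :
    projTrace K M (α * β) = projTrace K M (β * α) := by
  obtain ⟨n, v, f, hvf⟩ := exists_dual_basis K M
  have key : ∀ α β : Module.End K M,
      projTrace K M (α * β) = ∑ i, ∑ j, f j (β (v i)) * f i (α (v j)) := by
    intro α β
    rw [projTrace_eq_sum hvf]
    refine Finset.sum_congr rfl fun i _ => ?_
    conv_lhs => rw [Module.End.mul_apply, ← hvf (β (v i))]
    simp
  rw [key, key, Finset.sum_comm]
  simp [mul_comm]

lemma projTrace_baseChange (L : Type*) [Field L] [Algebra K L] (α : Module.End K M) :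
    LinearMap.trace L (L ⊗[K] M) (α.baseChange L) = algebraMap K L (projTrace K M α) := by
  obtain ⟨z, rfl⟩ := (dualTensorHomEquiv K M M).surjective α
  change LinearMap.trace L (L ⊗[K] M) ((dualTensorHom K M M z).baseChange L)
    = algebraMap K L (projTrace K M (dualTensorHom K M M z))
  rw [projTrace_dualTensorHom]
  induction z using TensorProduct.induction_on with
  | zero => simp
  | add x y hx hy => simp only [map_add, LinearMap.baseChange_add, hx, hy]
  | tmul f v =>
    have : (dualTensorHom K M M (f ⊗ₜ v)).baseChange L
        = dualTensorHom L (L ⊗[K] M) (L ⊗[K] M)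
            (f.baseChange L ⊗ₜ (1 ⊗ₜ v)) := by
      ext x
      simp [dualTensorHom_apply, TensorProduct.smul_tmul']
    rw [this, LinearMap.trace_eq_contract_apply]
    simp [Algebra.algebraMap_eq_smul_one]

end ProjTrace

/-! ### Split algebras -/

section Splits

variable {K : Type*} [CommRing K] {X Y : Type*} [Ring X] [Algebra K X] [Ring Y] [Algebra K Y]
  {L : Type*} [Field L] [Algebra K L]
  {ν : Type*} [Fintype ν] [DecidableEq ν] {μ : Type*} [Fintype μ] [DecidableEq μ]

/-- A homomorphism from `X` to matrices over a field `L` splits `X` if it induces an isomorphism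
from `L ⊗ X` onto the matrix algebra. For a finite algebra `X` this amounts to the two conditions
that its image generates the matrices and that the dimensions agree. -/
structure Splits (f : X →ₐ[K] Matrix ν ν L) : Prop where
  span_range : Submodule.span L (Set.range f) = ⊤
  finrank_eq : Module.finrank L (L ⊗[K] X) = Fintype.card ν * Fintype.card ν

/-- The homomorphism `L ⊗ X → M_ν(L)` induced by `f`. -/
def splitLift (f : X →ₐ[K] Matrix ν ν L) : L ⊗[K] X →ₐ[L] Matrix ν ν L :=
  Algebra.TensorProduct.lift (Algebra.ofId L _) f fun _ _ => Algebra.commute_algebraMap_left _ _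

@[simp] lemma splitLift_tmul (f : X →ₐ[K] Matrix ν ν L) (c : L) (x : X) :
    splitLift f (c ⊗ₜ x) = c • f x := by
  rw [Algebra.smul_def]
  exact Algebra.TensorProduct.lift_tmul _ _ _ _ _

lemma Splits.bijective [Module.Finite K X] {f : X →ₐ[K] Matrix ν ν L} (hf : Splits f) :
    Function.Bijective (splitLift f) := by
  have hs : Function.Surjective (splitLift f).toLinearMap := by
    rw [← LinearMap.range_eq_top, eq_top_iff, ← hf.span_range, Submodule.span_le]
    rintro _ ⟨x, rfl⟩
    exact ⟨1 ⊗ₜ x, by simp⟩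
  have hr : Module.finrank L (L ⊗[K] X) = Module.finrank L (Matrix ν ν L) := by
    rw [hf.finrank_eq, Module.finrank_matrix]; simp
  exact ⟨(LinearMap.injective_iff_surjective_of_finrank_eq_finrank hr).2 hs, hs⟩

lemma splits_of_algEquiv (φ : (L ⊗[K] X) ≃ₐ[L] Matrix ν ν L) :
    Splits ((φ.toAlgHom.restrictScalars K).comp Algebra.TensorProduct.includeRight) where
  span_range := by
    rw [eq_top_iff]
    rintro M -
    obtain ⟨z, rfl⟩ := φ.surjective M
    induction z using TensorProduct.induction_on with
    | zero => simp
    | add x y hx hy => rw [map_add]; exact add_mem hx hy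
    | tmul c x =>
      have : c ⊗ₜ[K] x = c • ((1 : L) ⊗ₜ[K] x) := by simp [TensorProduct.smul_tmul']
      rw [this, map_smul]
      exact Submodule.smul_mem _ _ (Submodule.subset_span ⟨x, rfl⟩)
  finrank_eq := by
    rw [φ.toLinearEquiv.finrank_eq, Module.finrank_matrix]; simp

/-- Two algebra isomorphisms from the same algebra onto endomorphism algebras of vector spaces
define the same trace, since isomorphisms between such algebras are inner. -/
lemma trace_algEquiv {V W : Type*} [AddCommGroup V] [Module L V] [AddCommGroup W] [Module L W]
    (e : Module.End L V ≃ₐ[L] Module.End L W) (α : Module.End L V) :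
    LinearMap.trace L W (e α) = LinearMap.trace L V α := by
  obtain ⟨T, rfl⟩ := e.eq_linearEquivConjAlgEquiv
  exact LinearMap.trace_conj' α T

/-- The trace of a splitting over `L` does not depend on the splitting. -/
lemma Splits.trace_eq [Module.Finite K X] {f : X →ₐ[K] Matrix ν ν L} (hf : Splits f)
    {g : X →ₐ[K] Matrix μ μ L} (hg : Splits g) (x : X) : (f x).trace = (g x).trace := by
  let F := AlgEquiv.ofBijective _ hf.bijective
  let G := AlgEquiv.ofBijective _ hg.bijective
  let e := (Matrix.toLinAlgEquiv' (R := L) (n := ν)).symm.trans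
    ((F.symm.trans G).trans (Matrix.toLinAlgEquiv' (R := L) (n := μ)))
  have hF : F (1 ⊗ₜ x) = f x := by simp [F]
  have hG : G (1 ⊗ₜ x) = g x := by simp [G]
  have := trace_algEquiv e (Matrix.toLin' (f x))
  have he : e (Matrix.toLin' (f x)) = Matrix.toLin' (g x) := by
    have h1 : (Matrix.toLinAlgEquiv' (R := L) (n := ν)).symm (Matrix.toLin' (f x)) = f x :=
      AlgEquiv.symm_apply_apply _ _
    change Matrix.toLinAlgEquiv' (G (F.symm (Matrix.toLinAlgEquiv'.symm _))) = _
    rw [h1, ← hF, F.symm_apply_apply, hG]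
    rfl
  rw [he, Matrix.trace_toLin'_eq, Matrix.trace_toLin'_eq] at this
  exact this.symm

/-- A splitting stays a splitting after a homomorphism of fields over `K`. -/
lemma Splits.map {L' : Type*} [Field L'] [Algebra K L'] {f : X →ₐ[K] Matrix ν ν L}
    (hf : Splits f) (τ : L →ₐ[K] L') : Splits (τ.mapMatrix.comp f) where
  span_range := by
    have h1 : ∀ M ∈ Submodule.span L (Set.range f),
        τ.mapMatrix M ∈ Submodule.span L' (Set.range (τ.mapMatrix.comp f)) := by
      intro M hM
      induction hM using Submodule.span_induction with
      | mem x hx =>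
        obtain ⟨y, rfl⟩ := hx
        exact Submodule.subset_span ⟨y, rfl⟩
      | zero => simp
      | add x y _ _ hx hy => rw [map_add]; exact add_mem hx hy
      | smul c x _ hx =>
        have : τ.mapMatrix (c • x) = τ c • τ.mapMatrix x := by
          ext i j; simp
        rw [this]
        exact Submodule.smul_mem _ _ hx
    rw [eq_top_iff]
    rintro M -
    rw [Matrix.matrix_eq_sum_single M]
    refine sum_mem fun i _ => sum_mem fun j _ => ?_
    have : Matrix.single i j (M i j) = M i j • τ.mapMatrix (Matrix.single i j 1) := by
      rw [AlgHom.mapMatrix_apply, Matrix.map_single _ _ _ τ]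
      simp
    rw [this]
    exact Submodule.smul_mem _ _ (h1 _ (hf.span_range ▸ Submodule.mem_top))
  finrank_eq := by
    let := τ.toRingHom.toAlgebra
    have : IsScalarTower K L L' := IsScalarTower.of_algebraMap_eq fun c => (τ.commutes c).symm
    rw [← (TensorProduct.AlgebraTensorModule.cancelBaseChange K L L' L' X).finrank_eq,
      Module.finrank_baseChange, hf.finrank_eq]

lemma trace_mapMatrix {L' : Type*} [Field L'] [Algebra K L'] (τ : L →ₐ[K] L')
    (M : Matrix ν ν L) :
    (τ.mapMatrix M).trace = τ M.trace := by
  simp [Matrix.trace]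

lemma Splits.comp_algEquiv {f : X →ₐ[K] Matrix ν ν L} (hf : Splits f) (e : Y ≃ₐ[K] X) :
    Splits (f.comp e.toAlgHom) where
  span_range := by
    rw [← hf.span_range]
    congr 1
    exact e.surjective.range_comp f
  finrank_eq := by
    rw [← hf.finrank_eq, (e.toLinearEquiv.baseChange K L _ _).finrank_eq]

/-- Transposition turns a splitting of `X` into one of the opposite algebra. -/
lemma Splits.op {f : X →ₐ[K] Matrix ν ν L} (hf : Splits f) :
    Splits ((Matrix.transposeAlgEquiv ν K L).symm.toAlgHom.comp (AlgHom.op f)) where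
  span_range := by
    rw [eq_top_iff]
    rintro M -
    have h : M.transpose ∈ Submodule.span L (Set.range f) := hf.span_range ▸ Submodule.mem_top
    rw [← M.transpose_transpose]
    generalize M.transpose = N at h ⊢
    induction h using Submodule.span_induction with
    | mem x hx =>
      obtain ⟨y, rfl⟩ := hx
      exact Submodule.subset_span ⟨MulOpposite.op y, rfl⟩
    | zero => simp
    | add x y _ _ hx hy => rw [Matrix.transpose_add]; exact add_mem hx hy
    | smul c x _ hx => rw [Matrix.transpose_smul]; exact Submodule.smul_mem _ _ hx
  finrank_eq := by
    rw [← hf.finrank_eq]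
    exact ((MulOpposite.opLinearEquiv K (M := X)).baseChange K L).finrank_eq.symm

/-- The tensor product of two splittings, by the Kronecker product of matrices. -/
lemma Splits.kronecker [Module.Finite K X] [Module.Finite K Y]
    {f : X →ₐ[K] Matrix ν ν L} (hf : Splits f) {g : Y →ₐ[K] Matrix μ μ L} (hg : Splits g) :
    ∃ h : X ⊗[K] Y →ₐ[K] Matrix (ν × μ) (ν × μ) L, Splits h ∧
      ∀ x y, h (x ⊗ₜ y) = Matrix.kroneckerMap (· * ·) (f x) (g y) := by
  let E : (Matrix ν ν L) ⊗[L] (Matrix μ μ L) ≃ₐ[L] Matrix (ν × μ) (ν × μ) L :=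
    (Matrix.kroneckerTMulAlgEquiv ν μ L L L L).trans (Algebra.TensorProduct.lid L L).mapMatrix
  have hE : ∀ M N, E (M ⊗ₜ N) = Matrix.kroneckerMap (· * ·) M N := by
    intro M N
    ext ⟨i, i'⟩ ⟨j, j'⟩
    simp [E]
  let h : X ⊗[K] Y →ₐ[K] Matrix (ν × μ) (ν × μ) L :=
    Algebra.TensorProduct.lift
      (((E.toAlgHom.comp Algebra.TensorProduct.includeLeft).restrictScalars K).comp f)
      (((E.toAlgHom.comp Algebra.TensorProduct.includeRight).restrictScalars K).comp g)
      (fun x y => by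
        change E (f x ⊗ₜ 1) * E (1 ⊗ₜ g y) = E (1 ⊗ₜ g y) * E (f x ⊗ₜ 1)
        rw [← map_mul, ← map_mul]
        simp)
  have hh : ∀ x y, h (x ⊗ₜ y) = E (f x ⊗ₜ g y) := by
    intro x y
    change E (f x ⊗ₜ 1) * E (1 ⊗ₜ g y) = _
    rw [← map_mul]
    simp
  refine ⟨h, ⟨?_, ?_⟩, fun x y => by rw [hh, hE]⟩
  · have h2 : ∀ M ∈ Submodule.span L (Set.range f), ∀ N ∈ Submodule.span L (Set.range g),
        E (M ⊗ₜ N) ∈ Submodule.span L (Set.range h) := by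
      intro M hM N hN
      induction hM using Submodule.span_induction with
      | mem x hx =>
        obtain ⟨x, rfl⟩ := hx
        induction hN using Submodule.span_induction with
        | mem y hy =>
          obtain ⟨y, rfl⟩ := hy
          exact Submodule.subset_span ⟨x ⊗ₜ y, hh x y⟩
        | zero => simp
        | add x y _ _ hx hy => rw [TensorProduct.tmul_add, map_add]; exact add_mem hx hy
        | smul c x _ hx =>
          rw [TensorProduct.tmul_smul, map_smul]; exact Submodule.smul_mem _ _ hx
      | zero => simp
      | add x y _ _ hx hy => rw [TensorProduct.add_tmul, map_add]; exact add_mem hx hy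
      | smul c x _ hx =>
        rw [← TensorProduct.smul_tmul', map_smul]; exact Submodule.smul_mem _ _ hx
    rw [eq_top_iff]
    rintro M -
    obtain ⟨z, rfl⟩ := E.surjective M
    induction z using TensorProduct.induction_on with
    | zero => simp
    | add x y hx hy => rw [map_add]; exact add_mem hx hy
    | tmul M N =>
      exact h2 _ (hf.span_range ▸ Submodule.mem_top) _ (hg.span_range ▸ Submodule.mem_top)
  · rw [(TensorProduct.AlgebraTensorModule.distribBaseChange K L X Y).finrank_eq,
      Module.finrank_tensorProduct, hf.finrank_eq, hg.finrank_eq, Fintype.card_prod]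
    ring

lemma isBaseChange_end [IsSemisimpleRing K] (L : Type*) [Field L] [Algebra K L] (V : Type*)
    [AddCommGroup V] [Module K V] [Module.Finite K V] :
    IsBaseChange L (LinearMap.baseChangeHom K L V V) := by
  have := Module.projective_of_isSemisimpleRing K L
  have := Module.projective_of_isSemisimpleRing K V
  have := Module.finitePresentation_of_projective K V
  exact Module.FinitePresentation.isBaseChange_map K V V L

/-- `End_K(V)` is split by `L ⊗ V`, and the trace of the splitting is `projTrace`. -/
lemma exists_splits_end [IsSemisimpleRing K] (V : Type*) [AddCommGroup V] [Module K V]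
    [Module.Finite K V] [Module.Projective K V] :
    ∃ (n : ℕ) (h : Module.End K V →ₐ[K] Matrix (Fin n) (Fin n) L), Splits h ∧
      ∀ α, (h α).trace = algebraMap K L (projTrace K V α) := by
  have hb := isBaseChange_end (K := K) L V
  let b := Module.finBasis L (L ⊗[K] V)
  let e := LinearMap.toMatrixAlgEquiv b
  refine ⟨_, (e.toAlgHom.restrictScalars K).comp (Module.End.baseChangeHom K L V), ⟨?_, ?_⟩, ?_⟩
  · rw [eq_top_iff]
    rintro M -
    obtain ⟨α, rfl⟩ := e.surjective M
    induction α using hb.inductionOn with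
    | zero => simp
    | tmul α => exact Submodule.subset_span ⟨α, rfl⟩
    | smul c x hx => rw [map_smul]; exact Submodule.smul_mem _ _ hx
    | add x y hx hy => rw [map_add]; exact add_mem hx hy
  · rw [hb.equiv.finrank_eq, Module.finrank_linearMap]
    simp
  · intro α
    rw [← projTrace_baseChange, LinearMap.trace_eq_matrix_trace L b]
    rfl

end Splits

/-! ### Existence of splittings -/

section ExistsSplits

variable {K : Type*} [CommRing K] [IsSemisimpleRing K]
  {X : Type*} [Ring X] [Algebra K X] [Module.Finite K X]
  {L : Type*} [Field L] [Algebra K L]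

@[simp] lemma sandwich_tmul {K X : Type*} [CommRing K] [Ring X] [Algebra K X] (a b x : X) :
    sandwich K X (a ⊗ₜ b) x = a * x * b := by
  simp [sandwich]

/-- A two-sided ideal of `L ⊗ X` is stable under the maps `x ↦ a x b`, hence under all
endomorphisms when the sandwich map is surjective; so it is trivial. -/
lemma isSimpleRing_baseChange (hX : Function.Surjective (sandwich K X)) [Nontrivial (L ⊗[K] X)] :
    IsSimpleRing (L ⊗[K] X) := by
  refine ⟨⟨fun I => ?_⟩⟩
  by_cases hI : I = ⊥
  · exact Or.inl hI
  right
  have hb := isBaseChange_end (K := K) L X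
  have hstab : ∀ (α : Module.End L (L ⊗[K] X)), ∀ z ∈ I, α z ∈ I := by
    intro α z hz
    induction α using hb.inductionOn with
    | zero => exact I.zero_mem
    | add α β hα hβ => exact I.add_mem hα hβ
    | smul c α hα =>
      rw [LinearMap.smul_apply, Algebra.smul_def]
      exact I.mul_mem_left _ _ hα
    | tmul α =>
      obtain ⟨w, rfl⟩ := hX α
      rw [LinearMap.baseChangeHom_apply]
      induction w using TensorProduct.induction_on with
      | zero => simp
      | add a b ha hb =>
        rw [map_add, LinearMap.baseChange_add]
        exact I.add_mem ha hb
      | tmul a b =>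
        have : (sandwich K X (a ⊗ₜ b)).baseChange L z = (1 ⊗ₜ a) * z * (1 ⊗ₜ b) := by
          clear hz
          induction z using TensorProduct.induction_on with
          | zero => simp
          | add x y hx hy => simp only [map_add, mul_add, add_mul, hx, hy]
          | tmul c x => simp
        rw [this]
        exact I.mul_mem_right _ _ (I.mul_mem_left _ _ hz)
  obtain ⟨x, hx, hx0⟩ : ∃ x ∈ I, x ≠ 0 := by
    by_contra! h
    exact hI (eq_bot_iff.2 fun x hx => (TwoSidedIdeal.mem_bot _).2 (h x hx))
  obtain ⟨f, hf⟩ := Module.Projective.exists_dual_ne_zero L hx0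
  have h1 := hstab (f.smulRight ((f x)⁻¹ • (1 : L ⊗[K] X))) x hx
  rw [LinearMap.smulRight_apply, smul_smul, mul_inv_cancel₀ hf, one_smul] at h1
  exact (TwoSidedIdeal.one_mem_iff I).1 h1

/-- Since `L ⊗ X` is simple, a homomorphism that is onto after extension of scalars is a
splitting. The zero matrix algebra is excluded, as a zero map need not be injective. -/
lemma splits_of_span_range (hX : Function.Surjective (sandwich K X)) {ν : Type*} [Fintype ν]
    [DecidableEq ν] [Nonempty ν] {f : X →ₐ[K] Matrix ν ν L}
    (hf : Submodule.span L (Set.range f) = ⊤) : Splits f := by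
  have hs : Function.Surjective (splitLift f) := by
    change Function.Surjective (splitLift f).toLinearMap
    rw [← LinearMap.range_eq_top, eq_top_iff, ← hf, Submodule.span_le]
    rintro _ ⟨x, rfl⟩
    exact ⟨1 ⊗ₜ x, by simp⟩
  have : Nontrivial (L ⊗[K] X) := hs.nontrivial
  have := isSimpleRing_baseChange (L := L) hX
  have hi : Function.Injective (splitLift f) := RingHom.injective (splitLift f).toRingHom
  refine ⟨hf, ?_⟩
  rw [(LinearEquiv.ofBijective (splitLift f).toLinearMap ⟨hi, hs⟩).finrank_eq,
    Module.finrank_matrix]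
  simp

/-- Over an algebraically closed field Wedderburn's theorem gives a splitting. -/
lemma exists_splits [IsAlgClosed L] (hX : Function.Surjective (sandwich K X)) :
    ∃ (n : ℕ) (f : X →ₐ[K] Matrix (Fin n) (Fin n) L), Splits f := by
  rcases subsingleton_or_nontrivial (L ⊗[K] X) with h | h
  -- the zero algebra is the algebra of matrices of size `0`
  · refine ⟨0, AlgHom.ofLinearMap 0 (Subsingleton.elim _ _) fun _ _ => Subsingleton.elim _ _,
      Subsingleton.elim _ _, ?_⟩
    simp [Module.finrank_zero_of_subsingleton]
  · have := isSimpleRing_baseChange (L := L) hX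
    obtain ⟨n, -, ⟨φ⟩⟩ :=
      IsSimpleRing.exists_algEquiv_matrix_of_isAlgClosed L (L ⊗[K] X)
    exact ⟨n, _, splits_of_algEquiv φ⟩

/-- If `X ⊗ Y` is the endomorphism algebra of `V`, then the trace of `x ⊗ y` on `V` is the product
of the traces of `x` and `y` in splittings. -/
lemma projTrace_eq_trace_mul_trace {Y : Type*} [Ring Y] [Algebra K Y] [Module.Finite K Y]
    {V : Type*} [AddCommGroup V] [Module K V] [Module.Finite K V] [Module.Projective K V]
    (Θ : X ⊗[K] Y ≃ₐ[K] Module.End K V)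
    {ν : Type*} [Fintype ν] [DecidableEq ν] {f : X →ₐ[K] Matrix ν ν L} (hf : Splits f)
    {μ : Type*} [Fintype μ] [DecidableEq μ] {g : Y →ₐ[K] Matrix μ μ L} (hg : Splits g)
    (x : X) (y : Y) :
    algebraMap K L (projTrace K V (Θ (x ⊗ₜ y))) = (f x).trace * (g y).trace := by
  obtain ⟨h, hh, hfg⟩ := hf.kronecker hg
  obtain ⟨n, h', hh', ht⟩ := exists_splits_end (K := K) (L := L) V
  have : Module.Finite K (Module.End K V) := Module.Finite.of_surjective
    Θ.toLinearMap Θ.surjective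
  rw [← Matrix.trace_kronecker, ← hfg, hh.trace_eq (hh'.comp_algEquiv Θ), ← ht]
  rfl

end ExistsSplits

/-! ### Reduced traces -/

section ReducedTrace

variable {K : Type uK} [CommRing K] {X : Type uB} [Ring X] [Algebra K X] [Module.Finite K X]

lemma IsReducedTrace.trace_eq {t : X →ₗ[K] K} (ht : IsReducedTrace t)
    {L : Type uK} [Field L] [Algebra K L] {n : ℕ} {f : X →ₐ[K] Matrix (Fin n) (Fin n) L}
    (hf : Splits f) (x : X) : (f x).trace = algebraMap K L (t x) := by
  rw [← ht L n (AlgEquiv.ofBijective _ hf.bijective) x]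
  simp

/-- `t` is the trace of some splitting over each algebraically closed field over `K`. -/
def IsSplitTrace (t : X →ₗ[K] K) : Prop :=
  ∀ (L : Type uK) [Field L] [IsAlgClosed L] [Algebra K L],
    ∃ (n : ℕ) (f : X →ₐ[K] Matrix (Fin n) (Fin n) L), Splits f ∧
      ∀ x, (f x).trace = algebraMap K L (t x)

/-- It suffices to test a reduced trace on one splitting over each algebraically closed field. -/
lemma isReducedTrace_of_isAlgClosed {t : X →ₗ[K] K} (h : IsSplitTrace t) :
    IsReducedTrace t := by
  intro L _ _ n φ b
  obtain ⟨m, f, hf, ht⟩ := h (AlgebraicClosure L)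
  let τ := IsScalarTower.toAlgHom K L (AlgebraicClosure L)
  have h1 := ((splits_of_algEquiv φ).map τ).trace_eq hf b
  rw [ht, IsScalarTower.algebraMap_apply K L (AlgebraicClosure L)] at h1
  refine (algebraMap L (AlgebraicClosure L)).injective (Eq.trans ?_ h1)
  exact (trace_mapMatrix τ _).symm

variable [IsArtinianRing K] [IsReduced K]

/-- Elements of a finite product of fields are separated by the maps to algebraically closed
fields. -/
lemma eq_of_algebraMap_closure {c c' : K}
    (h : ∀ (L : Type uK) [Field L] [IsAlgClosed L] [Algebra K L],
      algebraMap K L c = algebraMap K L c') : c = c' := by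
  apply (IsArtinianRing.equivPi K).injective
  funext m
  let _ : Field (K ⧸ m.asIdeal) := Ideal.Quotient.field m.asIdeal
  have := h (AlgebraicClosure (K ⧸ m.asIdeal))
  rw [IsScalarTower.algebraMap_apply K (K ⧸ m.asIdeal) (AlgebraicClosure (K ⧸ m.asIdeal)),
    IsScalarTower.algebraMap_apply K (K ⧸ m.asIdeal) (AlgebraicClosure (K ⧸ m.asIdeal))] at this
  exact (algebraMap (K ⧸ m.asIdeal) (AlgebraicClosure (K ⧸ m.asIdeal))).injective this

lemma IsReducedTrace.unique (hX : Function.Surjective (sandwich K X)) {t t' : X →ₗ[K] K}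
    (ht : IsReducedTrace t) (ht' : IsReducedTrace t') : t = t' := by
  have := IsArtinianRing.isSemisimpleRing_of_isReduced K
  ext x
  refine eq_of_algebraMap_closure fun L _ _ _ => ?_
  obtain ⟨n, f, hf⟩ := exists_splits (L := L) hX
  rw [← ht.trace_eq hf, ← ht'.trace_eq hf]

end ReducedTrace

/-! ### The reduced trace of an Azumaya algebra -/

section Azumaya

variable {K : Type uK} [CommRing K] {A : Type uA} [Ring A] [Algebra K A] [IsAzumaya K A]

lemma sandwich_bijective_of_isAzumaya : Function.Bijective (sandwich K A) := by
  have : (sandwich K A : A ⊗[K] A → Module.End K A) = AlgHom.mulLeftRight K A ∘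
      (TensorProduct.congr (LinearEquiv.refl K A) (MulOpposite.opLinearEquiv K)) := rfl
  rw [this]
  exact IsAzumaya.bij.comp (LinearEquiv.bijective _)

variable [IsSemisimpleRing K]

/-- The trace of `x ↦ a x b` is the product of the traces of `a` and `b`. -/
lemma projTrace_sandwich {L : Type*} [Field L] [Algebra K L] {ν : Type*} [Fintype ν]
    [DecidableEq ν] {f : A →ₐ[K] Matrix ν ν L} (hf : Splits f) (a b : A) :
    algebraMap K L (projTrace K A (sandwich K A (a ⊗ₜ b))) = (f a).trace * (f b).trace := by
  have : Module.Finite K Aᵐᵒᵖ := Module.Finite.equiv (MulOpposite.opLinearEquiv K)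
  let Θ := AlgEquiv.ofBijective (AlgHom.mulLeftRight K A) IsAzumaya.bij
  have h1 : Θ (a ⊗ₜ MulOpposite.op b) = sandwich K A (a ⊗ₜ b) := rfl
  have h2 := projTrace_eq_trace_mul_trace Θ hf hf.op a (MulOpposite.op b)
  rw [h1] at h2
  rw [h2]
  exact congrArg _ (Matrix.trace_transpose (f b))

/-- Over the residue field `F` of a point, traces in a splitting over the algebraic closure lie in
`F`: a trace `c` satisfies `c ^ 2 ∈ F`, and it is fixed by the automorphisms over `F`, because
conjugating a splitting gives another splitting. As `2 ≠ 0`, the conjugate `-c` of an element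
`c ∉ F` with `c ^ 2 ∈ F` is different from `c`. -/
lemma trace_mem_range {F : Type*} [Field F] [Algebra K F] (h2 : (2 : F) ≠ 0) {n : ℕ}
    {f : A →ₐ[K] Matrix (Fin n) (Fin n) (AlgebraicClosure F)} (hf : Splits f) (a : A) :
    (f a).trace ∈ Set.range (algebraMap F (AlgebraicClosure F)) := by
  set c := (f a).trace with hc
  have hfix : ∀ τ : AlgebraicClosure F ≃ₐ[F] AlgebraicClosure F, τ c = c := by
    intro τ
    have h1 := (hf.map (τ.toAlgHom.restrictScalars K)).trace_eq hf a
    rw [hc]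
    exact (trace_mapMatrix (τ.toAlgHom.restrictScalars K) (f a)).symm.trans h1
  obtain ⟨e, he⟩ : ∃ e : F, c ^ 2 = algebraMap F (AlgebraicClosure F) e := by
    refine ⟨algebraMap K F (projTrace K A (sandwich K A (a ⊗ₜ a))), ?_⟩
    rw [← IsScalarTower.algebraMap_apply, projTrace_sandwich hf, sq]
  by_contra hmem
  have hmin : minpoly F c = Polynomial.X ^ 2 - Polynomial.C e := by
    refine (minpoly.unique' F c (Polynomial.monic_X_pow_sub_C e two_ne_zero)
      (by simp [he]) fun q hq => ?_).symm
    rw [Polynomial.degree_X_pow_sub_C two_pos] at hq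
    by_cases hq0 : q = 0
    · exact Or.inl hq0
    refine Or.inr fun hroot => hmem ?_
    exact minpoly.mem_range_of_degree_eq_one F c <| by
      have h1 : (minpoly F c).degree ≤ q.degree := minpoly.degree_le_of_ne_zero F c hq0 hroot
      have h3 := minpoly.degree_pos (Algebra.IsIntegral.isIntegral (R := F) c)
      have h4 : (minpoly F c).degree < 2 := lt_of_le_of_lt h1 (by exact_mod_cast hq)
      rw [Polynomial.degree_eq_natDegree (minpoly.ne_zero
        (Algebra.IsIntegral.isIntegral (R := F) c))] at h3 h4 ⊢
      norm_cast at *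
      omega
  have hconj : IsConjRoot F (-c) c := by
    refine (minpoly.eq_of_irreducible_of_monic
      (minpoly.irreducible (Algebra.IsIntegral.isIntegral (R := F) c)) ?_
      (minpoly.monic (Algebra.IsIntegral.isIntegral (R := F) c))).symm
    rw [hmin]
    simp [he]
  obtain ⟨τ, hτ⟩ := isConjRoot_iff_exists_algEquiv.1 hconj
  rw [hfix τ] at hτ
  have h0 : algebraMap F (AlgebraicClosure F) 2 * c = 0 := by
    rw [map_ofNat, two_mul]
    nth_rewrite 1 [hτ]
    simp
  rcases mul_eq_zero.1 h0 with h | h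
  · exact h2 ((map_eq_zero _).1 h)
  · exact hmem ⟨0, by simp [h]⟩

/-- The reduced trace with values in the residue field of a point. -/
lemma exists_residue_trace {F : Type*} [Field F] [Algebra K F] (h2 : (2 : F) ≠ 0) :
    ∃ (t : A →ₗ[K] F) (n : ℕ) (f : A →ₐ[K] Matrix (Fin n) (Fin n) (AlgebraicClosure F)),
      Splits f ∧ ∀ a, (f a).trace = algebraMap F (AlgebraicClosure F) (t a) := by
  obtain ⟨n, f, hf⟩ := exists_splits (K := K) (X := A) (L := AlgebraicClosure F)
    sandwich_bijective_of_isAzumaya.2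
  choose t ht using fun a => trace_mem_range h2 hf a
  have hinj := (algebraMap F (AlgebraicClosure F)).injective
  refine ⟨⟨⟨t, fun a b => hinj ?_⟩, fun c a => hinj ?_⟩, n, f, hf, fun a => (ht a).symm⟩
  · rw [map_add, ht, ht, ht, map_add, Matrix.trace_add]
  · rw [RingHom.id_apply, ht, map_smul, Matrix.trace_smul, ← ht, Algebra.smul_def,
      Algebra.smul_def, map_mul, ← IsScalarTower.algebraMap_apply]

end Azumaya

section ReducedTrace

variable (K : Type uK) [CommRing K] [IsArtinianRing K] [IsReduced K] (h2 : IsUnit (2 : K))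
  (A : Type uA) [Ring A] [Algebra K A] [IsAzumaya K A]

include h2 in
/-- An Azumaya algebra over a finite product of fields in which `2` is invertible has a reduced
trace, glued from those over the residue fields. -/
lemma exists_isSplitTrace :
    ∃ t : A →ₗ[K] K, IsSplitTrace t := by
  have := IsArtinianRing.isSemisimpleRing_of_isReduced K
  let _ : ∀ m : MaximalSpectrum K, Field (K ⧸ m.asIdeal) :=
    fun m => Ideal.Quotient.field m.asIdeal
  have h (m : MaximalSpectrum K) := exists_residue_trace (K := K) (A := A)
    (F := K ⧸ m.asIdeal)
    (by have := (h2.map (algebraMap K (K ⧸ m.asIdeal))).ne_zero; rwa [map_ofNat] at this)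
  choose t n f hf ht using h
  refine ⟨(IsArtinianRing.equivPi K).symm.toLinearMap ∘ₗ LinearMap.pi t, ?_⟩
  intro L _ _ _
  let m : MaximalSpectrum K := ⟨RingHom.ker (algebraMap K L),
    (RingHom.ker_isPrime (algebraMap K L)).isMaximal'⟩
  let _ : Algebra (K ⧸ m.asIdeal) L := (Ideal.Quotient.lift m.asIdeal (algebraMap K L)
    fun a ha => ha).toAlgebra
  have : IsScalarTower K (K ⧸ m.asIdeal) L := IsScalarTower.of_algebraMap_eq fun c => rfl
  let τ : AlgebraicClosure (K ⧸ m.asIdeal) →ₐ[K ⧸ m.asIdeal] L := IsAlgClosed.lift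
  refine ⟨n m, _, (hf m).map (τ.restrictScalars K), fun a => ?_⟩
  rw [AlgHom.comp_apply, trace_mapMatrix, ht, AlgHom.restrictScalars_apply, τ.commutes,
    IsScalarTower.algebraMap_apply K (K ⧸ m.asIdeal) L]
  congr 1
  have h1 : IsArtinianRing.equivPi K ((IsArtinianRing.equivPi K).symm fun m => t m a)
    = fun m => t m a := AlgEquiv.apply_symm_apply _ _
  exact (congrFun h1 m).symm

variable {K A}

lemma IsSplitTrace.projTrace_sandwich {t : A →ₗ[K] K} (ht : IsSplitTrace t) (a b : A) :
    projTrace K A (sandwich K A (a ⊗ₜ b)) = t a * t b := by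
  have := IsArtinianRing.isSemisimpleRing_of_isReduced K
  refine eq_of_algebraMap_closure fun L _ _ _ => ?_
  obtain ⟨n, f, hf, h⟩ := ht L
  rw [AzumayaAlt.projTrace_sandwich hf, h, h, map_mul]

omit [IsArtinianRing K] [IsReduced K] in
/-- The reduced trace is onto: otherwise the trace would vanish on all matrices over some field, or
the matrices would have size `0`, which is impossible because `A` is faithful over `K`. -/
lemma IsSplitTrace.exists_eq_one [IsSemisimpleRing K] {t : A →ₗ[K] K} (ht : IsSplitTrace t) :
    ∃ a, t a = 1 := by
  by_contra hne
  have hI : (LinearMap.range t : Ideal K) ≠ ⊤ := fun h =>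
    hne ((Ideal.eq_top_iff_one _).1 h)
  obtain ⟨m, hm, hle⟩ := Ideal.exists_le_maximal _ hI
  let _ : Field (K ⧸ m) := Ideal.Quotient.field m
  obtain ⟨n, f, hf, h⟩ := ht (AlgebraicClosure (K ⧸ m))
  have h0 : ∀ M ∈ Submodule.span (AlgebraicClosure (K ⧸ m)) (Set.range f), M.trace = 0 := by
    intro M hM
    induction hM using Submodule.span_induction with
    | mem x hx =>
      obtain ⟨a, rfl⟩ := hx
      rw [h, IsScalarTower.algebraMap_apply K (K ⧸ m), Ideal.Quotient.algebraMap_eq,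
        Ideal.Quotient.eq_zero_iff_mem.2 (hle ⟨a, rfl⟩), map_zero]
    | zero => simp
    | add x y _ _ hx hy => rw [Matrix.trace_add, hx, hy, add_zero]
    | smul c x _ hx => rw [Matrix.trace_smul, hx, smul_zero]
  rcases Nat.eq_zero_or_pos n with rfl | hn
  · have := Module.projective_of_isSemisimpleRing K (AlgebraicClosure (K ⧸ m))
    have hinj := Algebra.TensorProduct.includeLeft_injective (R := K)
      (S := AlgebraicClosure (K ⧸ m)) (A := AlgebraicClosure (K ⧸ m)) (B := A)
      (FaithfulSMul.algebraMap_injective K A)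
    have := hinj.nontrivial
    have h1 := hf.finrank_eq
    rw [Fintype.card_fin] at h1
    exact Module.finrank_pos.ne' h1
  · have := h0 (Matrix.single ⟨0, hn⟩ ⟨0, hn⟩ 1) (hf.span_range ▸ Submodule.mem_top)
    simp at this

/-- The field `L` with its `K`-algebra structure twisted by `ι`. -/
def TwistedField (_ : K →+* K) (L : Type*) : Type _ := L

instance (ι : K →+* K) (L : Type*) [Field L] : Field (TwistedField ι L) :=
  inferInstanceAs (Field L)

instance (ι : K →+* K) (L : Type*) [Field L] [IsAlgClosed L] : IsAlgClosed (TwistedField ι L) :=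
  inferInstanceAs (IsAlgClosed L)

instance (ι : K →+* K) (L : Type*) [Field L] [Algebra K L] : Algebra K (TwistedField ι L) :=
  RingHom.toAlgebra ((algebraMap K L).comp ι : K →+* L)

omit [IsArtinianRing K] [IsReduced K] [IsAzumaya K A] in
lemma IsInvolution.map_one {ι : K →+* K} {σ : A →ₛₗ[ι] A} (hσ : IsInvolution σ) : σ 1 = 1 := by
  have h1 := hσ.map_mul 1 (σ 1)
  rw [one_mul, hσ.involutive, one_mul] at h1
  exact h1.symm

/-- A semilinear involution carries the reduced trace to its conjugate: transposing a splitting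
over the twisted field and composing with the involution gives a splitting. -/
lemma IsSplitTrace.map_involution {t : A →ₗ[K] K} (ht : IsSplitTrace t) {ι : K →+* K}
    (hι : ∀ c, ι (ι c) = c) {σ : A →ₛₗ[ι] A} (hσ : IsInvolution σ) (a : A) :
    t (σ a) = ι (t a) := by
  have := IsArtinianRing.isSemisimpleRing_of_isReduced K
  let t' : A →ₗ[K] K :=
    { toFun := fun a => ι (t (σ a))
      map_add' := by simp
      map_smul' := by simp [hι] }
  have ht' : IsReducedTrace t' := by
    refine isReducedTrace_of_isAlgClosed fun L _ _ _ => ?_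
    obtain ⟨n, f, hf, h⟩ := ht (TwistedField ι L)
    have hσ1 := hσ.map_one
    let g : A →ₐ[K] Matrix (Fin n) (Fin n) L :=
      { toFun := fun a => ((f (σ a)).transpose : Matrix (Fin n) (Fin n) (TwistedField ι L))
        map_one' := by rw [hσ1, map_one, Matrix.transpose_one]; rfl
        map_mul' := fun a b => by
          rw [hσ.map_mul, map_mul, Matrix.transpose_mul]; rfl
        map_zero' := by rw [map_zero, map_zero, Matrix.transpose_zero]; rfl
        map_add' := fun a b => by rw [map_add, map_add, Matrix.transpose_add]; rfl
        commutes' := fun c => by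
          rw [Algebra.algebraMap_eq_smul_one, LinearMap.map_smulₛₗ, hσ1, map_smul, map_one,
            Matrix.transpose_smul, Matrix.transpose_one, Algebra.smul_def, mul_one]
          have h1 : algebraMap K (TwistedField ι L) (ι c) = algebraMap K L c :=
            congrArg (algebraMap K L) (hι c)
          ext i j
          rw [Matrix.algebraMap_matrix_apply, Matrix.algebraMap_matrix_apply, h1]
          rfl }
    have htr : ∀ a, (g a).trace = algebraMap K L (t' a) := fun a =>
      (Matrix.trace_transpose (f (σ a))).trans (h (σ a))
    refine ⟨n, g, ?_, htr⟩
    obtain ⟨a₀, ha₀⟩ := ht.exists_eq_one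
    have hn : Nonempty (Fin n) := by
      by_contra hn
      rw [not_nonempty_iff] at hn
      have := h a₀
      rw [ha₀, map_one, Matrix.trace, Finset.univ_eq_empty, Finset.sum_empty] at this
      exact zero_ne_one this
    refine splits_of_span_range sandwich_bijective_of_isAzumaya.2 ?_
    rw [eq_top_iff]
    rintro M -
    let M' : Matrix (Fin n) (Fin n) (TwistedField ι L) := M.transpose
    have hM : M' ∈ Submodule.span (TwistedField ι L) (Set.range f) :=
      hf.span_range ▸ Submodule.mem_top
    have key : ∀ N ∈ Submodule.span (TwistedField ι L) (Set.range f),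
        @Membership.mem (Matrix (Fin n) (Fin n) L) _ _
          (Submodule.span L (Set.range g)) N.transpose := by
      intro N hN
      induction hN using Submodule.span_induction with
      | mem x hx =>
        obtain ⟨a, rfl⟩ := hx
        refine Submodule.subset_span ⟨σ a, ?_⟩
        change (f (σ (σ a))).transpose = _
        rw [hσ.involutive]
      | zero => exact Submodule.zero_mem _
      | add x y _ _ hx hy => exact add_mem hx hy
      | smul c x _ hx => exact (Submodule.span L (Set.range g)).smul_mem (c : L) hx
    exact key _ hM
  have h1 := LinearMap.congr_fun (ht'.unique sandwich_bijective_of_isAzumaya.2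
    (isReducedTrace_of_isAlgClosed ht)) a
  rw [← h1]
  exact (hι _).symm

end ReducedTrace

/-! ### Goldman elements -/

section IsGoldman

variable {K : Type*} [CommRing K] {X : Type*} [Ring X] [Algebra K X]

/-- The properties of the Goldman element `g` of an algebra `X` with reduced trace `t` from which
everything else follows formally. -/
structure IsGoldman (t : X →ₗ[K] K) (g : X ⊗[K] X) : Prop where
  mul_eq : ∀ z : X ⊗[K] X, g * z = TensorProduct.comm K X X z * g
  comm_eq : TensorProduct.comm K X X g = g
  mul_self : g * g = 1
  sandwich_eq : sandwich K X g = Algebra.linearMap K X ∘ₗ t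

lemma sandwich_mul_tmul (w : X ⊗[K] X) (a b u : X) :
    sandwich K X (w * (a ⊗ₜ b)) u = sandwich K X w (a * u) * b := by
  induction w using TensorProduct.induction_on with
  | zero => simp
  | add x y hx hy => simp only [add_mul, map_add, LinearMap.add_apply, hx, hy]
  | tmul x y => simp [mul_assoc]

lemma sandwich_tmul_mul (w : X ⊗[K] X) (a b u : X) :
    sandwich K X ((a ⊗ₜ b) * w) u = a * sandwich K X w (u * b) := by
  induction w using TensorProduct.induction_on with
  | zero => simp
  | add x y hx hy => simp only [mul_add, map_add, LinearMap.add_apply, hx, hy]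
  | tmul x y => simp [mul_assoc]

lemma sandwich_comm_tmul_mul (w : X ⊗[K] X) (a b u : X) :
    sandwich K X (TensorProduct.comm K X X (w * (a ⊗ₜ b))) u
      = sandwich K X (TensorProduct.comm K X X w) (b * u) * a := by
  induction w using TensorProduct.induction_on with
  | zero => simp
  | add x y hx hy => simp only [add_mul, map_add, LinearMap.add_apply, hx, hy]
  | tmul x y => simp [mul_assoc]

lemma sandwich_comm_mul_tmul (w : X ⊗[K] X) (a b u : X) :
    sandwich K X (TensorProduct.comm K X X ((a ⊗ₜ b) * w)) u
      = b * sandwich K X (TensorProduct.comm K X X w) (u * a) := by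
  induction w using TensorProduct.induction_on with
  | zero => simp
  | add x y hx hy => simp only [mul_add, map_add, LinearMap.add_apply, hx, hy]
  | tmul x y => simp [mul_assoc]

namespace IsGoldman

variable {t : X →ₗ[K] K} {g : X ⊗[K] X} (hg : IsGoldman t g) {S : Finset (X × X)}
  (hS : g = ∑ i ∈ S, i.1 ⊗ₜ[K] i.2)

include hg

lemma sandwich_apply (u : X) : sandwich K X g u = algebraMap K X (t u) := by
  rw [hg.sandwich_eq]; rfl

include hS

lemma sum_mul_mul (u : X) : ∑ i ∈ S, i.1 * u * i.2 = algebraMap K X (t u) := by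
  rw [← hg.sandwich_apply, hS]
  simp

lemma sum_mul_mul' (u : X) : ∑ i ∈ S, i.2 * u * i.1 = algebraMap K X (t u) := by
  rw [← hg.sandwich_apply, ← hg.comm_eq, hS]
  simp

lemma sum_left (u : X) : ∑ i ∈ S, t (i.1 * u) • i.2 = u := by
  have h : sandwich K X (g * g) u = ∑ i ∈ S, t (i.1 * u) • i.2 := by
    nth_rewrite 2 [hS]
    rw [Finset.mul_sum, map_sum, LinearMap.sum_apply]
    refine Finset.sum_congr rfl fun i _ => ?_
    rw [sandwich_mul_tmul, hg.sandwich_apply, ← Algebra.smul_def]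
  rw [← h, hg.mul_self, Algebra.TensorProduct.one_def]
  simp

lemma sum_right (u : X) : ∑ i ∈ S, t (u * i.2) • i.1 = u := by
  have h : sandwich K X (g * g) u = ∑ i ∈ S, t (u * i.2) • i.1 := by
    nth_rewrite 1 [hS]
    rw [Finset.sum_mul, map_sum, LinearMap.sum_apply]
    refine Finset.sum_congr rfl fun i _ => ?_
    rw [sandwich_tmul_mul, hg.sandwich_apply, ← Algebra.commutes, ← Algebra.smul_def]
  rw [← h, hg.mul_self, Algebra.TensorProduct.one_def]
  simp

lemma sum_tmul_mul (a : X) :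
    ∑ i ∈ S, (i.1 ⊗ₜ[K] (i.2 * a)) = ∑ i ∈ S, ((a * i.1) ⊗ₜ[K] i.2) := by
  have := hg.mul_eq (1 ⊗ₜ a)
  rw [hS, Finset.sum_mul, TensorProduct.comm_tmul, Finset.mul_sum] at this
  simpa using this

omit hS

lemma rTensor_sandwich (z : X ⊗[K] X) : (sandwich K X z).rTensor X g = z * g := by
  induction z using TensorProduct.induction_on with
  | zero => simp
  | add x y hx hy =>
    simp only [map_add, LinearMap.rTensor_add, LinearMap.add_apply, hx, hy, add_mul]
  | tmul a b =>
    have h1 : (a ⊗ₜ b) * g = (a ⊗ₜ 1) * (g * (b ⊗ₜ 1)) := by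
      rw [hg.mul_eq, TensorProduct.comm_tmul, ← mul_assoc]
      simp
    rw [h1]
    obtain ⟨S, hS⟩ := TensorProduct.exists_finset g
    rw [hS, map_sum, Finset.sum_mul, Finset.mul_sum]
    simp [mul_assoc]

/-- The preimage of an endomorphism `θ` under the sandwich map is `(θ ⊗ 1)(g) g`. -/
lemma sandwich_bijective : Function.Bijective (sandwich K X) := by
  have hz : ∀ z : X ⊗[K] X, (sandwich K X z).rTensor X g * g = z := fun z => by
    rw [hg.rTensor_sandwich, mul_assoc, hg.mul_self, mul_one]
  refine ⟨fun z z' h => by rw [← hz z, h, hz], fun θ => ⟨θ.rTensor X g * g, ?_⟩⟩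
  ext u
  obtain ⟨S, hS⟩ := TensorProduct.exists_finset g
  have h : sandwich K X (θ.rTensor X g * g) u = ∑ i ∈ S, t (u * i.2) • θ i.1 := by
    nth_rewrite 1 [hS]
    rw [map_sum, Finset.sum_mul, map_sum, LinearMap.sum_apply]
    refine Finset.sum_congr rfl fun i _ => ?_
    rw [LinearMap.rTensor_tmul, sandwich_tmul_mul, hg.sandwich_apply, ← Algebra.commutes,
      ← Algebra.smul_def]
  rw [h]
  conv_rhs => rw [← hg.sum_right hS u, map_sum]
  simp

/-- A trace function on `X` is a multiple of the reduced trace. -/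
lemma trace_eq_mul {a₀ : X} (ha₀ : t a₀ = 1) {τ : X →ₗ[K] K} (hτ : ∀ a b, τ (a * b) = τ (b * a))
    (a : X) : τ a = t a * τ a₀ := by
  obtain ⟨S, hS⟩ := TensorProduct.exists_finset g
  have h1 : a = ∑ i ∈ S, a * (i.1 * a₀ * i.2) := by
    rw [← Finset.mul_sum, hg.sum_mul_mul hS, ha₀, map_one, mul_one]
  conv_lhs => rw [h1, map_sum]
  have h2 : ∀ i ∈ S, τ (a * (i.1 * a₀ * i.2)) = τ (i.2 * a * i.1 * a₀) := fun i _ => by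
    rw [← mul_assoc, hτ]
    simp only [mul_assoc]
  rw [Finset.sum_congr rfl h2, ← map_sum, ← Finset.sum_mul, hg.sum_mul_mul' hS,
    ← Algebra.smul_def, map_smul, smul_eq_mul]

end IsGoldman

end IsGoldman

section Azumaya

variable {K : Type uK} [CommRing K] [IsArtinianRing K] [IsReduced K]
  {A : Type uA} [Ring A] [Algebra K A] [IsAzumaya K A]

lemma IsSplitTrace.mul_comm {X : Type*} [Ring X] [Algebra K X] [Module.Finite K X]
    {t : X →ₗ[K] K} (ht : IsSplitTrace t) (a b : X) : t (a * b) = t (b * a) := by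
  refine eq_of_algebraMap_closure fun L _ _ _ => ?_
  obtain ⟨n, f, hf, h⟩ := ht L
  rw [← h, ← h, map_mul, map_mul, Matrix.trace_mul_comm]

/-- The reduced trace of an Azumaya algebra has a Goldman element. The normalization `g ^ 2 = 1`
comes from the formula for the trace of `x ↦ a x b`; the other properties persist when the trace
and `g` are scaled by a unit. -/
lemma IsSplitTrace.exists_isGoldman {t : A →ₗ[K] K} (ht : IsSplitTrace t) :
    ∃ g : A ⊗[K] A, IsGoldman t g := by
  have := IsArtinianRing.isSemisimpleRing_of_isReduced K
  obtain ⟨a₀, ha₀⟩ := ht.exists_eq_one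
  have hinj := (sandwich_bijective_of_isAzumaya (K := K) (A := A)).1
  obtain ⟨g, hg⟩ := (sandwich_bijective_of_isAzumaya (K := K) (A := A)).2
    (Algebra.linearMap K A ∘ₗ t)
  have hg' : ∀ u, sandwich K A g u = algebraMap K A (t u) := fun u => by rw [hg]; rfl
  have hmul : ∀ z : A ⊗[K] A, g * z = TensorProduct.comm K A A z * g := by
    intro z
    induction z using TensorProduct.induction_on with
    | zero => simp
    | add x y hx hy => rw [mul_add, map_add, add_mul, hx, hy]
    | tmul a b =>
      apply hinj
      ext u
      rw [sandwich_mul_tmul, TensorProduct.comm_tmul, sandwich_tmul_mul, hg', hg',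
        Algebra.commutes, ht.mul_comm]
  obtain ⟨S, hS⟩ := TensorProduct.exists_finset g
  have hsum : ∀ u, ∑ i ∈ S, i.1 * u * i.2 = algebraMap K A (t u) := by
    intro u; rw [← hg', hS]; simp
  have hcentral : ∀ c : A, (∀ a, a * c = c * a) → c = algebraMap K A (t (a₀ * c)) := by
    intro c hc
    rw [← hsum]
    have : ∀ i ∈ S, i.1 * (a₀ * c) * i.2 = c * (i.1 * a₀ * i.2) := fun i _ => by
      simp only [← mul_assoc, ← hc i.1]
      simp only [mul_assoc, hc]
    rw [Finset.sum_congr rfl this, ← Finset.mul_sum, hsum, ha₀, map_one, mul_one]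
  have hcomm : TensorProduct.comm K A A g = g := by
    apply hinj
    ext u
    set s := sandwich K A (TensorProduct.comm K A A g) u with hs
    have hsu : s = ∑ i ∈ S, i.2 * u * i.1 := by rw [hs, hS]; simp
    rw [hg', hcentral s]
    · congr 1
      have h2 : ∀ i ∈ S, t (a₀ * (i.2 * u * i.1)) = t (i.1 * a₀ * i.2 * u) := fun i _ => by
        rw [← mul_assoc, ht.mul_comm]
        simp only [mul_assoc]
      rw [hsu, Finset.mul_sum, map_sum, Finset.sum_congr rfl h2, ← map_sum, ← Finset.sum_mul,
        hsum, ha₀, map_one, one_mul]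
    · intro a
      have h1 := congrArg (fun z => sandwich K A (TensorProduct.comm K A A z) u)
        (hmul (a ⊗ₜ 1))
      simp only [TensorProduct.comm_tmul, sandwich_comm_tmul_mul, sandwich_comm_mul_tmul,
        one_mul, mul_one] at h1
      exact h1.symm
  have hleft : ∀ u, ∑ i ∈ S, t (i.1 * u) • i.2 = u * ∑ i ∈ S, t i.1 • i.2 := by
    intro u
    have := congrArg ((TensorProduct.lid K A).toLinearMap ∘ₗ t.rTensor A) (hmul (u ⊗ₜ 1))
    rw [hS, Finset.sum_mul, TensorProduct.comm_tmul, Finset.mul_sum] at this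
    simpa [Finset.mul_sum] using this
  have he : ∑ i ∈ S, t i.1 • i.2 = 1 := by
    set e := ∑ i ∈ S, t i.1 • i.2 with he
    have htr : ∀ a, t (a * e) = t a := by
      intro a
      have h1 : sandwich K A (g * (a ⊗ₜ 1))
          = dualTensorHom K A A ((t ∘ₗ LinearMap.mulLeft K a) ⊗ₜ 1) := by
        ext u
        rw [sandwich_mul_tmul, hg']
        simp [dualTensorHom_apply, Algebra.algebraMap_eq_smul_one]
      have h2 := congrArg (projTrace K A) h1
      rw [projTrace_dualTensorHom, hS, Finset.sum_mul, map_sum, map_sum] at h2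
      simp only [Algebra.TensorProduct.tmul_mul_tmul, mul_one, ht.projTrace_sandwich,
        contractLeft_apply, LinearMap.comp_apply, LinearMap.mulLeft_apply] at h2
      rw [← h2, ← hleft, map_sum]
      simp
    rw [hcentral e, htr, ha₀, map_one]
    intro a
    rw [← hleft, he, Finset.sum_mul]
    have := congrArg ((TensorProduct.lid K A).toLinearMap ∘ₗ t.rTensor A) (hmul (1 ⊗ₜ a))
    rw [hS, Finset.sum_mul, TensorProduct.comm_tmul, Finset.mul_sum] at this
    simp only [ht.mul_comm _ a]
    simpa using this.symm
  refine ⟨g, hmul, hcomm, ?_, hg⟩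
  apply hinj
  ext u
  have h : sandwich K A (g * g) u = ∑ i ∈ S, t (i.1 * u) • i.2 := by
    nth_rewrite 2 [hS]
    rw [Finset.mul_sum, map_sum, LinearMap.sum_apply]
    refine Finset.sum_congr rfl fun i _ => ?_
    rw [sandwich_mul_tmul, hg', ← Algebra.smul_def]
  rw [h, hleft, he, Algebra.TensorProduct.one_def]
  simp

/-- A semilinear involution fixes the Goldman element. -/
lemma IsGoldman.sum_map_involution {t : A →ₗ[K] K} (ht : IsSplitTrace t) {g : A ⊗[K] A}
    (hg : IsGoldman t g) {ι : K →+* K} (hι : ∀ c, ι (ι c) = c) {σ : A →ₛₗ[ι] A}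
    (hσ : IsInvolution σ) {S : Finset (A × A)} (hS : g = ∑ i ∈ S, i.1 ⊗ₜ[K] i.2) :
    ∑ i ∈ S, σ i.1 ⊗ₜ[K] σ i.2 = g := by
  apply (sandwich_bijective_of_isAzumaya (K := K) (A := A)).1
  have hσ1 := hσ.map_one
  ext u
  obtain ⟨a, rfl⟩ : ∃ a, σ a = u := ⟨σ u, hσ.involutive u⟩
  rw [hg.sandwich_apply, ht.map_involution hι hσ, map_sum, LinearMap.sum_apply]
  have h : ∀ i ∈ S, sandwich K A (σ i.1 ⊗ₜ σ i.2) (σ a) = σ (i.2 * a * i.1) := fun i _ => by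
    rw [hσ.map_mul, hσ.map_mul, sandwich_tmul, mul_assoc]
  rw [Finset.sum_congr rfl h, ← map_sum, hg.sum_mul_mul' hS, Algebra.algebraMap_eq_smul_one,
    LinearMap.map_smulₛₗ, hσ1, Algebra.algebraMap_eq_smul_one]

end Azumaya

/-! ### The Goldman element of an endomorphism algebra -/

section EndGoldman

variable {K : Type*} [CommRing K] {A : Type*} [Ring A] [Algebra K A]
  {V : Type*} [AddCommGroup V] [Module K V] [Module Aᵐᵒᵖ V] [IsScalarTower K Aᵐᵒᵖ V]

variable (K A V) in
/-- The right multiplication of `A ⊗ A` on `V ⊗ V`. -/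
def rightMul₂ : A ⊗[K] A →ₗ[K] Module.End K (V ⊗[K] V) :=
  TensorProduct.homTensorHomMap (RingHom.id K) V V V V ∘ₗ
    TensorProduct.map (rightMul K A V) (rightMul K A V)

@[simp] lemma rightMul₂_tmul (a b : A) (v w : V) :
    rightMul₂ K A V (a ⊗ₜ b) (v ⊗ₜ w) = (MulOpposite.op a • v) ⊗ₜ (MulOpposite.op b • w) := by
  simp [rightMul₂]

lemma rightMul₂_mul (z z' : A ⊗[K] A) :
    rightMul₂ K A V (z * z') = rightMul₂ K A V z' * rightMul₂ K A V z := by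
  induction z using TensorProduct.induction_on with
  | zero => simp
  | add x y hx hy => simp only [add_mul, map_add, mul_add, hx, hy]
  | tmul a b =>
    induction z' using TensorProduct.induction_on with
    | zero => simp
    | add x y hx hy => simp only [add_mul, map_add, mul_add, hx, hy]
    | tmul a' b' =>
      ext v w
      simp [mul_smul]

lemma rightMul₂_one : rightMul₂ K A V 1 = 1 := by
  ext v w
  simp [Algebra.TensorProduct.one_def]

lemma rightMul₂_comm (z : A ⊗[K] A) :
    (TensorProduct.comm K V V).toLinearMap ∘ₗ rightMul₂ K A V z
      = rightMul₂ K A V (TensorProduct.comm K A A z) ∘ₗ (TensorProduct.comm K V V).toLinearMap := by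
  induction z using TensorProduct.induction_on with
  | zero => simp
  | add x y hx hy => simp only [map_add, LinearMap.comp_add, LinearMap.add_comp, hx, hy]
  | tmul a b =>
    ext v w
    simp

/-- The twisted exchange `v ⊗ w ↦ (w ⊗ v) g`. -/
def twistedSwap (V : Type*) [AddCommGroup V] [Module K V] [Module Aᵐᵒᵖ V] [IsScalarTower K Aᵐᵒᵖ V]
    (g : A ⊗[K] A) : Module.End K (V ⊗[K] V) :=
  rightMul₂ K A V g ∘ₗ (TensorProduct.comm K V V).toLinearMap

@[simp] lemma twistedSwap_tmul (g : A ⊗[K] A) (v w : V) :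
    twistedSwap V g (v ⊗ₜ w) = rightMul₂ K A V g (w ⊗ₜ v) := rfl

variable (K A V) in
/-- The algebra homomorphism from `End_A(V)` to `End_K(V)`. -/
def endRes : Module.End Aᵐᵒᵖ V →ₐ[K] Module.End K V :=
  AlgHom.ofLinearMap (LinearMap.restrictScalarsₗ K Aᵐᵒᵖ V V K) rfl fun _ _ => rfl

@[simp] lemma endRes_apply (b : Module.End Aᵐᵒᵖ V) (v : V) : endRes K A V b v = b v := rfl

variable (K A V) in
/-- The left action of `End_A(V) ⊗ End_A(V)` on `V ⊗ V`. -/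
def endAct₂ : (Module.End Aᵐᵒᵖ V) ⊗[K] (Module.End Aᵐᵒᵖ V) →ₗ[K] Module.End K (V ⊗[K] V) :=
  TensorProduct.homTensorHomMap (RingHom.id K) V V V V ∘ₗ
    TensorProduct.map (endRes K A V).toLinearMap (endRes K A V).toLinearMap

@[simp] lemma endAct₂_tmul (b c : Module.End Aᵐᵒᵖ V) (v w : V) :
    endAct₂ K A V (b ⊗ₜ c) (v ⊗ₜ w) = b v ⊗ₜ c w := by
  simp [endAct₂]

lemma endAct₂_mul (z z' : (Module.End Aᵐᵒᵖ V) ⊗[K] (Module.End Aᵐᵒᵖ V)) :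
    endAct₂ K A V (z * z') = endAct₂ K A V z * endAct₂ K A V z' := by
  induction z using TensorProduct.induction_on with
  | zero => simp
  | add x y hx hy => simp only [add_mul, map_add, hx, hy]
  | tmul a b =>
    induction z' using TensorProduct.induction_on with
    | zero => simp
    | add x y hx hy => simp only [map_add, mul_add, hx, hy]
    | tmul a' b' =>
      ext v w
      simp

lemma endAct₂_one : endAct₂ K A V 1 = 1 := by
  ext v w
  simp [Algebra.TensorProduct.one_def]

lemma twistedSwap_endAct₂ (g : A ⊗[K] A) (z : (Module.End Aᵐᵒᵖ V) ⊗[K] (Module.End Aᵐᵒᵖ V)) :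
    twistedSwap V g * endAct₂ K A V z
      = endAct₂ K A V (TensorProduct.comm K _ _ z) * twistedSwap V g := by
  induction z using TensorProduct.induction_on with
  | zero => simp
  | add x y hx hy => simp only [add_mul, map_add, mul_add, hx, hy]
  | tmul b c =>
    ext v w
    simp only [TensorProduct.AlgebraTensorModule.curry_apply, LinearMap.restrictScalars_self,
      TensorProduct.curry_apply, Module.End.mul_apply, endAct₂_tmul, twistedSwap_tmul,
      TensorProduct.comm_tmul]
    induction g using TensorProduct.induction_on with
    | zero => simp
    | add x y hx hy => simp only [map_add, LinearMap.add_apply, hx, hy]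
    | tmul x y => simp

lemma endRes_mul_rightMul (a : A) (b : Module.End Aᵐᵒᵖ V) :
    endRes K A V b * rightMul K A V a = rightMul K A V a * endRes K A V b := by
  ext v; simp

lemma rightMul_mul (a b : A) : rightMul K A V (a * b) = rightMul K A V b * rightMul K A V a := by
  ext v; simp [mul_smul]

/-- The trace `b ↦ tr_V(b a₀)` on `End_A(V)`. -/
def endTrace (K : Type*) [CommRing K] {A : Type*} [Ring A] [Algebra K A]
    (V : Type*) [AddCommGroup V] [Module K V] [Module Aᵐᵒᵖ V] [IsScalarTower K Aᵐᵒᵖ V]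
    [Module.Finite K V] [Module.Projective K V] (a₀ : A) : Module.End Aᵐᵒᵖ V →ₗ[K] K :=
  projTrace K V ∘ₗ LinearMap.mulRight K (rightMul K A V a₀) ∘ₗ (endRes K A V).toLinearMap

lemma endTrace_apply [Module.Finite K V] [Module.Projective K V] (a₀ : A) (b : Module.End Aᵐᵒᵖ V) :
    endTrace K V a₀ b = projTrace K V (endRes K A V b * rightMul K A V a₀) := rfl

variable (K A V) in
/-- The algebra homomorphism `End_A(V) ⊗ Aᵒᵖ → End_K(V)`. -/
def endTensorOp : Module.End Aᵐᵒᵖ V ⊗[K] Aᵐᵒᵖ →ₐ[K] Module.End K V :=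
  Algebra.TensorProduct.lift (endRes K A V) (Algebra.lsmul K K V) fun b a => by
    ext v
    simp

lemma endTensorOp_tmul (b : Module.End Aᵐᵒᵖ V) (a : A) :
    endTensorOp K A V (b ⊗ₜ MulOpposite.op a) = endRes K A V b * rightMul K A V a :=
  Algebra.TensorProduct.lift_tmul _ _ _ _ _

variable {t : A →ₗ[K] K} {g : A ⊗[K] A} (hg : IsGoldman t g)
  {S : Finset (A × A)} (hS : g = ∑ i ∈ S, i.1 ⊗ₜ[K] i.2)

include hg

lemma twistedSwap_rightMul₂ (z : A ⊗[K] A) :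
    twistedSwap V g * rightMul₂ K A V z = rightMul₂ K A V z * twistedSwap V g := by
  change (_ ∘ₗ _) ∘ₗ _ = rightMul₂ K A V z * (rightMul₂ K A V g * _)
  rw [LinearMap.comp_assoc, rightMul₂_comm, ← mul_assoc, ← rightMul₂_mul, hg.mul_eq,
    rightMul₂_mul]
  rfl

lemma twistedSwap_mul_self : twistedSwap V g * twistedSwap V g = 1 := by
  have h1 : twistedSwap V g * twistedSwap V g = rightMul₂ K A V g *
    ((TensorProduct.comm K V V).toLinearMap ∘ₗ rightMul₂ K A V g) ∘ₗ
      (TensorProduct.comm K V V).toLinearMap := rfl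
  rw [h1, rightMul₂_comm, hg.comm_eq]
  have h2 : (rightMul₂ K A V g ∘ₗ (TensorProduct.comm K V V).toLinearMap) ∘ₗ
      (TensorProduct.comm K V V).toLinearMap = rightMul₂ K A V g := by
    ext v w; simp
  rw [h2, ← rightMul₂_mul, hg.mul_self, rightMul₂_one]

lemma projTrace_endRes_mul_rightMul [Module.Finite K V] [Module.Projective K V]
    {a₀ : A} (ha₀ : t a₀ = 1) (a : A) (b : Module.End Aᵐᵒᵖ V) :
    projTrace K V (endRes K A V b * rightMul K A V a) = t a * endTrace K V a₀ b := by
  refine IsGoldman.trace_eq_mul hg ha₀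
    (τ := projTrace K V ∘ₗ LinearMap.mulLeft K (endRes K A V b) ∘ₗ rightMul K A V) ?_ a
  intro a a'
  simp only [LinearMap.comp_apply, LinearMap.mulLeft_apply]
  rw [rightMul_mul, rightMul_mul, ← mul_assoc, projTrace_mul_comm, ← mul_assoc,
    ← endRes_mul_rightMul, mul_assoc]

include hS

/-- The averaging map from `End_K(V)` to `End_A(V)`. -/
def averaging (c : A) : Module.End K V →ₗ[K] Module.End Aᵐᵒᵖ V where
  toFun α :=
    { toFun := fun v => ∑ i ∈ S, MulOpposite.op i.2 • α (MulOpposite.op (i.1 * c) • v)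
      map_add' := fun v w => by simp [Finset.sum_add_distrib]
      map_smul' := fun a v => by
        obtain ⟨a, rfl⟩ := MulOpposite.op_surjective a
        let F : A ⊗[K] A →ₗ[K] V := TensorProduct.lift
          (LinearMap.mk₂ K (fun x y : A => MulOpposite.op y • α (MulOpposite.op (x * c) • v))
            (fun x x' y => by simp [add_mul, add_smul]) (fun r x y => by
              rw [smul_mul_assoc, MulOpposite.op_smul, smul_assoc, map_smul, smul_comm])
            (fun x y y' => by simp [add_smul]) (fun r x y => by simp))
        have := congrArg F (hg.sum_tmul_mul hS a)
        rw [map_sum, map_sum] at this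
        simp only [F, TensorProduct.lift.tmul, LinearMap.mk₂_apply] at this
        simp only [RingHom.id_apply, Finset.smul_sum, smul_smul, ← MulOpposite.op_mul]
        simpa only [mul_assoc] using this.symm }
  map_add' α β := by
    ext v
    simp [Finset.sum_add_distrib]
  map_smul' r α := by
    ext v
    simp [Finset.smul_sum, smul_comm r]

lemma averaging_apply (c : A) (α : Module.End K V) (v : V) :
    averaging hg hS c α v
      = ∑ i ∈ S, MulOpposite.op i.2 • α (MulOpposite.op (i.1 * c) • v) := rfl

lemma averaging_endRes_mul (c a : A) (b : Module.End Aᵐᵒᵖ V) :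
    averaging hg hS c (endRes K A V b * rightMul K A V a) = t (c * a) • b := by
  ext v
  rw [averaging_apply]
  have : ∀ i ∈ S, MulOpposite.op i.2 • (endRes K A V b * rightMul K A V a)
      (MulOpposite.op (i.1 * c) • v) = MulOpposite.op (i.1 * (c * a) * i.2) • b v := fun i _ => by
    simp [smul_smul, mul_assoc]
  rw [Finset.sum_congr rfl this, ← Finset.sum_smul, ← Finset.op_sum, hg.sum_mul_mul hS,
    Algebra.algebraMap_eq_smul_one, MulOpposite.op_smul, smul_assoc]
  simp

lemma averaging_endRes {a₀ : A} (ha₀ : t a₀ = 1) (b : Module.End Aᵐᵒᵖ V) :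
    averaging hg hS a₀ (endRes K A V b) = b := by
  have := averaging_endRes_mul hg hS a₀ 1 b
  have h1 : rightMul K A V 1 = 1 := by ext v; simp
  rwa [h1, mul_one, mul_one, ha₀, one_smul] at this

variable [Module.Finite K V] [Module.Projective K V]

lemma endAct₂_injective {a₀ : A} (ha₀ : t a₀ = 1) : Function.Injective (endAct₂ K A V) := by
  have h1 : Function.Injective
      (TensorProduct.map (endRes K A V).toLinearMap (endRes K A V).toLinearMap) := by
    refine Function.LeftInverse.injective
      (g := TensorProduct.map (averaging hg hS a₀) (averaging hg hS a₀)) fun z => ?_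
    rw [← LinearMap.comp_apply, ← TensorProduct.map_comp]
    have : averaging hg hS a₀ ∘ₗ (endRes K A V).toLinearMap = LinearMap.id :=
      LinearMap.ext fun b => averaging_endRes hg hS ha₀ b
    rw [this, TensorProduct.map_id, LinearMap.id_apply]
  have h2 := (homTensorHomEquiv K V V V V).injective.comp h1
  exact fun z z' h => h2 (by
    rw [Function.comp_apply, Function.comp_apply, homTensorHomEquiv_apply, homTensorHomEquiv_apply]
    exact h)

/-- The twisted exchange is given by an element of `End_A(V) ⊗ End_A(V)`: it commutes with
`A ⊗ A`, so averaging a preimage in `End_K(V) ⊗ End_K(V)` does not change its action. -/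
lemma exists_endAct₂_eq {a₀ : A} (ha₀ : t a₀ = 1) :
    ∃ γ : (Module.End Aᵐᵒᵖ V) ⊗[K] (Module.End Aᵐᵒᵖ V),
      endAct₂ K A V γ = twistedSwap V g := by
  obtain ⟨w, hw⟩ := (homTensorHomEquiv K V V V V).surjective (twistedSwap V g)
  have hw' : TensorProduct.homTensorHomMap (RingHom.id K) V V V V w = twistedSwap V g :=
    (homTensorHomEquiv_apply w).symm.trans hw
  refine ⟨TensorProduct.map (averaging hg hS a₀) (averaging hg hS a₀) w, ?_⟩
  have key : endAct₂ K A V (TensorProduct.map (averaging hg hS a₀) (averaging hg hS a₀) w)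
      = ∑ i ∈ S, ∑ j ∈ S, rightMul₂ K A V (i.2 ⊗ₜ j.2) *
          (TensorProduct.homTensorHomMap (RingHom.id K) V V V V w *
            rightMul₂ K A V ((i.1 * a₀) ⊗ₜ (j.1 * a₀))) := by
    clear hw hw'
    induction w using TensorProduct.induction_on with
    | zero => simp
    | add x y hx hy => simp only [map_add, add_mul, mul_add, Finset.sum_add_distrib, hx, hy]
    | tmul α β =>
      ext v w
      simp only [TensorProduct.AlgebraTensorModule.curry_apply, LinearMap.restrictScalars_self,
        TensorProduct.curry_apply, TensorProduct.map_tmul, endAct₂_tmul, averaging_apply,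
        LinearMap.sum_apply, Module.End.mul_apply, rightMul₂_tmul,
        TensorProduct.homTensorHomMap_apply, TensorProduct.sum_tmul, TensorProduct.tmul_sum]
      rw [Finset.sum_comm]
  rw [key, hw']
  simp only [twistedSwap_rightMul₂ hg, ← mul_assoc, ← rightMul₂_mul,
    Algebra.TensorProduct.tmul_mul_tmul]
  simp only [← Finset.sum_mul, ← map_sum, ← TensorProduct.tmul_sum, ← TensorProduct.sum_tmul]
  simp only [mul_assoc] at *
  have h1 : ∑ i ∈ S, i.1 * (a₀ * i.2) = 1 := by
    rw [← map_one (algebraMap K A), ← ha₀, ← hg.sum_mul_mul hS]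
    simp only [mul_assoc]
  rw [h1, ← Algebra.TensorProduct.one_def, rightMul₂_one, one_mul]

/-- The element of `End_A(V) ⊗ End_A(V)` giving the twisted exchange is a Goldman element. -/
lemma isGoldman_of_endAct₂_eq {a₀ : A} (ha₀ : t a₀ = 1)
    {γ : (Module.End Aᵐᵒᵖ V) ⊗[K] (Module.End Aᵐᵒᵖ V)}
    (hγ : endAct₂ K A V γ = twistedSwap V g) : IsGoldman (endTrace K V a₀) γ := by
  have hinj := endAct₂_injective (V := V) hg hS ha₀
  have hmul : ∀ z, γ * z = TensorProduct.comm K _ _ z * γ := fun z => hinj (by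
    rw [endAct₂_mul, endAct₂_mul, hγ, twistedSwap_endAct₂])
  have hsq : γ * γ = 1 := hinj (by
    rw [endAct₂_mul, hγ, endAct₂_one, twistedSwap_mul_self hg])
  refine ⟨hmul, ?_, hsq, ?_⟩
  · have := hmul γ
    rw [hsq] at this
    calc TensorProduct.comm K _ _ γ = TensorProduct.comm K _ _ γ * γ * γ := by
          rw [mul_assoc, hsq, mul_one]
      _ = γ := by rw [← this, one_mul]
  · ext1 b
    obtain ⟨n, v, f, hvf⟩ := exists_dual_basis K V
    -- the elementary endomorphisms of a dual basis make the twisted exchange explicit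
    let E : Fin n → Fin n → Module.End K V := fun j l => (f l).smulRight (v j)
    have hw : TensorProduct.map (endRes K A V).toLinearMap (endRes K A V).toLinearMap γ
        = ∑ i ∈ S, ∑ j, ∑ l, (rightMul K A V i.1 * E j l) ⊗ₜ (rightMul K A V i.2 * E l j) := by
      apply (homTensorHomEquiv K V V V V).injective
      rw [homTensorHomEquiv_apply, homTensorHomEquiv_apply]
      refine Eq.trans hγ ?_
      ext x y
      have h1 : y ⊗ₜ x = ∑ j, ∑ l, E j l x ⊗ₜ[K] E l j y := by
        conv_lhs => rw [← hvf x, ← hvf y]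
        simp only [E, LinearMap.smulRight_apply, TensorProduct.sum_tmul, TensorProduct.tmul_sum,
          TensorProduct.smul_tmul_smul]
        rw [Finset.sum_comm]
        exact Finset.sum_congr rfl fun j _ => Finset.sum_congr rfl fun l _ => by rw [mul_comm]
      simp only [TensorProduct.AlgebraTensorModule.curry_apply, LinearMap.restrictScalars_self,
        TensorProduct.curry_apply, twistedSwap_tmul, h1, hS, map_sum, LinearMap.sum_apply,
        rightMul₂_tmul, TensorProduct.homTensorHomMap_apply,
        TensorProduct.map_tmul, Module.End.mul_apply, rightMul_apply]
      exact (Finset.sum_comm.trans (Finset.sum_congr rfl fun j _ => Finset.sum_comm)).symm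
    have hM : endRes K A V (sandwich K _ γ b) = ∑ i ∈ S, ∑ j, ∑ l,
        rightMul K A V i.1 * E j l * endRes K A V b * (rightMul K A V i.2 * E l j) := by
      have h2 : ∀ z, endRes K A V (sandwich K _ z b) = sandwich K _
          (TensorProduct.map (endRes K A V).toLinearMap (endRes K A V).toLinearMap z)
          (endRes K A V b) := by
        intro z
        induction z using TensorProduct.induction_on with
        | zero => simp
        | add x y hx hy => simp only [map_add, LinearMap.add_apply, hx, hy]
        | tmul b c => simp
      rw [h2, hw]
      simp
    have hE : ∀ α : Module.End K V, ∑ j, ∑ l, E j l * α * E l j = projTrace K V α • 1 := by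
      intro α
      ext x
      rw [projTrace_eq_sum hvf]
      simp only [E, LinearMap.sum_apply, Module.End.mul_apply, LinearMap.smulRight_apply, map_smul,
        LinearMap.smul_apply, Module.End.one_apply, Finset.sum_smul]
      conv_rhs => rw [← hvf x]
      simp only [Finset.smul_sum, smul_smul]
      rw [Finset.sum_comm]
      exact Finset.sum_congr rfl fun j _ => Finset.sum_congr rfl fun l _ => by rw [mul_comm]
    have hres : Function.Injective (endRes K A V) := fun b c h => LinearMap.ext fun x =>
      LinearMap.congr_fun h x
    apply hres
    rw [hM]
    have h3 : ∀ i ∈ S, ∑ j, ∑ l,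
        rightMul K A V i.1 * E j l * endRes K A V b * (rightMul K A V i.2 * E l j)
          = endTrace K V a₀ b • rightMul K A V (t i.2 • i.1) := by
      intro i _
      have := hE (endRes K A V b * rightMul K A V i.2)
      rw [projTrace_endRes_mul_rightMul hg ha₀] at this
      calc _ = rightMul K A V i.1 * ∑ j, ∑ l,
            E j l * (endRes K A V b * rightMul K A V i.2) * E l j := by
            simp only [Finset.mul_sum, mul_assoc]
        _ = _ := by
            rw [this, mul_smul_comm, mul_one, map_smul, smul_smul, mul_comm]
    have h4 := hg.sum_right hS 1
    simp only [one_mul] at h4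
    rw [Finset.sum_congr rfl h3, ← Finset.smul_sum, ← map_sum, h4]
    ext x
    simp [Algebra.algebraMap_eq_smul_one]

/-- The double centralizer property `End_A(V) ⊗ Aᵒᵖ ≃ End_K(V)`. Averaging gives a left inverse; a
map `v ↦ η(v) u` of rank one is in the image because the untwisted exchange of `V ⊗ V` is the
twisted one followed by the right multiplication with `g`. -/
lemma endTensorOp_bijective {a₀ : A} (ha₀ : t a₀ = 1) :
    Function.Bijective (endTensorOp K A V) := by
  constructor
  · let Ψ : Module.End K V →ₗ[K] Module.End Aᵐᵒᵖ V ⊗[K] Aᵐᵒᵖ :=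
      ∑ i ∈ S, (TensorProduct.mk K _ _).flip (MulOpposite.op i.2) ∘ₗ averaging hg hS i.1
    refine Function.LeftInverse.injective (g := Ψ) fun z => ?_
    induction z using TensorProduct.induction_on with
    | zero => simp
    | add x y hx hy => rw [map_add, map_add, hx, hy]
    | tmul b a =>
      obtain ⟨a, rfl⟩ := MulOpposite.op_surjective a
      rw [endTensorOp_tmul]
      simp only [Ψ, LinearMap.sum_apply, LinearMap.comp_apply, averaging_endRes_mul,
        LinearMap.flip_apply, TensorProduct.mk_apply, TensorProduct.smul_tmul]
      rw [← TensorProduct.tmul_sum]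
      conv_rhs => rw [← hg.sum_left hS a, Finset.op_sum]
      simp
  · obtain ⟨γ, hγ⟩ := exists_endAct₂_eq (V := V) hg hS ha₀
    have hswap : ∀ v u : V, u ⊗ₜ[K] v = rightMul₂ K A V g (endAct₂ K A V γ (v ⊗ₜ u)) := by
      intro v u
      rw [hγ, twistedSwap_tmul, ← Module.End.mul_apply, ← rightMul₂_mul, hg.mul_self,
        rightMul₂_one, Module.End.one_apply]
    obtain ⟨T, hT⟩ := TensorProduct.exists_finset γ
    change Function.Surjective (endTensorOp K A V).toLinearMap
    rw [← LinearMap.range_eq_top, eq_top_iff]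
    rintro α -
    obtain ⟨z, rfl⟩ := (dualTensorHomEquiv K V V).surjective α
    change dualTensorHom K V V z ∈ _
    induction z using TensorProduct.induction_on with
    | zero => simp
    | add x y hx hy => rw [map_add]; exact add_mem hx hy
    | tmul η u =>
      refine ⟨∑ s ∈ T, ∑ i ∈ S, η (MulOpposite.op i.2 • s.2 u) • (s.1 ⊗ₜ MulOpposite.op i.1), ?_⟩
      ext v
      have h1 := congrArg (TensorProduct.rid K V ∘ η.lTensor V) (hswap v u)
      simp only [Function.comp_apply, LinearMap.lTensor_tmul, TensorProduct.rid_tmul] at h1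
      rw [dualTensorHom_apply, h1, hT, hS]
      simp only [map_sum, LinearMap.sum_apply, endAct₂_tmul, rightMul₂_tmul,
        LinearMap.lTensor_tmul, TensorProduct.rid_tmul, map_smul, LinearMap.smul_apply,
        AlgHom.toLinearMap_apply, endTensorOp_tmul, Module.End.mul_apply, rightMul_apply,
        endRes_apply]

end EndGoldman

section GoldmanEnd

variable {K : Type uK} [CommRing K] [IsArtinianRing K] [IsReduced K]
  {A : Type uA} [Ring A] [Algebra K A] [Module.Finite K A]
  {V : Type uV} [AddCommGroup V] [Module K V] [Module Aᵐᵒᵖ V] [IsScalarTower K Aᵐᵒᵖ V]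
  [Module.Finite K V] [Module.Projective K V]
  {t : A →ₗ[K] K} {g : A ⊗[K] A} (hg : IsGoldman t g)

include hg

/-- The Goldman element of `End_A(V)` acts on `V ⊗ V` as the exchange twisted by the Goldman
element of `A`. -/
theorem endAct₂_goldman (ht : IsSplitTrace t) {a₀ : A} (ha₀ : t a₀ = 1) :
    endAct₂ K A V (goldman K (Module.End Aᵐᵒᵖ V)) = twistedSwap V g ∧
      IsGoldman (endTrace K V a₀) (goldman K (Module.End Aᵐᵒᵖ V)) := by
  have := IsArtinianRing.isSemisimpleRing_of_isReduced K
  obtain ⟨S, hS⟩ := TensorProduct.exists_finset g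
  obtain ⟨γ, hγ⟩ := exists_endAct₂_eq (V := V) hg hS ha₀
  have hG := isGoldman_of_endAct₂_eq hg hS ha₀ hγ
  have : Module.Finite K (Module.End Aᵐᵒᵖ V) := by
    have : Module.Finite K (Module.End K V) :=
      Module.Finite.equiv (dualTensorHomEquiv K V V)
    exact Module.Finite.of_surjective (averaging hg hS a₀)
      fun b => ⟨_, averaging_endRes hg hS ha₀ b⟩
  have : Module.Finite K Aᵐᵒᵖ := Module.Finite.equiv (MulOpposite.opLinearEquiv K)
  have hred : IsReducedTrace (endTrace K V a₀ : Module.End Aᵐᵒᵖ V →ₗ[K] K) := by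
    refine isReducedTrace_of_isAlgClosed fun L _ _ _ => ?_
    obtain ⟨n, f, hf⟩ := exists_splits (L := L) hG.sandwich_bijective.2
    obtain ⟨m, f', hf', htr⟩ := ht L
    refine ⟨n, f, hf, fun b => ?_⟩
    have h1 := projTrace_eq_trace_mul_trace
      (AlgEquiv.ofBijective _ (endTensorOp_bijective (V := V) hg hS ha₀)) hf hf'.op b
      (MulOpposite.op a₀)
    have h2 : (((Matrix.transposeAlgEquiv (Fin m) K L).symm.toAlgHom.comp (AlgHom.op f'))
        (MulOpposite.op a₀)).trace = 1 :=
      (Matrix.trace_transpose (f' a₀)).trans (by rw [htr, ha₀, map_one])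
    rw [h2, mul_one] at h1
    rw [← h1, endTrace_apply, ← endTensorOp_tmul]
    rfl
  have htr : reducedTrace K (Module.End Aᵐᵒᵖ V) = endTrace K V a₀ :=
    IsReducedTrace.unique hG.sandwich_bijective.2 (Classical.epsilon_spec ⟨_, hred⟩) hred
  have hgold : goldman K (Module.End Aᵐᵒᵖ V) = γ := by
    apply hG.sandwich_bijective.1
    rw [hG.sandwich_eq, ← htr]
    exact Classical.epsilon_spec (p := fun g => sandwich K (Module.End Aᵐᵒᵖ V) g
      = Algebra.linearMap K _ ∘ₗ reducedTrace K _) ⟨γ, by rw [hG.sandwich_eq, htr]⟩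
  rw [hgold]
  exact ⟨hγ, hG⟩

end GoldmanEnd

/-! ### Homomorphisms from symmetric groups -/

section PermHom

open Equiv

lemma decomposeFin_symm_eq {n : ℕ} (p : Fin (n + 1)) (e : Perm (Fin n)) :
    Perm.decomposeFin.symm (p, e) = swap 0 p * Perm.decomposeFin.symm (0, e) := by
  ext x
  refine Fin.cases ?_ (fun x => ?_) x
  · simp
  · simp

lemma decomposeFin_symm_zero_swap_mul {n : ℕ} (i j : Fin n) (e : Perm (Fin n)) :
    Perm.decomposeFin.symm (0, swap i j * e)
      = swap i.succ j.succ * Perm.decomposeFin.symm (0, e) := by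
  ext x
  refine Fin.cases ?_ (fun x => ?_) x
  · rw [Perm.mul_apply, Perm.decomposeFin_symm_apply_zero, Perm.decomposeFin_symm_apply_zero,
      swap_apply_of_ne_of_ne (Fin.succ_ne_zero i).symm (Fin.succ_ne_zero j).symm]
  · simp only [Perm.mul_apply, Perm.decomposeFin_symm_apply_succ, swap_self, refl_apply,
      (Fin.succ_injective n).swap_apply]

/-- The presentation of the symmetric group by transpositions: involutions `s i j` that satisfy
the conjugation relations of transpositions define a homomorphism. A permutation is written as a
transposition `(0 p)` times a permutation fixing `0`, and induction applies. -/
theorem exists_permHom {M : Type*} [Monoid M] : ∀ (d : ℕ) (s : Fin d → Fin d → M)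
    (_ : ∀ i j, i ≠ j → s i j = s j i) (_ : ∀ i j, i ≠ j → s i j * s i j = 1)
    (_ : ∀ i j, i ≠ j → ∀ k l, k ≠ l →
      s i j * s k l = s (swap i j k) (swap i j l) * s i j),
    ∃ φ : Perm (Fin d) →* M, ∀ i j, i ≠ j → φ (swap i j) = s i j := by
  intro d
  induction d with
  | zero => exact fun _ _ _ _ => ⟨1, fun i => i.elim0⟩
  | succ d ih =>
    intro s hsymm hsq hconj
    obtain ⟨φ, hφ⟩ := ih (fun i j => s i.succ j.succ)
      (fun i j h => hsymm _ _ ((Fin.succ_injective d).ne h))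
      (fun i j h => hsq _ _ ((Fin.succ_injective d).ne h))
      (fun i j h k l h' => by
        rw [hconj _ _ ((Fin.succ_injective d).ne h) _ _ ((Fin.succ_injective d).ne h'),
          (Fin.succ_injective d).swap_apply, (Fin.succ_injective d).swap_apply])
    let s₀ : Fin (d + 1) → M := fun p => if p = 0 then 1 else s 0 p
    let F : Perm (Fin (d + 1)) → M := fun π =>
      s₀ (Perm.decomposeFin π).1 * φ (Perm.decomposeFin π).2
    have hF : ∀ p e, F (Perm.decomposeFin.symm (p, e)) = s₀ p * φ e := fun p e => by simp [F]
    have hs0 : ∀ p, p ≠ 0 → s₀ p = s 0 p := fun p hp => if_neg hp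
    have hs1 : s₀ 0 = 1 := if_pos rfl
    have key : ∀ i j, i ≠ j → ∀ π, F (swap i j * π) = s i j * F π := by
      intro i j hij π
      obtain ⟨⟨p, e⟩, rfl⟩ := Perm.decomposeFin.symm.surjective π
      have hcase : ∀ j, p ≠ j → F (swap p j * Perm.decomposeFin.symm (p, e))
          = s p j * F (Perm.decomposeFin.symm (p, e)) := by
        intro j hpj
        rw [hF]
        by_cases hp : p = 0
        · subst hp
          rw [← decomposeFin_symm_eq, hF, hs1, one_mul, hs0 j hpj.symm]
        by_cases hj : j = 0
        · subst hj
          rw [decomposeFin_symm_eq, swap_comm p 0, ← mul_assoc, swap_mul_self, one_mul, hF, hs1,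
            hs0 p hp, ← mul_assoc, hsymm p 0 hp, hsq 0 p (Ne.symm hp)]
        obtain ⟨p', rfl⟩ := Fin.exists_succ_eq.2 hp
        obtain ⟨j', rfl⟩ := Fin.exists_succ_eq.2 hj
        have h1 : swap p'.succ j'.succ * Perm.decomposeFin.symm (p'.succ, e)
            = Perm.decomposeFin.symm (j'.succ, swap p' j' * e) := by
          rw [decomposeFin_symm_eq p'.succ, decomposeFin_symm_eq j'.succ,
            decomposeFin_symm_zero_swap_mul, ← mul_assoc, ← mul_assoc, mul_swap_eq_swap_mul,
            swap_apply_left, swap_apply_of_ne_of_ne (Ne.symm hp) (Ne.symm hj)]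
        rw [h1, hF, map_mul, hφ _ _ (fun h => hpj (congrArg _ h)), hs0 _ hp, hs0 _ hj,
          ← mul_assoc, ← mul_assoc, hconj _ _ hpj _ _ (Ne.symm hp), swap_apply_left,
          swap_apply_of_ne_of_ne (Ne.symm hp) (Ne.symm hj)]
      by_cases hi : i = p
      · subst hi; exact hcase j hij
      by_cases hj : j = p
      · subst hj; rw [swap_comm, hcase i (Ne.symm hi), hsymm _ _ hij]
      have hne : ∀ x, x ≠ p → swap 0 p x ≠ 0 := fun x hx h => hx
        ((swap 0 p).injective (h.trans (swap_apply_right 0 p).symm))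
      obtain ⟨i', hi'⟩ := Fin.exists_succ_eq.2 (hne i hi)
      obtain ⟨j', hj'⟩ := Fin.exists_succ_eq.2 (hne j hj)
      have hij' : i' ≠ j' := fun h => hij ((swap 0 p).injective (by rw [← hi', ← hj', h]))
      have h1 : swap i j * Perm.decomposeFin.symm (p, e)
          = Perm.decomposeFin.symm (p, swap i' j' * e) := by
        rw [decomposeFin_symm_eq p, decomposeFin_symm_eq p (swap i' j' * e),
          decomposeFin_symm_zero_swap_mul, ← mul_assoc, ← mul_assoc, hi', hj',
          mul_swap_eq_swap_mul (swap 0 p), swap_apply_self, swap_apply_self]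
      rw [h1, hF, hF, map_mul, hφ _ _ hij', ← mul_assoc, ← mul_assoc]
      congr 1
      by_cases hp : p = 0
      · subst hp
        rw [hs1, one_mul, mul_one, hi', hj', swap_self, refl_apply, refl_apply]
      · rw [hs0 p hp, hconj 0 p (Ne.symm hp) _ _ ((Fin.succ_injective d).ne hij'), hi', hj',
          swap_apply_self, swap_apply_self]
    have hF1 : F 1 = 1 := by
      have : (1 : Perm (Fin (d + 1))) = Perm.decomposeFin.symm (0, 1) := by
        rw [Perm.decomposeFin_symm_of_one, swap_self]; rfl
      rw [this, hF, hs1, map_one, one_mul]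
    refine ⟨⟨⟨F, hF1⟩, fun π ρ => ?_⟩, fun i j h => ?_⟩
    · change F (π * ρ) = F π * F ρ
      induction π using Perm.swap_induction_on with
      | one => rw [one_mul, hF1, one_mul]
      | swap_mul π i j hij h => 
        have := key i j hij π
        rw [mul_assoc, key i j hij, h, this]
        exact (mul_assoc _ _ _).symm
    · have := key i j h 1
      rwa [hF1, mul_one, mul_one] at this

/-- Homomorphisms from a symmetric group are determined by adjacent transpositions. -/
lemma permHom_ext {M : Type*} [Monoid M] {d : ℕ} {φ ψ : Perm (Fin d) →* M}
    (h : ∀ i j : Fin d, (j : ℕ) = (i : ℕ) + 1 → φ (swap i j) = ψ (swap i j)) : φ = ψ := by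
  cases d with
  | zero => exact MonoidHom.ext fun π => by rw [Subsingleton.elim π 1, map_one, map_one]
  | succ n =>
    refine MonoidHom.eq_of_eqOn_denseM (Perm.mclosure_swap_castSucc_succ n) ?_
    rintro _ ⟨i, rfl⟩
    exact h _ _ (by simp)

end PermHom

/-! ### Goldman elements in tensor powers -/

section PairHom

variable {K : Type*} [CommRing K] {X : Type*} [Ring X] [Algebra K X] {d : ℕ}

/-- The algebra homomorphism `X ⊗ X → X^{⊗ d}` that places the two factors in the positions
`i ≠ j`. -/
def pairHom {i j : Fin d} (hij : i ≠ j) : X ⊗[K] X →ₐ[K] ⨂[K]^d X :=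
  Algebra.TensorProduct.lift
    (PiTensorProduct.singleAlgHom (R := K) (A := fun _ : Fin d => X) i)
    (PiTensorProduct.singleAlgHom (R := K) (A := fun _ : Fin d => X) j) fun a b => by
      change PiTensorProduct.tprod K _ * PiTensorProduct.tprod K _
        = PiTensorProduct.tprod K _ * PiTensorProduct.tprod K _
      rw [PiTensorProduct.tprod_mul_tprod, PiTensorProduct.tprod_mul_tprod]
      congr 1
      exact Pi.mulSingle_commute (f := fun _ : Fin d => X) hij a b

/-- The family with `a` in position `i`, `b` in position `j` and `1` elsewhere. -/
def pairFun (i j : Fin d) (a b : X) : Fin d → X :=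
  Pi.mulSingle i a * Pi.mulSingle j b

lemma pairFun_left {i j : Fin d} (hij : i ≠ j) (a b : X) : pairFun i j a b i = a := by
  simp [pairFun, hij]

lemma pairFun_right {i j : Fin d} (hij : i ≠ j) (a b : X) : pairFun i j a b j = b := by
  simp [pairFun, hij.symm]

lemma pairFun_of_ne {i j k : Fin d} (hi : k ≠ i) (hj : k ≠ j) (a b : X) :
    pairFun i j a b k = 1 := by
  simp [pairFun, hi, hj]

lemma pairFun_comp (π : Equiv.Perm (Fin d)) (i j : Fin d) (a b : X) :
    pairFun i j a b ∘ π.symm = pairFun (π i) (π j) a b := by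
  funext k
  simp only [pairFun, Function.comp_apply, Pi.mul_apply, Pi.mulSingle_apply,
    Equiv.symm_apply_eq]

@[simp] lemma pairHom_tmul {i j : Fin d} (hij : i ≠ j) (a b : X) :
    pairHom (K := K) hij (a ⊗ₜ b) = PiTensorProduct.tprod K (pairFun i j a b) := by
  rw [pairHom, Algebra.TensorProduct.lift_tmul]
  exact PiTensorProduct.tprod_mul_tprod _ _

lemma pairHom_comm {i j : Fin d} (hij : i ≠ j) (z : X ⊗[K] X) :
    pairHom hij.symm z = pairHom hij (TensorProduct.comm K X X z) := by
  induction z using TensorProduct.induction_on with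
  | zero => simp
  | add x y hx hy => simp only [map_add, hx, hy]
  | tmul a b =>
    rw [TensorProduct.comm_tmul, pairHom_tmul, pairHom_tmul]
    congr 1
    exact Pi.mulSingle_commute (f := fun _ : Fin d => X) hij.symm a b

variable {t : X →ₗ[K] K} {g : X ⊗[K] X} (hg : IsGoldman t g)

include hg

lemma IsGoldman.pairHom_mul_tprod {i j : Fin d} (hij : i ≠ j) (f : Fin d → X) :
    pairHom hij g * PiTensorProduct.tprod K f
      = PiTensorProduct.tprod K (f ∘ Equiv.swap i j) * pairHom hij g := by
  classical
  -- `f` is the product of its part in the positions `i`, `j` and of the rest, which commutes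
  -- with `pairHom hij g`
  let f' : Fin d → X := fun k => if k = i ∨ k = j then 1 else f k
  have h1 : f = pairFun i j (f i) (f j) * f' := by
    funext k
    by_cases hi : k = i
    · subst hi; simp [f', pairFun_left hij]
    by_cases hj : k = j
    · subst hj; simp [f', pairFun_right hij]
    simp [f', pairFun_of_ne hi hj, hi, hj]
  have h2 : f ∘ Equiv.swap i j = pairFun i j (f j) (f i) * f' := by
    funext k
    by_cases hi : k = i
    · subst hi; simp [f', pairFun_left hij]
    by_cases hj : k = j
    · subst hj; simp [f', pairFun_right hij]
    simp [f', pairFun_of_ne hi hj, hi, hj, Equiv.swap_apply_of_ne_of_ne hi hj]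
  have h3 : ∀ z : X ⊗[K] X, pairHom hij z * PiTensorProduct.tprod K f'
      = PiTensorProduct.tprod K f' * pairHom hij z := by
    intro z
    induction z using TensorProduct.induction_on with
    | zero => simp
    | add x y hx hy => simp only [map_add, add_mul, mul_add, hx, hy]
    | tmul a b =>
      rw [pairHom_tmul, PiTensorProduct.tprod_mul_tprod, PiTensorProduct.tprod_mul_tprod]
      congr 1
      funext k
      by_cases hi : k = i
      · subst hi; simp [f']
      by_cases hj : k = j
      · subst hj; simp [f']
      simp [pairFun_of_ne hi hj]
  rw [h2, h1, ← PiTensorProduct.tprod_mul_tprod, ← PiTensorProduct.tprod_mul_tprod,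
    ← pairHom_tmul hij, ← pairHom_tmul hij, ← mul_assoc, ← map_mul, hg.mul_eq,
    TensorProduct.comm_tmul, map_mul, mul_assoc, h3, ← mul_assoc]
  simp [pairFun_left hij, pairFun_right hij, f']

lemma IsGoldman.pairHom_mul_pairHom {i j : Fin d} (hij : i ≠ j) {k l : Fin d} (hkl : k ≠ l)
    (z : X ⊗[K] X) :
    pairHom hij g * pairHom hkl z
      = pairHom ((Equiv.swap i j).injective.ne hkl) z * pairHom hij g := by
  induction z using TensorProduct.induction_on with
  | zero => simp
  | add x y hx hy => simp only [map_add, add_mul, mul_add, hx, hy]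
  | tmul a b =>
    rw [pairHom_tmul, pairHom_tmul, hg.pairHom_mul_tprod, ← pairFun_comp, Equiv.symm_swap]

/-- A Goldman element defines a homomorphism from the symmetric group. -/
theorem IsGoldman.exists_hom (d : ℕ) : ∃ δ : Equiv.Perm (Fin d) →* ⨂[K]^d X,
    ∀ (i j : Fin d) (hij : i ≠ j), δ (Equiv.swap i j) = pairHom hij g := by
  classical
  obtain ⟨φ, hφ⟩ := exists_permHom d
    (fun i j => if h : i ≠ j then pairHom (K := K) (d := d) h g else 1)
    (fun i j h => by
      simp only [dif_pos h, dif_pos h.symm]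
      rw [pairHom_comm h.symm, hg.comm_eq])
    (fun i j h => by simp only [dif_pos h]; rw [← map_mul, hg.mul_self, map_one])
    (fun i j h k l h' => by
      simp only [dif_pos h, dif_pos h', dif_pos ((Equiv.swap i j).injective.ne h')]
      exact hg.pairHom_mul_pairHom h h' g)
  exact ⟨φ, fun i j h => (hφ i j h).trans (dif_pos h)⟩

omit hg in
/-- The homomorphism from the symmetric group to `X^{⊗ d}` that sends the transposition `(i j)` to
`g` in the positions `i` and `j`, for a Goldman element `g`. -/
def permHom (g : X ⊗[K] X) (d : ℕ) : Equiv.Perm (Fin d) →* ⨂[K]^d X :=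
  Classical.epsilon fun δ : Equiv.Perm (Fin d) →* ⨂[K]^d X =>
    ∀ (i j : Fin d) (hij : i ≠ j), δ (Equiv.swap i j) = pairHom hij g

lemma IsGoldman.permHom_swap {i j : Fin d} (hij : i ≠ j) :
    permHom g d (Equiv.swap i j) = pairHom hij g :=
  Classical.epsilon_spec (hg.exists_hom d) i j hij

/-- Conjugation by `permHom g d π` permutes the factors of `X^{⊗ d}`. -/
lemma IsGoldman.permHom_mul (π : Equiv.Perm (Fin d)) (z : ⨂[K]^d X) :
    permHom g d π * z = PiTensorProduct.reindex K (fun _ => X) π z * permHom g d π := by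
  induction z using PiTensorProduct.induction_on with
  | add x y hx hy => simp only [mul_add, map_add, add_mul, hx, hy]
  | smul_tprod r f =>
    rw [mul_smul_comm, map_smul, smul_mul_assoc]
    congr 1
    erw [PiTensorProduct.reindex_tprod]
    induction π using Equiv.Perm.swap_induction_on generalizing f with
    | one => rw [map_one, one_mul, mul_one]; rfl
    | swap_mul π i j hij h =>
      rw [map_mul, mul_assoc, h, ← mul_assoc, hg.permHom_swap hij, hg.pairHom_mul_tprod hij,
        mul_assoc]
      rfl

omit hg in
lemma goldmanAt_eq_pairHom {i j : Fin d} (hij : i ≠ j) :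
    goldmanAt K X i j = pairHom hij (goldman K X) := by
  rw [goldmanAt]
  induction goldman K X using TensorProduct.induction_on with
  | zero => simp
  | add x y hx hy => simp only [map_add, hx, hy]
  | tmul a b =>
    rw [pairHom, Algebra.TensorProduct.lift_tmul]
    rfl

omit hg in
/-- The morphism defined by its values on adjacent transpositions takes the expected values on all
transpositions. -/
lemma goldmanHom_eq_permHom (hg : IsGoldman t (goldman K X)) :
    goldmanHom K X d = permHom (goldman K X) d := by
  have h : ∀ i j : Fin d, (j : ℕ) = (i : ℕ) + 1 →
      permHom (goldman K X) d (Equiv.swap i j) = goldmanAt K X i j := fun i j h => by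
    have hij : i ≠ j := fun e => by subst e; omega
    rw [hg.permHom_swap hij, goldmanAt_eq_pairHom hij]
  refine permHom_ext fun i j hij => ?_
  rw [h i j hij]
  exact Classical.epsilon_spec (p := fun φ : Equiv.Perm (Fin d) →* ⨂[K]^d X =>
    ∀ i j : Fin d, (j : ℕ) = (i : ℕ) + 1 → φ (Equiv.swap i j) = goldmanAt K X i j) ⟨_, h⟩ i j hij

end PairHom

/-! ### The action of permutations on tensor powers -/

section Action

variable {K : Type uK} [CommRing K]

variable (K) in
/-- The permutation of the factors of `M^{⊗ d}`. -/
def permTensor (M : Type*) [AddCommGroup M] [Module K M] {d : ℕ} (π : Equiv.Perm (Fin d)) :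
    ⨂[K]^d M ≃ₗ[K] ⨂[K]^d M :=
  PiTensorProduct.reindex K (fun _ => M) π

@[simp] lemma permTensor_tprod {M : Type*} [AddCommGroup M] [Module K M] {d : ℕ}
    (π : Equiv.Perm (Fin d)) (v : Fin d → M) :
    permTensor K M π (PiTensorProduct.tprod K v) = PiTensorProduct.tprod K (v ∘ π.symm) :=
  PiTensorProduct.reindex_tprod _ _

lemma permTensor_inv_permTensor {M : Type*} [AddCommGroup M] [Module K M] {d : ℕ}
    (π : Equiv.Perm (Fin d)) (x : ⨂[K]^d M) : permTensor K M π⁻¹ (permTensor K M π x) = x := by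
  induction x using PiTensorProduct.induction_on with
  | add x x' hx hx' => simp only [map_add, hx, hx']
  | smul_tprod r x =>
    rw [map_smul, map_smul, permTensor_tprod, permTensor_tprod]
    congr 2
    funext i
    exact congrArg x (π.symm_apply_apply i)

/-- The tensor with the entries of `v`, except for `a` in position `i` and `b` in position `j`. -/
def twoSlots {M : Type*} [AddCommGroup M] [Module K M] {d : ℕ} (v : Fin d → M) {i j : Fin d}
    (hij : i ≠ j) : M ⊗[K] M →ₗ[K] ⨂[K]^d M :=
  TensorProduct.lift (LinearMap.mk₂ K
    (fun a b => PiTensorProduct.tprod K (Function.update (Function.update v i a) j b))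
    (fun a a' b => by
      simp only [Function.update_comm hij, MultilinearMap.map_update_add])
    (fun c a b => by
      simp only [Function.update_comm hij, MultilinearMap.map_update_smul])
    (fun a b b' => by simp only [MultilinearMap.map_update_add])
    (fun c a b => by simp only [MultilinearMap.map_update_smul]))

lemma twoSlots_tmul {M : Type*} [AddCommGroup M] [Module K M] {d : ℕ} (v : Fin d → M)
    {i j : Fin d} (hij : i ≠ j) (a b : M) :
    twoSlots (K := K) v hij (a ⊗ₜ b)
      = PiTensorProduct.tprod K (Function.update (Function.update v i a) j b) := rfl

variable {A : Type uA} [Ring A] [Algebra K A]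
  {V : Type uV} [AddCommGroup V] [Module K V] [Module Aᵐᵒᵖ V] [IsScalarTower K Aᵐᵒᵖ V]
  {U : Type uU} [AddCommGroup U] [Module K U] [Module Aᵐᵒᵖ U] [IsScalarTower K Aᵐᵒᵖ U]

lemma endTensorAct_one (d : ℕ) : endTensorAct K A V d 1 = 1 := by
  apply PiTensorProduct.ext
  ext v
  simp [PiTensorProduct.one_def]

omit [Module Aᵐᵒᵖ V] [IsScalarTower K Aᵐᵒᵖ V] in
lemma piTensorHomMap_map_mul {B : Type*} [Ring B] [Algebra K B] (φ : B →ₐ[K] Module.End K V)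
    {d : ℕ} (a b : ⨂[K]^d B) :
    PiTensorProduct.piTensorHomMap (PiTensorProduct.map (fun _ => φ.toLinearMap) (a * b))
      = ((PiTensorProduct.piTensorHomMap (PiTensorProduct.map (fun _ => φ.toLinearMap) a) *
        PiTensorProduct.piTensorHomMap (PiTensorProduct.map (fun _ => φ.toLinearMap) b) :
          Module.End K (⨂[K]^d V))) := by
  induction a using PiTensorProduct.induction_on with
  | add x y hx hy => simp [add_mul, hx, hy]
  | smul_tprod r a =>
    induction b using PiTensorProduct.induction_on with
    | add x y hx hy => simp only [mul_add, map_add, hx, hy]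
    | smul_tprod s b =>
      apply PiTensorProduct.ext
      ext v
      simp [smul_smul]

lemma endTensorAct_mul {d : ℕ} (a b : ⨂[K]^d (Module.End Aᵐᵒᵖ V)) :
    endTensorAct K A V d (a * b) = endTensorAct K A V d a * endTensorAct K A V d b :=
  piTensorHomMap_map_mul (endRes K A V) a b

@[simp] lemma goldmanAct_one {d : ℕ} (x : ⨂[K]^d V) :
    goldmanAct K A V (1 : Equiv.Perm (Fin d)) x = x := by
  change endTensorAct K A V d (goldmanHom K _ d 1) x = x
  rw [map_one, endTensorAct_one]; rfl

lemma goldmanAct_mul {d : ℕ} (π ρ : Equiv.Perm (Fin d)) (x : ⨂[K]^d V) :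
    goldmanAct K A V (π * ρ) x = goldmanAct K A V π (goldmanAct K A V ρ x) := by
  change endTensorAct K A V d (goldmanHom K _ d (π * ρ)) x = _
  rw [map_mul, endTensorAct_mul]; rfl

lemma goldmanAct_tensorRightMul {d : ℕ} (π : Equiv.Perm (Fin d)) (a : ⨂[K]^d A) (x : ⨂[K]^d V) :
    goldmanAct K A V π (tensorRightMul K A V d a x)
      = tensorRightMul K A V d a (goldmanAct K A V π x) :=
  (goldmanAct K A V π).map_smul (MulOpposite.op a) x

/-- An element of `End_A(V) ⊗ End_A(V)` placed in two positions acts on these two factors only. -/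
lemma endTensorAct_pairHom {d : ℕ} {i j : Fin d} (hij : i ≠ j)
    (z : Module.End Aᵐᵒᵖ V ⊗[K] Module.End Aᵐᵒᵖ V) (v : Fin d → V) :
    endTensorAct K A V d (pairHom hij z) (PiTensorProduct.tprod K v)
      = twoSlots v hij (endAct₂ K A V z (v i ⊗ₜ v j)) := by
  induction z using TensorProduct.induction_on with
  | zero => simp
  | add x y hx hy => simp only [map_add, LinearMap.add_apply, hx, hy]
  | tmul a b =>
    rw [pairHom_tmul, endTensorAct_tprod, endAct₂_tmul, twoSlots_tmul]
    congr 1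
    funext k
    by_cases hj : k = j
    · subst hj; simp [pairFun_right hij]
    by_cases hi : k = i
    · subst hi; simp [pairFun_left hij, hij]
    simp [pairFun_of_ne hi hj, hi, hj]

lemma tensorRightMul_pairHom {d : ℕ} {i j : Fin d} (hij : i ≠ j) (z : A ⊗[K] A) (v : Fin d → V) :
    tensorRightMul K A V d (pairHom hij z) (PiTensorProduct.tprod K v)
      = twoSlots v hij (rightMul₂ K A V z (v i ⊗ₜ v j)) := by
  induction z using TensorProduct.induction_on with
  | zero => simp
  | add x y hx hy => simp only [map_add, LinearMap.add_apply, hx, hy]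
  | tmul a b =>
    rw [pairHom_tmul, tensorRightMul_tprod, rightMul₂_tmul, twoSlots_tmul]
    congr 1
    funext k
    by_cases hj : k = j
    · subst hj; simp [pairFun_right hij]
    by_cases hi : k = i
    · subst hi; simp [pairFun_left hij, hij]
    simp [pairFun_of_ne hi hj, hi, hj]

variable (V) in
/-- The Goldman action on the tensor powers of `V` is the permutation of the factors followed by
the right multiplication with the images of permutations under `permHom g d`. -/
def ActsBy (g : A ⊗[K] A) : Prop :=
  ∀ (d : ℕ) (π : Equiv.Perm (Fin d)) (x : ⨂[K]^d V),
    goldmanAct K A V π x = tensorRightMul K A V d (permHom g d π) (permTensor K V π x)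

/-- It suffices to know the action of the Goldman element on `V ⊗ V`. -/
lemma actsBy_of_endAct₂_eq {t : A →ₗ[K] K} {g : A ⊗[K] A} (hg : IsGoldman t g)
    {t' : Module.End Aᵐᵒᵖ V →ₗ[K] K} (hG : IsGoldman t' (goldman K (Module.End Aᵐᵒᵖ V)))
    (h : endAct₂ K A V (goldman K (Module.End Aᵐᵒᵖ V)) = twistedSwap V g) : ActsBy V g := by
  intro d π x
  induction x using PiTensorProduct.induction_on with
  | add x y hx hy => simp only [map_add, hx, hy]
  | smul_tprod r v =>
    have hr : goldmanAct K A V π (r • PiTensorProduct.tprod K v)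
        = r • goldmanAct K A V π (PiTensorProduct.tprod K v) :=
      map_smul (endTensorAct K A V d (goldmanHom K (Module.End Aᵐᵒᵖ V) d π)) r _
    rw [hr, map_smul, map_smul]
    congr 1
    rw [permTensor_tprod]
    clear hr
    induction π using Equiv.Perm.swap_induction_on with
    | one => rw [goldmanAct_one, map_one, tensorRightMul_one]; rfl
    | swap_mul π i j hij hπ =>
      rw [goldmanAct_mul, hπ, goldmanAct_tensorRightMul, map_mul, tensorRightMul_mul,
        Module.End.mul_apply]
      congr 1
      change endTensorAct K A V d (goldmanHom K (Module.End Aᵐᵒᵖ V) d _) _ = _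
      rw [goldmanHom_eq_permHom hG, hG.permHom_swap hij, hg.permHom_swap hij,
        endTensorAct_pairHom, h, tensorRightMul_pairHom, twistedSwap_tmul]
      have h1 : ∀ z, twoSlots (K := K) (v ∘ (Equiv.swap i j * π).symm) hij z
          = twoSlots (v ∘ π.symm) hij z := by
        intro z
        induction z using TensorProduct.induction_on with
        | zero => simp
        | add x y hx hy => simp only [map_add, hx, hy]
        | tmul a b =>
          rw [twoSlots_tmul, twoSlots_tmul]
          congr 1
          funext k
          by_cases hj : k = j
          · subst hj; simp
          by_cases hi : k = i
          · subst hi; simp [hij]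
          simp only [Function.update_of_ne hj, Function.update_of_ne hi]
          change v (π.symm ((Equiv.swap i j).symm k)) = v (π.symm k)
          rw [Equiv.symm_swap, Equiv.swap_apply_of_ne_of_ne hi hj]
      rw [h1]
      congr 3
      · change v (π.symm j) = v (π.symm ((Equiv.swap i j).symm i))
        rw [Equiv.symm_swap, Equiv.swap_apply_left]
      · change v (π.symm i) = v (π.symm ((Equiv.swap i j).symm j))
        rw [Equiv.symm_swap, Equiv.swap_apply_right]

lemma goldmanAct_smul {d : ℕ} (π : Equiv.Perm (Fin d)) (r : K) (x : ⨂[K]^d V) :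
    goldmanAct K A V π (r • x) = r • goldmanAct K A V π x :=
  map_smul (endTensorAct K A V d (goldmanHom K (Module.End Aᵐᵒᵖ V) d π)) r x

/-- The tensor product of a family of `A`-linear maps. -/
def mapPow {d : ℕ} (f : Fin d → U →ₗ[Aᵐᵒᵖ] V) : ⨂[K]^d U →ₗ[K] ⨂[K]^d V :=
  PiTensorProduct.map fun i => (f i).restrictScalars K

@[simp] lemma mapPow_tprod {d : ℕ} (f : Fin d → U →ₗ[Aᵐᵒᵖ] V) (u : Fin d → U) :
    mapPow f (PiTensorProduct.tprod K u) = PiTensorProduct.tprod K fun i => f i (u i) :=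
  PiTensorProduct.map_tprod _ _

lemma mapPow_tensorRightMul {d : ℕ} (f : Fin d → U →ₗ[Aᵐᵒᵖ] V) (a : ⨂[K]^d A)
    (x : ⨂[K]^d U) :
    mapPow f (tensorRightMul K A U d a x) = tensorRightMul K A V d a (mapPow f x) := by
  induction x using PiTensorProduct.induction_on with
  | add x y hx hy => simp only [map_add, hx, hy]
  | smul_tprod r u =>
    induction a using PiTensorProduct.induction_on with
    | add x y hx hy => simp only [map_add, LinearMap.add_apply, hx, hy]
    | smul_tprod s a => simp

/-- Naturality of the Goldman action. -/
lemma ActsBy.goldmanAct_mapPow {g : A ⊗[K] A} (hU : ActsBy U g) (hV : ActsBy V g) {d : ℕ}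
    (π : Equiv.Perm (Fin d)) (f : Fin d → U →ₗ[Aᵐᵒᵖ] V) (x : ⨂[K]^d U) :
    goldmanAct K A V π (mapPow f x) = mapPow (f ∘ π.symm) (goldmanAct K A U π x) := by
  rw [hU, hV, mapPow_tensorRightMul]
  congr 1
  induction x using PiTensorProduct.induction_on with
  | add x y hx hy => simp only [map_add, hx, hy]
  | smul_tprod r u => simp [Function.comp_def]

end Action

/-! ### Young subgroups -/

section Young

variable {K : Type uK} [CommRing K] {p q d : ℕ} (h : p + q = d)

/-- The permutation of `p + q` positions that is `a` on the first `p` and `b` on the last `q`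
positions. -/
def blockPerm : Equiv.Perm (Fin p) × Equiv.Perm (Fin q) →* Equiv.Perm (Fin d) :=
  ((finSumFinEquiv.trans (finCongr h)).permCongrHom.toMonoidHom).comp
    (Equiv.Perm.sumCongrHom (Fin p) (Fin q))


lemma blockPerm_apply_inl (a : Equiv.Perm (Fin p)) (b : Equiv.Perm (Fin q)) (i : Fin p) :
    blockPerm h (a, b) (finSumFinEquiv.trans (finCongr h) (Sum.inl i))
      = finSumFinEquiv.trans (finCongr h) (Sum.inl (a i)) := by
  change (finSumFinEquiv.trans (finCongr h)) (Equiv.sumCongr a b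
    ((finSumFinEquiv.trans (finCongr h)).symm (finSumFinEquiv.trans (finCongr h) (Sum.inl i)))) = _
  rw [Equiv.symm_apply_apply]; rfl

lemma blockPerm_apply_inr (a : Equiv.Perm (Fin p)) (b : Equiv.Perm (Fin q)) (i : Fin q) :
    blockPerm h (a, b) (finSumFinEquiv.trans (finCongr h) (Sum.inr i))
      = finSumFinEquiv.trans (finCongr h) (Sum.inr (b i)) := by
  change (finSumFinEquiv.trans (finCongr h)) (Equiv.sumCongr a b
    ((finSumFinEquiv.trans (finCongr h)).symm (finSumFinEquiv.trans (finCongr h) (Sum.inr i)))) = _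
  rw [Equiv.symm_apply_apply]; rfl

lemma sign_blockPerm (a : Equiv.Perm (Fin p)) (b : Equiv.Perm (Fin q)) :
    Equiv.Perm.sign (blockPerm h (a, b)) = Equiv.Perm.sign a * Equiv.Perm.sign b := by
  change Equiv.Perm.sign ((finSumFinEquiv.trans (finCongr h)).permCongr (Equiv.sumCongr a b)) = _
  rw [Equiv.Perm.sign_permCongr]
  exact Equiv.Perm.sign_sumCongr a b

lemma blockPerm_swap_left (i j : Fin p) : blockPerm h (Equiv.swap i j, (1 : Equiv.Perm (Fin q)))
    = Equiv.swap (finSumFinEquiv.trans (finCongr h) (Sum.inl i))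
        (finSumFinEquiv.trans (finCongr h) (Sum.inl j)) := by
  change (finSumFinEquiv.trans (finCongr h)).permCongr
    (Equiv.sumCongr (Equiv.swap i j) (Equiv.refl _)) = _
  rw [show Equiv.sumCongr (Equiv.swap i j) (Equiv.refl (Fin q))
    = Equiv.swap (Sum.inl i) (Sum.inl j) from Equiv.Perm.sumCongr_swap_refl i j]
  exact Equiv.symm_trans_swap_trans _ _ (finSumFinEquiv.trans (finCongr h))

lemma blockPerm_swap_right (i j : Fin q) : blockPerm h ((1 : Equiv.Perm (Fin p)), Equiv.swap i j)
    = Equiv.swap (finSumFinEquiv.trans (finCongr h) (Sum.inr i))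
        (finSumFinEquiv.trans (finCongr h) (Sum.inr j)) := by
  change (finSumFinEquiv.trans (finCongr h)).permCongr
    (Equiv.sumCongr (Equiv.refl _) (Equiv.swap i j)) = _
  rw [show Equiv.sumCongr (Equiv.refl (Fin p)) (Equiv.swap i j)
    = Equiv.swap (Sum.inr i) (Sum.inr j) from Equiv.Perm.sumCongr_refl_swap i j]
  exact Equiv.symm_trans_swap_trans _ _ (finSumFinEquiv.trans (finCongr h))

lemma permTensor_blockPerm (M : Type*) [AddCommGroup M] [Module K M] (a : Equiv.Perm (Fin p))
    (b : Equiv.Perm (Fin q)) (x : ⨂[K]^p M) (y : ⨂[K]^q M) :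
    permTensor K M (blockPerm h (a, b)) (concat K M h (x ⊗ₜ y))
      = concat K M h (permTensor K M a x ⊗ₜ permTensor K M b y) := by
  induction x using PiTensorProduct.induction_on with
  | add x x' hx hx' => simp only [TensorProduct.add_tmul, map_add, hx, hx']
  | smul_tprod r x =>
  induction y using PiTensorProduct.induction_on with
  | add x x' hx hx' => simp only [TensorProduct.tmul_add, map_add, hx, hx']
  | smul_tprod s y =>
  simp only [← TensorProduct.smul_tmul', TensorProduct.tmul_smul, map_smul, permTensor_tprod,
    concat_tprod]
  congr 3
  funext i
  change Sum.elim x y ((finSumFinEquiv.trans (finCongr h)).symm ((finSumFinEquiv.trans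
    (finCongr h)) ((Equiv.sumCongr a b).symm ((finSumFinEquiv.trans (finCongr h)).symm i)))) = _
  rw [Equiv.symm_apply_apply]
  rcases (finSumFinEquiv.trans (finCongr h)).symm i with j | j <;> rfl

variable {A : Type uA} [Ring A] [Algebra K A]
  {V : Type uV} [AddCommGroup V] [Module K V] [Module Aᵐᵒᵖ V] [IsScalarTower K Aᵐᵒᵖ V]

lemma tensorRightMul_concat (a : ⨂[K]^p A) (b : ⨂[K]^q A) (x : ⨂[K]^p V) (y : ⨂[K]^q V) :
    tensorRightMul K A V d (concat K A h (a ⊗ₜ b)) (concat K V h (x ⊗ₜ y))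
      = concat K V h (tensorRightMul K A V p a x ⊗ₜ tensorRightMul K A V q b y) := by
  induction x using PiTensorProduct.induction_on with
  | add x x' hx hx' => simp only [TensorProduct.add_tmul, map_add, hx, hx']
  | smul_tprod r x =>
  induction y using PiTensorProduct.induction_on with
  | add x x' hx hx' => simp only [TensorProduct.tmul_add, map_add, hx, hx']
  | smul_tprod s y =>
  induction a using PiTensorProduct.induction_on with
  | add x x' hx hx' =>
    simp only [TensorProduct.add_tmul, map_add, LinearMap.add_apply, hx, hx']
  | smul_tprod r' a =>
  induction b using PiTensorProduct.induction_on with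
  | add x x' hx hx' =>
    simp only [TensorProduct.tmul_add, map_add, LinearMap.add_apply, hx, hx']
  | smul_tprod s' b =>
  have key : (fun i =>
      MulOpposite.op (Sum.elim a b ((finSumFinEquiv.trans (finCongr h)).symm i)) •
        Sum.elim x y ((finSumFinEquiv.trans (finCongr h)).symm i))
      = fun i => Sum.elim (fun i => MulOpposite.op (a i) • x i)
        (fun i => MulOpposite.op (b i) • y i) ((finSumFinEquiv.trans (finCongr h)).symm i) := by
    funext i
    rcases (finSumFinEquiv.trans (finCongr h)).symm i with j | j <;> rfl
  simp only [← TensorProduct.smul_tmul', TensorProduct.tmul_smul, map_smul, LinearMap.smul_apply,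
    tensorRightMul_tprod, concat_tprod, key]
  simp only [smul_smul]
  congr 1
  ring

lemma concat_pairHom_left {i j : Fin p} (hij : i ≠ j) (z : A ⊗[K] A) :
    concat K A h (pairHom hij z ⊗ₜ 1)
      = pairHom
          (((finSumFinEquiv.trans (finCongr h)).injective.comp Sum.inl_injective).ne hij) z := by
  induction z using TensorProduct.induction_on with
  | zero => simp
  | add x x' hx hx' => simp only [TensorProduct.add_tmul, map_add, hx, hx']
  | tmul a b =>
    rw [pairHom_tmul, pairHom_tmul, PiTensorProduct.one_def, concat_tprod]
    congr 1
    funext k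
    obtain ⟨k, rfl⟩ := (finSumFinEquiv.trans (finCongr h)).surjective k
    rw [Equiv.symm_apply_apply]
    rcases k with k | k <;> simp only [pairFun, Pi.mul_apply, Pi.mulSingle_apply,
      Function.comp_apply, EmbeddingLike.apply_eq_iff_eq, Sum.elim_inl, Sum.elim_inr,
      Pi.one_apply, Sum.inl.injEq, reduceCtorEq, if_false, mul_one]

lemma concat_pairHom_right {i j : Fin q} (hij : i ≠ j) (z : A ⊗[K] A) :
    concat K A h (1 ⊗ₜ pairHom hij z)
      = pairHom
          (((finSumFinEquiv.trans (finCongr h)).injective.comp Sum.inr_injective).ne hij) z := by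
  induction z using TensorProduct.induction_on with
  | zero => simp
  | add x x' hx hx' => simp only [TensorProduct.tmul_add, map_add, hx, hx']
  | tmul a b =>
    rw [pairHom_tmul, pairHom_tmul, PiTensorProduct.one_def, concat_tprod]
    congr 1
    funext k
    obtain ⟨k, rfl⟩ := (finSumFinEquiv.trans (finCongr h)).surjective k
    rw [Equiv.symm_apply_apply]
    rcases k with k | k <;> simp only [pairFun, Pi.mul_apply, Pi.mulSingle_apply,
      Function.comp_apply, EmbeddingLike.apply_eq_iff_eq, Sum.elim_inl, Sum.elim_inr,
      Pi.one_apply, Sum.inr.injEq, reduceCtorEq, if_false, mul_one]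

variable {t : A →ₗ[K] K} {g : A ⊗[K] A} (hg : IsGoldman t g)

include hg

lemma IsGoldman.permHom_blockPerm (a : Equiv.Perm (Fin p)) (b : Equiv.Perm (Fin q)) :
    permHom g d (blockPerm h (a, b)) = concat K A h (permHom g p a ⊗ₜ permHom g q b) := by
  have h1 : permHom g d (blockPerm h (a, 1)) = concat K A h (permHom g p a ⊗ₜ 1) := by
    induction a using Equiv.Perm.swap_induction_on with
    | one =>
      rw [map_one, ← Algebra.TensorProduct.one_def]
      exact ((congrArg _ (map_one (blockPerm h))).trans (map_one _)).trans
        (map_one (concatAlg K A h)).symm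
    | swap_mul π i j hij hπ =>
      rw [show ((Equiv.swap i j * π, 1) : Equiv.Perm (Fin p) × Equiv.Perm (Fin q))
        = (Equiv.swap i j, 1) * (π, 1) from rfl, map_mul, map_mul, hπ, map_mul,
        blockPerm_swap_left, hg.permHom_swap hij]
      erw [hg.permHom_swap
        (((finSumFinEquiv.trans (finCongr h)).injective.comp Sum.inl_injective).ne hij)]
      rw [← concat_pairHom_left]
      refine (map_mul (concatAlg K A h) _ _).symm.trans ?_
      rw [Algebra.TensorProduct.tmul_mul_tmul, one_mul]
      rfl
  have h2 : permHom g d (blockPerm h (1, b)) = concat K A h (1 ⊗ₜ permHom g q b) := by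
    induction b using Equiv.Perm.swap_induction_on with
    | one =>
      rw [map_one, ← Algebra.TensorProduct.one_def]
      exact ((congrArg _ (map_one (blockPerm h))).trans (map_one _)).trans
        (map_one (concatAlg K A h)).symm
    | swap_mul π i j hij hπ =>
      rw [show ((1, Equiv.swap i j * π) : Equiv.Perm (Fin p) × Equiv.Perm (Fin q))
        = (1, Equiv.swap i j) * (1, π) from rfl, map_mul, map_mul, hπ, map_mul,
        blockPerm_swap_right, hg.permHom_swap hij]
      erw [hg.permHom_swap
        (((finSumFinEquiv.trans (finCongr h)).injective.comp Sum.inr_injective).ne hij)]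
      rw [← concat_pairHom_right]
      refine (map_mul (concatAlg K A h) _ _).symm.trans ?_
      rw [Algebra.TensorProduct.tmul_mul_tmul, one_mul]
      rfl
  rw [show (a, b) = (a, 1) * (1, b) by simp, map_mul, map_mul, h1, h2]
  refine (map_mul (concatAlg K A h) _ _).symm.trans ?_
  rw [Algebra.TensorProduct.tmul_mul_tmul, one_mul, mul_one]
  rfl

/-- The action of a Young subgroup is computed factorwise. -/
lemma ActsBy.goldmanAct_blockPerm (hV : ActsBy V g) (a : Equiv.Perm (Fin p))
    (b : Equiv.Perm (Fin q)) (x : ⨂[K]^p V) (y : ⨂[K]^q V) :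
    goldmanAct K A V (blockPerm h (a, b)) (concat K V h (x ⊗ₜ y))
      = concat K V h (goldmanAct K A V a x ⊗ₜ goldmanAct K A V b y) := by
  rw [hV, hV, hV, permTensor_blockPerm, hg.permHom_blockPerm, tensorRightMul_concat]

end Young

/-! ### Tensor powers of sesquilinear forms -/

section FormPow

variable {K : Type uK} [CommRing K] {ι : K →+* K} {A : Type uA} [Ring A] [Algebra K A]
  {V : Type uV} [AddCommGroup V] [Module K V] [Module Aᵐᵒᵖ V] [IsScalarTower K Aᵐᵒᵖ V]
  {σ : A →ₛₗ[ι] A} {d : ℕ}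

lemma semilinearPow_mul (hσ : IsInvolution σ) (a b : ⨂[K]^d A) :
    semilinearPow σ d (a * b) = semilinearPow σ d b * semilinearPow σ d a := by
  induction a using PiTensorProduct.induction_on with
  | add x x' hx hx' => simp only [add_mul, mul_add, map_add, hx, hx']
  | smul_tprod r a =>
  induction b using PiTensorProduct.induction_on with
  | add x x' hx hx' => simp only [add_mul, mul_add, map_add, hx, hx']
  | smul_tprod s b =>
  simp only [smul_mul_smul_comm, map_smulₛₗ, semilinearPow_tprod, PiTensorProduct.tprod_mul_tprod,
    map_mul, mul_comm (ι s)]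
  congr 2
  funext i
  exact hσ.map_mul _ _

lemma semilinearPow_one (hσ : IsInvolution σ) : semilinearPow σ d (1 : ⨂[K]^d A) = 1 := by
  have h1 := hσ.map_one
  rw [PiTensorProduct.one_def, semilinearPow_tprod]
  congr 1
  funext i
  exact h1

lemma semilinearPow_pairHom {i j : Fin d} (hij : i ≠ j) (hσ : IsInvolution σ)
    (S : Finset (A × A)) :
    semilinearPow σ d (pairHom hij (∑ i ∈ S, i.1 ⊗ₜ[K] i.2))
      = pairHom hij (∑ i ∈ S, σ i.1 ⊗ₜ[K] σ i.2) := by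
  have h1 := hσ.map_one
  simp only [map_sum, pairHom_tmul, semilinearPow_tprod]
  refine Finset.sum_congr rfl fun s _ => ?_
  congr 1
  funext k
  by_cases hi : k = i
  · subst hi; simp only [pairFun_left hij]
  by_cases hj : k = j
  · subst hj; simp only [pairFun_right hij]
  simp only [pairFun_of_ne hi hj, h1]

lemma formPow_tensorRightMul {h : V →ₛₗ[ι] V →ₗ[K] A}
    (hh : ∀ (x y : V) (a b : A),
      h (MulOpposite.op a • x) (MulOpposite.op b • y) = σ a * h x y * b)
    (a b : ⨂[K]^d A) (x y : ⨂[K]^d V) :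
    formPow h d (tensorRightMul K A V d a x) (tensorRightMul K A V d b y)
      = semilinearPow σ d a * formPow h d x y * b := by
  induction x using PiTensorProduct.induction_on with
  | add x x' hx hx' => simp only [add_mul, mul_add, map_add, LinearMap.add_apply, hx, hx']
  | smul_tprod r x =>
  induction y using PiTensorProduct.induction_on with
  | add x x' hx hx' => simp only [add_mul, mul_add, map_add, hx, hx']
  | smul_tprod s y =>
  induction a using PiTensorProduct.induction_on with
  | add x x' hx hx' => simp only [add_mul, map_add, LinearMap.add_apply, hx, hx']
  | smul_tprod r' a =>
  induction b using PiTensorProduct.induction_on with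
  | add x x' hx hx' => simp only [mul_add, map_add, LinearMap.add_apply, hx, hx']
  | smul_tprod s' b =>
  simp only [map_smul, map_smulₛₗ, LinearMap.smul_apply, tensorRightMul_tprod, formPow_tprod, hh,
    semilinearPow_tprod, mul_smul_comm, smul_mul_assoc, PiTensorProduct.tprod_mul_tprod]
  simp only [smul_smul]
  congr 1
  ring

omit [Module Aᵐᵒᵖ V] [IsScalarTower K Aᵐᵒᵖ V] in
lemma formPow_permTensor (h : V →ₛₗ[ι] V →ₗ[K] A) (π : Equiv.Perm (Fin d)) (x y : ⨂[K]^d V) :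
    formPow h d (permTensor K V π x) (permTensor K V π y)
      = permTensor K A π (formPow h d x y) := by
  induction x using PiTensorProduct.induction_on with
  | add x x' hx hx' => simp only [map_add, LinearMap.add_apply, hx, hx']
  | smul_tprod r x =>
  induction y using PiTensorProduct.induction_on with
  | add x x' hx hx' => simp only [map_add, hx, hx']
  | smul_tprod s y =>
  simp only [map_smul, map_smulₛₗ, LinearMap.smul_apply, permTensor_tprod, formPow_tprod]
  rfl

omit [Module Aᵐᵒᵖ V] [IsScalarTower K Aᵐᵒᵖ V] in
lemma formPow_hermitian {ε : K} {h : V →ₛₗ[ι] V →ₗ[K] A}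
    (hh : ∀ x y : V, σ (h x y) = ε • h y x) (hι : ∀ c, ι (ι c) = c) (x y : ⨂[K]^d V) :
    semilinearPow σ d (formPow h d x y) = ε ^ d • formPow h d y x := by
  induction x using PiTensorProduct.induction_on with
  | add x x' hx hx' => simp only [map_add, LinearMap.add_apply, smul_add, hx, hx']
  | smul_tprod r x =>
  induction y using PiTensorProduct.induction_on with
  | add x x' hx hx' => simp only [map_add, LinearMap.add_apply, smul_add, hx, hx']
  | smul_tprod s y =>
  simp only [map_smul, map_smulₛₗ, LinearMap.smul_apply, formPow_tprod, semilinearPow_tprod, hh,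
    hι, MultilinearMap.map_smul_univ, Finset.prod_const, Finset.card_univ, Fintype.card_fin]
  simp only [smul_smul]
  congr 1
  ring

variable [IsArtinianRing K] [IsReduced K] [IsAzumaya K A] {t : A →ₗ[K] K} {g : A ⊗[K] A}
  (hg : IsGoldman t g)

include hg

lemma IsGoldman.semilinearPow_permHom (ht : IsSplitTrace t) (hι : ∀ c, ι (ι c) = c)
    (hσ : IsInvolution σ) (π : Equiv.Perm (Fin d)) :
    semilinearPow σ d (permHom g d π) = permHom g d π⁻¹ := by
  obtain ⟨S, hS⟩ := TensorProduct.exists_finset g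
  induction π using Equiv.Perm.swap_induction_on with
  | one => rw [inv_one, map_one, semilinearPow_one hσ]
  | swap_mul π i j hij h =>
    rw [map_mul, semilinearPow_mul hσ, h, mul_inv_rev, map_mul, Equiv.swap_inv,
      hg.permHom_swap hij]
    congr 1
    conv_lhs => rw [hS]
    rw [semilinearPow_pairHom hij hσ, IsGoldman.sum_map_involution ht hg hι hσ hS]

/-- The Goldman action of a permutation is adjoint to the action of its inverse. -/
lemma ActsBy.formPow_goldmanAct (hV : ActsBy V g) (ht : IsSplitTrace t)
    (hι : ∀ c, ι (ι c) = c) (hσ : IsInvolution σ) {h : V →ₛₗ[ι] V →ₗ[K] A}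
    (hh : ∀ (x y : V) (a b : A),
      h (MulOpposite.op a • x) (MulOpposite.op b • y) = σ a * h x y * b)
    (π : Equiv.Perm (Fin d)) (x y : ⨂[K]^d V) :
    formPow h d (goldmanAct K A V π x) y = formPow h d x (goldmanAct K A V π⁻¹ y) := by
  have h1 := formPow_tensorRightMul hh (permHom g d π) 1 (permTensor K V π x) y
  have h2 := formPow_tensorRightMul hh 1 (permHom g d π⁻¹) x (permTensor K V π⁻¹ y)
  have h3 := permTensor_inv_permTensor π x
  rw [tensorRightMul_one, mul_one, Module.End.one_apply] at h1
  rw [tensorRightMul_one, semilinearPow_one hσ, one_mul, Module.End.one_apply] at h2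
  rw [hV, hV, h1, h2, hg.semilinearPow_permHom ht hι hσ, hg.permHom_mul]
  congr 1
  refine (formPow_permTensor h π⁻¹ (permTensor K V π x) y).symm.trans ?_
  rw [h3]

end FormPow

/-! ### Shuffles -/

section Shuffles

variable {p q d : ℕ} (h : p + q = d)

lemma mem_shuffles_iff (π : Equiv.Perm (Fin d)) : π ∈ shuffles p d ↔
    StrictMono (fun i : Fin p => π (finSumFinEquiv.trans (finCongr h) (Sum.inl i))) ∧
    StrictMono (fun i : Fin q => π (finSumFinEquiv.trans (finCongr h) (Sum.inr i))) := by
  subst h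
  simp only [shuffles, Finset.mem_filter, Finset.mem_univ, true_and]
  refine and_congr ⟨fun H i j hij => ?_, fun H i j hij hj => ?_⟩
    ⟨fun H i j hij => ?_, fun H i j hij hi => ?_⟩
  · exact H _ _ (Fin.strictMono_castAdd q hij) (by simp)
  · exact H (a := ⟨i, lt_trans hij hj⟩) (b := ⟨j, hj⟩) hij
  · exact H _ _ (Fin.strictMono_natAdd p hij) (by simp)
  · have hi' : (i : ℕ) - p < q := by omega
    have hj' : (j : ℕ) - p < q := by omega
    have hij' : (i : ℕ) < j := hij
    have e1 : i = finSumFinEquiv.trans (finCongr rfl) (Sum.inr (⟨i - p, hi'⟩ : Fin q)) :=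
      Fin.ext (by simp; omega)
    have e2 : j = finSumFinEquiv.trans (finCongr rfl) (Sum.inr (⟨j - p, hj'⟩ : Fin q)) :=
      Fin.ext (by simp; omega)
    rw [e1, e2]
    exact H (Fin.lt_def.2 (by change (i : ℕ) - p < j - p; omega))

lemma perm_eq_one_of_strictMono {n : ℕ} {c : Equiv.Perm (Fin n)} (hc : StrictMono c) : c = 1 :=
  Equiv.ext fun i => congrFun (congrArg DFunLike.coe
    (Subsingleton.elim (hc.orderIsoOfSurjective c c.surjective) (OrderIso.refl _))) i

lemma eq_one_of_strictMono_comp {n : ℕ} {α : Type*} [LinearOrder α] {f : Fin n → α}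
    (hf : StrictMono f) {c : Equiv.Perm (Fin n)} (hc : StrictMono (f ∘ c)) : c = 1 :=
  perm_eq_one_of_strictMono fun _ _ hij => hf.lt_iff_lt.1 (hc hij)

/-- Every permutation is in a unique way the product of a shuffle and of a permutation of the two
blocks. -/
theorem bijective_shuffles_mul_blockPerm : Function.Bijective
    fun x : shuffles p d × (Equiv.Perm (Fin p) × Equiv.Perm (Fin q)) =>
      (x.1 : Equiv.Perm (Fin d)) * blockPerm h x.2 := by
  constructor
  · rintro ⟨⟨π, hπ⟩, x⟩ ⟨⟨π', hπ'⟩, x'⟩ hx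
    have hx : π * blockPerm h x = π' * blockPerm h x' := hx
    have h1 : π = π' * blockPerm h (x' * x⁻¹) := by
      rw [map_mul, map_inv, ← mul_assoc, ← hx, mul_inv_cancel_right]
    obtain ⟨a, b, hab⟩ : ∃ a b, x' * x⁻¹ = (a, b) := ⟨_, _, rfl⟩
    rw [hab] at h1
    rw [mem_shuffles_iff h] at hπ hπ'
    have ha : a = 1 := by
      refine eq_one_of_strictMono_comp hπ'.1 ?_
      convert hπ.1 using 2 with i
      rw [h1, Equiv.Perm.mul_apply, blockPerm_apply_inl]
      rfl
    have hb : b = 1 := by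
      refine eq_one_of_strictMono_comp hπ'.2 ?_
      convert hπ.2 using 2 with i
      rw [h1, Equiv.Perm.mul_apply, blockPerm_apply_inr]
      rfl
    have h2 : x' * x⁻¹ = 1 := by rw [hab, ha, hb]; rfl
    obtain rfl := mul_inv_eq_one.1 h2
    obtain rfl := mul_right_cancel hx
    rfl
  · intro ρ
    let f : Fin p → Fin d := fun i => ρ (finSumFinEquiv.trans (finCongr h) (Sum.inl i))
    let f' : Fin q → Fin d := fun i => ρ (finSumFinEquiv.trans (finCongr h) (Sum.inr i))
    have hf : Function.Injective f :=
      ρ.injective.comp ((finSumFinEquiv.trans (finCongr h)).injective.comp Sum.inl_injective)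
    have hf' : Function.Injective f' :=
      ρ.injective.comp ((finSumFinEquiv.trans (finCongr h)).injective.comp Sum.inr_injective)
    refine ⟨⟨⟨ρ * blockPerm h (Tuple.sort f, Tuple.sort f'), (mem_shuffles_iff h _).2 ⟨?_, ?_⟩⟩,
      (Tuple.sort f, Tuple.sort f')⁻¹⟩, ?_⟩
    · convert (Tuple.monotone_sort f).strictMono_of_injective (hf.comp (Tuple.sort f).injective)
        using 2 with i
      rw [Equiv.Perm.mul_apply, blockPerm_apply_inl]
      rfl
    · convert (Tuple.monotone_sort f').strictMono_of_injective (hf'.comp (Tuple.sort f').injective)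
        using 2 with i
      rw [Equiv.Perm.mul_apply, blockPerm_apply_inr]
      rfl
    · change ρ * blockPerm h _ * blockPerm h _⁻¹ = ρ
      rw [map_inv, mul_inv_cancel_right]

/-- The indicator function of the first `p` positions. -/
def firstBlock (p d : ℕ) (i : Fin d) : Bool := decide ((i : ℕ) < p)

lemma firstBlock_inl (i : Fin p) :
    firstBlock p d (finSumFinEquiv.trans (finCongr h) (Sum.inl i)) = true := by
  simp [firstBlock]

lemma firstBlock_inr (i : Fin q) :
    firstBlock p d (finSumFinEquiv.trans (finCongr h) (Sum.inr i)) = false := by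
  simp [firstBlock]

/-- A shuffle that preserves the blocks is trivial. -/
lemma eq_one_of_mem_shuffles {π : Equiv.Perm (Fin d)} (hπ : π ∈ shuffles p d)
    (hb : firstBlock p d ∘ π.symm = firstBlock p d) : π = 1 := by
  have hb' : ∀ i, ((π i : ℕ) < p ↔ (i : ℕ) < p) := fun i => by
    have := congrFun hb (π i)
    simp only [Function.comp_apply, Equiv.symm_apply_apply, firstBlock, decide_eq_decide] at this
    exact this.symm
  simp only [shuffles, Finset.mem_filter, Finset.mem_univ, true_and] at hπ
  refine perm_eq_one_of_strictMono fun i j hij => ?_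
  by_cases hj : (j : ℕ) < p
  · exact hπ.1 i j hij hj
  by_cases hi : p ≤ (i : ℕ)
  · exact hπ.2 i j hij hi
  · exact Fin.lt_def.2 (lt_of_lt_of_le ((hb' i).2 (not_le.1 hi))
      (not_lt.1 fun H => hj ((hb' j).1 H)))

lemma card_firstBlock (hp : p ≤ d) :
    (Finset.univ.filter fun i => firstBlock p d i = true).card = p := by
  simp only [firstBlock, decide_eq_true_eq]
  rw [Fin.card_filter_val_lt]
  omega

/-- Block sizes are invariants of the indicator functions under permutations. -/
lemma eq_of_firstBlock_comp {p' : ℕ} (hp : p ≤ d) (hp' : p' ≤ d) {π : Equiv.Perm (Fin d)}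
    (hb : firstBlock p d ∘ π.symm = firstBlock p' d) : p = p' := by
  rw [← card_firstBlock hp, ← card_firstBlock hp', ← hb]
  refine Finset.card_bij (fun i _ => π i) ?_ (fun _ _ _ _ h => π.injective h) ?_
  · simp
  · intro b hb
    exact ⟨π.symm b, by simpa using hb, by simp⟩

lemma exists_perm_comp_eq_firstBlock (c : Fin d → Bool) :
    ∃ p q : ℕ, p + q = d ∧ ∃ π : Equiv.Perm (Fin d), c ∘ π = firstBlock p d := by
  let s : Finset (Fin d) := Finset.univ.filter fun i => c i = true
  have h : s.card + sᶜ.card = d := by rw [Finset.card_add_card_compl, Fintype.card_fin]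
  refine ⟨s.card, sᶜ.card, h, (finSumFinEquiv.trans (finCongr h)).symm.trans
    (finSumEquivOfFinset (m := s.card) (n := sᶜ.card) (s := s) rfl rfl), ?_⟩
  funext i
  obtain ⟨i, rfl⟩ := (finSumFinEquiv.trans (finCongr h)).surjective i
  rw [Function.comp_apply, Equiv.trans_apply, Equiv.symm_apply_apply]
  rcases i with i | i
  · rw [firstBlock_inl, finSumEquivOfFinset_inl]
    exact (Finset.mem_filter.1 (s.orderEmbOfFin_mem rfl i)).2
  · rw [firstBlock_inr, finSumEquivOfFinset_inr]
    have := Finset.mem_compl.1 (sᶜ.orderEmbOfFin_mem rfl i)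
    exact Bool.eq_false_iff.2 fun H => this (Finset.mem_filter.2 ⟨Finset.mem_univ _, H⟩)

end Shuffles

/-! ### The anti-symmetrizer -/

section Antisymm

variable {K : Type uK} [CommRing K] {A : Type uA} [Ring A] [Algebra K A]
  {V : Type uV} [AddCommGroup V] [Module K V] [Module Aᵐᵒᵖ V] [IsScalarTower K Aᵐᵒᵖ V]
  {U : Type uU} [AddCommGroup U] [Module K U] [Module Aᵐᵒᵖ U] [IsScalarTower K Aᵐᵒᵖ U]
  {p q d : ℕ}

variable (K) in
/-- The sign of a permutation, as an element of `K`. -/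
def permSign (π : Equiv.Perm (Fin d)) : K := ((Equiv.Perm.sign π : ℤ) : K)

@[simp] lemma permSign_one : permSign K (1 : Equiv.Perm (Fin d)) = 1 := by simp [permSign]

lemma permSign_mul (π ρ : Equiv.Perm (Fin d)) :
    permSign K (π * ρ) = permSign K π * permSign K ρ := by
  simp [permSign]

lemma permSign_mul_self (π : Equiv.Perm (Fin d)) : permSign K π * permSign K π = 1 := by
  rw [permSign, ← Int.cast_mul, ← Units.val_mul, Int.units_mul_self, Units.val_one, Int.cast_one]

lemma permSign_inv (π : Equiv.Perm (Fin d)) : permSign K π⁻¹ = permSign K π := by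
  rw [permSign, Equiv.Perm.sign_inv, permSign]

lemma permSign_blockPerm (h : p + q = d) (a : Equiv.Perm (Fin p)) (b : Equiv.Perm (Fin q)) :
    permSign K (blockPerm h (a, b)) = permSign K a * permSign K b := by
  rw [permSign, sign_blockPerm, Units.val_mul, Int.cast_mul, permSign, permSign]

lemma altAct_apply (Y : Finset (Equiv.Perm (Fin d))) (x : ⨂[K]^d V) :
    altAct K A V Y x = ∑ π ∈ Y, permSign K π • goldmanAct K A V π x := by
  rw [altAct, LinearMap.sum_apply]
  refine Finset.sum_congr rfl fun π _ => ?_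
  rcases Int.units_eq_one_or (Equiv.Perm.sign π) with h | h <;> simp [permSign, h]

lemma altAct_smul (Y : Finset (Equiv.Perm (Fin d))) (r : K) (x : ⨂[K]^d V) :
    altAct K A V Y (r • x) = r • altAct K A V Y x := by
  simp only [altAct_apply, goldmanAct_smul, Finset.smul_sum, smul_comm r]

lemma antisymm_apply (x : ⨂[K]^d V) :
    antisymm K A V d x
      = ∑ π : Equiv.Perm (Fin d), permSign K π • goldmanAct K A V π x :=
  altAct_apply _ x

lemma antisymm_smul (r : K) (x : ⨂[K]^d V) :
    antisymm K A V d (r • x) = r • antisymm K A V d x :=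
  altAct_smul _ r x

/-- The anti-symmetrizer absorbs permutations up to their sign. -/
lemma antisymm_goldmanAct (π : Equiv.Perm (Fin d)) (x : ⨂[K]^d V) :
    antisymm K A V d (goldmanAct K A V π x) = permSign K π • antisymm K A V d x := by
  rw [antisymm_apply, antisymm_apply]
  refine Eq.trans ?_ (Finset.smul_sum (r := permSign K π)).symm
  refine Fintype.sum_equiv (Equiv.mulRight π) _ _ fun ρ => ?_
  rw [Equiv.coe_mulRight, goldmanAct_mul, smul_smul, permSign_mul, mul_comm, mul_assoc,
    permSign_mul_self, mul_one]

lemma antisymm_mapPow {g : A ⊗[K] A} (hU : ActsBy U g) (hV : ActsBy V g)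
    (f : U →ₗ[Aᵐᵒᵖ] V) (x : ⨂[K]^d U) :
    antisymm K A V d (mapPow (fun _ => f) x) = mapPow (fun _ => f) (antisymm K A U d x) := by
  rw [antisymm_apply, antisymm_apply, map_sum]
  refine Finset.sum_congr rfl fun π _ => ?_
  rw [map_smul, hU.goldmanAct_mapPow hV]
  rfl

/-- The anti-symmetrizer is the sum over shuffles times the anti-symmetrizers of the blocks. -/
theorem altAct_shuffles_concat {t : A →ₗ[K] K} {g : A ⊗[K] A} (hg : IsGoldman t g)
    (hV : ActsBy V g) (h : p + q = d) (x : ⨂[K]^p V) (y : ⨂[K]^q V) :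
    altAct K A V (shuffles p d) (concat K V h (antisymm K A V p x ⊗ₜ antisymm K A V q y))
      = antisymm K A V d (concat K V h (x ⊗ₜ y)) := by
  have h1 : concat K V h (antisymm K A V p x ⊗ₜ antisymm K A V q y)
      = ∑ ab : Equiv.Perm (Fin p) × Equiv.Perm (Fin q), permSign K (blockPerm h ab) •
          goldmanAct K A V (blockPerm h ab) (concat K V h (x ⊗ₜ y)) := by
    rw [antisymm_apply, antisymm_apply, TensorProduct.sum_tmul, map_sum, Fintype.sum_prod_type]
    refine Finset.sum_congr rfl fun a _ => ?_
    rw [TensorProduct.tmul_sum, map_sum]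
    refine Finset.sum_congr rfl fun b _ => ?_
    rw [hV.goldmanAct_blockPerm h hg, permSign_blockPerm, ← TensorProduct.smul_tmul',
      TensorProduct.tmul_smul, map_smul, map_smul, smul_smul]
  rw [h1, map_sum, antisymm_apply,
    ← (bijective_shuffles_mul_blockPerm h).sum_comp
      (fun π => permSign K π • goldmanAct K A V π (concat K V h (x ⊗ₜ y)))]
  refine Eq.trans ?_ (Fintype.sum_prod_type_right _).symm
  refine Finset.sum_congr rfl fun ab _ => ?_
  rw [altAct_smul, altAct_apply, ← Finset.sum_coe_sort]
  refine Finset.smul_sum.trans (Finset.sum_congr rfl fun π _ => ?_)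
  rw [goldmanAct_mul, smul_smul, permSign_mul, mul_comm]

end Antisymm

/-! ### Tensor powers of a direct sum -/

section DirectSumPower

variable {K : Type uK} [CommRing K] {A : Type uA} [Ring A] [Algebra K A]
  {U : Type uU} [AddCommGroup U] [Module K U] [Module Aᵐᵒᵖ U] [IsScalarTower K Aᵐᵒᵖ U]
  {V : Type uV} [AddCommGroup V] [Module K V] [Module Aᵐᵒᵖ V] [IsScalarTower K Aᵐᵒᵖ V]
  {p q d : ℕ}

variable (K A U V) in
/-- The inclusion of `U^{⊗ p} ⊗ V^{⊗ q}` into `(U ⊕ V)^{⊗ d}`, where `U` takes the first `p` and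
`V` the last `q` positions. -/
def juxtapose (h : p + q = d) : (⨂[K]^p U) ⊗[K] (⨂[K]^q V) →ₗ[K] ⨂[K]^d (U × V) :=
  (concat K (U × V) h).toLinearMap ∘ₗ
    TensorProduct.map (mapPow fun _ => LinearMap.inl Aᵐᵒᵖ U V)
      (mapPow fun _ => LinearMap.inr Aᵐᵒᵖ U V)

variable (K A U V) in
/-- The projection of `(U ⊕ V)^{⊗ d}` to `U^{⊗ p} ⊗ V^{⊗ q}`. -/
def blockProj (h : p + q = d) : ⨂[K]^d (U × V) →ₗ[K] (⨂[K]^p U) ⊗[K] (⨂[K]^q V) :=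
  TensorProduct.map (mapPow fun _ => LinearMap.fst Aᵐᵒᵖ U V)
      (mapPow fun _ => LinearMap.snd Aᵐᵒᵖ U V) ∘ₗ
    (concat K (U × V) h).symm.toLinearMap

variable (A U V) in
/-- The projection of `U ⊕ V` to one of its summands. -/
def summandProj (b : Bool) : (U × V) →ₗ[Aᵐᵒᵖ] (U × V) :=
  if b then LinearMap.inl Aᵐᵒᵖ U V ∘ₗ LinearMap.fst Aᵐᵒᵖ U V
  else LinearMap.inr Aᵐᵒᵖ U V ∘ₗ LinearMap.snd Aᵐᵒᵖ U V

variable (K A U V) in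
/-- The projection of `(U ⊕ V)^{⊗ d}` to the tensor product of the summands prescribed by `c`. -/
def colorProj (c : Fin d → Bool) : ⨂[K]^d (U × V) →ₗ[K] ⨂[K]^d (U × V) :=
  mapPow fun i => summandProj A U V (c i)

omit [Module K U] [Module K V] [IsScalarTower K Aᵐᵒᵖ U] [IsScalarTower K Aᵐᵒᵖ V] [Algebra K A] in
lemma summandProj_comp (b b' : Bool) (m : U × V) :
    summandProj A U V b (summandProj A U V b' m) = if b = b' then summandProj A U V b m else 0 := by
  cases b <;> cases b' <;> simp [summandProj]

lemma blockProj_juxtapose (h : p + q = d) (z : (⨂[K]^p U) ⊗[K] (⨂[K]^q V)) :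
    blockProj K A U V h (juxtapose K A U V h z) = z := by
  simp only [blockProj, juxtapose, LinearMap.comp_apply, LinearEquiv.coe_coe,
    LinearEquiv.symm_apply_apply]
  induction z using TensorProduct.induction_on with
  | zero => simp
  | add x y hx hy => simp only [map_add, hx, hy]
  | tmul x y =>
    rw [TensorProduct.map_tmul, TensorProduct.map_tmul]
    congr 1
    · induction x using PiTensorProduct.induction_on with
      | add x y hx hy => simp only [map_add, hx, hy]
      | smul_tprod r x => simp
    · induction y using PiTensorProduct.induction_on with
      | add x y hx hy => simp only [map_add, hx, hy]
      | smul_tprod r x => simp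

lemma juxtapose_blockProj (h : p + q = d) (z : ⨂[K]^d (U × V)) :
    juxtapose K A U V h (blockProj K A U V h z) = colorProj K A U V (firstBlock p d) z := by
  obtain ⟨z, rfl⟩ := (concat K (U × V) h).surjective z
  simp only [blockProj, juxtapose, LinearMap.comp_apply, LinearEquiv.coe_coe,
    LinearEquiv.symm_apply_apply]
  induction z using TensorProduct.induction_on with
  | zero => simp
  | add x y hx hy => simp only [map_add, hx, hy]
  | tmul x y =>
  induction x using PiTensorProduct.induction_on with
  | add x x' hx hx' => simp only [TensorProduct.add_tmul, map_add, hx, hx']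
  | smul_tprod r x =>
  induction y using PiTensorProduct.induction_on with
  | add x x' hx hx' => simp only [TensorProduct.tmul_add, map_add, hx, hx']
  | smul_tprod s y =>
  simp only [← TensorProduct.smul_tmul', TensorProduct.tmul_smul, map_smul,
    TensorProduct.map_tmul, mapPow_tprod, concat_tprod, colorProj]
  congr 3
  funext i
  obtain ⟨i, rfl⟩ := (finSumFinEquiv.trans (finCongr h)).surjective i
  rw [Equiv.symm_apply_apply]
  rcases i with i | i
  · rw [firstBlock_inl]; rfl
  · rw [firstBlock_inr]; rfl

lemma colorProj_juxtapose (h : p + q = d) (z : (⨂[K]^p U) ⊗[K] (⨂[K]^q V)) :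
    colorProj K A U V (firstBlock p d) (juxtapose K A U V h z) = juxtapose K A U V h z := by
  rw [← juxtapose_blockProj h, blockProj_juxtapose]

lemma colorProj_colorProj_of_ne {c c' : Fin d → Bool} (hc : c ≠ c') (z : ⨂[K]^d (U × V)) :
    colorProj K A U V c (colorProj K A U V c' z) = 0 := by
  obtain ⟨i, hi⟩ := Function.ne_iff.1 hc
  induction z using PiTensorProduct.induction_on with
  | add x y hx hy => simp only [map_add, hx, hy, add_zero]
  | smul_tprod r m =>
    rw [map_smul, map_smul, colorProj, colorProj, mapPow_tprod, mapPow_tprod]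
    rw [MultilinearMap.map_coord_zero (f := PiTensorProduct.tprod K) i, smul_zero]
    rw [summandProj_comp, if_neg hi]

lemma sum_colorProj (z : ⨂[K]^d (U × V)) :
    ∑ c : Fin d → Bool, colorProj K A U V c z = z := by
  induction z using PiTensorProduct.induction_on with
  | add x y hx hy => simp only [map_add, Finset.sum_add_distrib, hx, hy]
  | smul_tprod r m =>
    simp only [map_smul, colorProj, mapPow_tprod]
    refine Finset.smul_sum.symm.trans ?_
    have h1 := MultilinearMap.map_sum (PiTensorProduct.tprod K)
      (fun (i : Fin d) (b : Bool) => summandProj A U V b (m i))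
    rw [← h1]
    congr 2
    funext i
    simp [summandProj]

lemma juxtapose_tensorRightMul (h : p + q = d) (a : ⨂[K]^p A) (b : ⨂[K]^q A)
    (x : ⨂[K]^p U) (y : ⨂[K]^q V) :
    juxtapose K A U V h (tensorRightMul K A U p a x ⊗ₜ tensorRightMul K A V q b y)
      = tensorRightMul K A (U × V) d (concat K A h (a ⊗ₜ b)) (juxtapose K A U V h (x ⊗ₜ y)) := by
  simp only [juxtapose, LinearMap.comp_apply, TensorProduct.map_tmul, mapPow_tensorRightMul,
    LinearEquiv.coe_coe, tensorRightMul_concat]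

variable {g : A ⊗[K] A} (hM : ActsBy (U × V) g)

include hM

lemma ActsBy.goldmanAct_colorProj (π : Equiv.Perm (Fin d)) (c : Fin d → Bool)
    (z : ⨂[K]^d (U × V)) :
    goldmanAct K A (U × V) π (colorProj K A U V c z)
      = colorProj K A U V (c ∘ π.symm) (goldmanAct K A (U × V) π z) :=
  hM.goldmanAct_mapPow hM π _ z

/-- A permutation that does not carry the first `p` positions to the first `p'` positions moves the
block `U^{⊗ p} ⊗ V^{⊗ q}` away from `U^{⊗ p'} ⊗ V^{⊗ q'}`. -/
lemma ActsBy.blockProj_goldmanAct_juxtapose {p' q' : ℕ} (h : p + q = d) (h' : p' + q' = d)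
    {π : Equiv.Perm (Fin d)} (hπ : firstBlock p d ∘ π.symm ≠ firstBlock p' d)
    (z : (⨂[K]^p U) ⊗[K] (⨂[K]^q V)) :
    blockProj K A U V h' (goldmanAct K A (U × V) π (juxtapose K A U V h z)) = 0 := by
  rw [← blockProj_juxtapose (A := A) h' (blockProj K A U V h' _), juxtapose_blockProj,
    ← colorProj_juxtapose, hM.goldmanAct_colorProj, colorProj_colorProj_of_ne hπ.symm, map_zero]

/-- Only the identity shuffle preserves the blocks, so the block projection inverts the shuffle
product. -/
lemma ActsBy.blockProj_altAct_shuffles (h : p + q = d) (z : (⨂[K]^p U) ⊗[K] (⨂[K]^q V)) :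
    blockProj K A U V h (altAct K A (U × V) (shuffles p d) (juxtapose K A U V h z)) = z := by
  rw [altAct_apply, map_sum, Finset.sum_eq_single 1]
  · rw [permSign_one, one_smul, goldmanAct_one, blockProj_juxtapose]
  · intro π hπ h1
    rw [map_smul, hM.blockProj_goldmanAct_juxtapose h h
      (fun e => h1 (eq_one_of_mem_shuffles hπ e)), smul_zero]
  · intro h1
    exact (h1 (Finset.mem_filter.2
      ⟨Finset.mem_univ _, fun _ _ hij _ => hij, fun _ _ hij _ => hij⟩)).elim

lemma ActsBy.blockProj_altAct_shuffles_of_ne {p' q' : ℕ} (h : p + q = d) (h' : p' + q' = d)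
    (hp : p ≠ p') (z : (⨂[K]^p U) ⊗[K] (⨂[K]^q V)) :
    blockProj K A U V h' (altAct K A (U × V) (shuffles p d) (juxtapose K A U V h z)) = 0 := by
  rw [altAct_apply, map_sum]
  refine Finset.sum_eq_zero fun π _ => ?_
  rw [map_smul, hM.blockProj_goldmanAct_juxtapose h h'
    (fun e => hp (eq_of_firstBlock_comp (by omega) (by omega) e)), smul_zero]

/-- Up to sign, every anti-symmetrized tensor is a sum of anti-symmetrized tensors with the
factors from `U` in front. -/
lemma ActsBy.exists_antisymm_colorProj (c : Fin d → Bool) (z : ⨂[K]^d (U × V)) :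
    ∃ (p q : ℕ) (h : p + q = d) (w : (⨂[K]^p U) ⊗[K] (⨂[K]^q V)),
      antisymm K A (U × V) d (colorProj K A U V c z)
        = antisymm K A (U × V) d (juxtapose K A U V h w) := by
  obtain ⟨p, q, h, π, hπ⟩ := exists_perm_comp_eq_firstBlock c
  refine ⟨p, q, h, permSign K π •
    blockProj K A U V h (goldmanAct K A (U × V) π⁻¹ z), ?_⟩
  have h1 := hM.goldmanAct_colorProj π⁻¹ c z
  rw [show c ∘ (π⁻¹).symm = firstBlock p d from hπ] at h1
  rw [map_smul, juxtapose_blockProj, ← h1, antisymm_smul, antisymm_goldmanAct, permSign_inv,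
    smul_smul, permSign_mul_self, one_smul]

variable {t : A →ₗ[K] K} (hg : IsGoldman t g) (hU : ActsBy U g) (hV : ActsBy V g)

include hg hU hV

lemma ActsBy.altAct_juxtapose_antisymm (h : p + q = d) (x : ⨂[K]^p U) (y : ⨂[K]^q V) :
    altAct K A (U × V) (shuffles p d)
        (juxtapose K A U V h (antisymm K A U p x ⊗ₜ antisymm K A V q y))
      = antisymm K A (U × V) d (juxtapose K A U V h (x ⊗ₜ y)) := by
  simp only [juxtapose, LinearMap.comp_apply, TensorProduct.map_tmul, LinearEquiv.coe_coe]
  rw [← antisymm_mapPow hU hM, ← antisymm_mapPow hV hM, altAct_shuffles_concat hg hM]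

end DirectSumPower

/-! ### The shuffle isomorphism -/

section ShuffleEquiv

variable {K : Type uK} [CommRing K] {A : Type uA} [Ring A] [Algebra K A]
  {U : Type uU} [AddCommGroup U] [Module K U] [Module Aᵐᵒᵖ U] [IsScalarTower K Aᵐᵒᵖ U]
  {V : Type uV} [AddCommGroup V] [Module K V] [Module Aᵐᵒᵖ V] [IsScalarTower K Aᵐᵒᵖ V]
  {d : ℕ}

variable (K A U V) in
/-- The inclusion of `Alt^p(U) ⊗ Alt^q(V)` into `U^{⊗ p} ⊗ V^{⊗ q}`. -/
def altIncl (pq : Finset.HasAntidiagonal.antidiagonal d) :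
    AltSummand K A U V d pq →ₗ[K] (⨂[K]^pq.1.1 U) ⊗[K] (⨂[K]^pq.1.2 V) :=
  TensorProduct.map ((Alt K A U pq.1.1).subtype.restrictScalars K)
    ((Alt K A V pq.1.2).subtype.restrictScalars K)

lemma altIncl_altTmul {pq : Finset.HasAntidiagonal.antidiagonal d} (x : Alt K A U pq.1.1)
    (y : Alt K A V pq.1.2) :
    altIncl K A U V pq (altTmul x y) = (x : ⨂[K]^pq.1.1 U) ⊗ₜ (y : ⨂[K]^pq.1.2 V) := rfl

lemma altIncl_injective [IsSemisimpleRing K] (pq : Finset.HasAntidiagonal.antidiagonal d) :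
    Function.Injective (altIncl K A U V pq) := by
  have := Module.projective_of_isSemisimpleRing K (⨂[K]^pq.1.1 U)
  have := Module.projective_of_isSemisimpleRing K (Alt K A V pq.1.2)
  exact TensorProduct.map_injective_of_flat_flat _ _ Subtype.val_injective Subtype.val_injective

variable (K A U V) in
/-- The shuffle product `Alt^p(U) ⊗ Alt^q(V) → (U ⊕ V)^{⊗ d}`. -/
def shuffleMap (pq : Finset.HasAntidiagonal.antidiagonal d) :
    AltSummand K A U V d pq →ₗ[K] ⨂[K]^d (U × V) :=
  (altAct K A (U × V) (shuffles pq.1.1 d)).restrictScalars K ∘ₗ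
    juxtapose K A U V (Finset.HasAntidiagonal.mem_antidiagonal.1 pq.2) ∘ₗ altIncl K A U V pq

lemma shuffleMap_apply (pq : Finset.HasAntidiagonal.antidiagonal d)
    (z : AltSummand K A U V d pq) :
    shuffleMap K A U V pq z = altAct K A (U × V) (shuffles pq.1.1 d)
      (juxtapose K A U V (Finset.HasAntidiagonal.mem_antidiagonal.1 pq.2)
        (altIncl K A U V pq z)) := rfl

/-- `Alt^p(U) ⊗ Alt^q(V)` is additively generated by the elements `s_p x ⊗ s_q y`. -/
lemma altSummand_induction {pq : Finset.HasAntidiagonal.antidiagonal d}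
    {P : AltSummand K A U V d pq → Prop} (z : AltSummand K A U V d pq)
    (tmul : ∀ x y, P (altTmul (toAlt K A U _ x) (toAlt K A V _ y)))
    (add : ∀ z z', P z → P z' → P (z + z')) : P z := by
  induction z using TensorProduct.induction_on with
  | zero =>
    have h0 := tmul 0 0
    rw [map_zero] at h0
    exact (TensorProduct.zero_tmul (R := K) (Alt K A U pq.1.1) (toAlt K A V pq.1.2 0)) ▸ h0
  | add x y hx hy => exact add x y hx hy
  | tmul x y =>
    obtain ⟨x, rfl⟩ := (antisymm K A U pq.1.1).surjective_rangeRestrict x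
    obtain ⟨y, rfl⟩ := (antisymm K A V pq.1.2).surjective_rangeRestrict y
    exact tmul x y

lemma shuffleMap_smul (pq : Finset.HasAntidiagonal.antidiagonal d) (a : (⨂[K]^d A)ᵐᵒᵖ)
    (z : AltSummand K A U V d pq) :
    shuffleMap K A U V pq (a • z) = a • shuffleMap K A U V pq z := by
  obtain ⟨a, rfl⟩ := MulOpposite.op_surjective a
  obtain ⟨a, rfl⟩ := (concat K A (Finset.HasAntidiagonal.mem_antidiagonal.1 pq.2)).surjective a
  induction z using altSummand_induction with
  | add x y hx hy => simp only [smul_add, map_add, hx, hy]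
  | tmul x y =>
  induction a using TensorProduct.induction_on with
  | zero => simp only [map_zero, MulOpposite.op_zero, zero_smul]
  | add x y hx hy => simp only [map_add, MulOpposite.op_add, add_smul, hx, hy]
  | tmul a b =>
    rw [altSummand_smul_tmul, shuffleMap_apply, shuffleMap_apply, altIncl_altTmul,
      altIncl_altTmul]
    exact (congrArg (altAct K A (U × V) (shuffles pq.1.1 d)) (juxtapose_tensorRightMul _ a b
      (toAlt K A U _ x : ⨂[K]^pq.1.1 U) (toAlt K A V _ y : ⨂[K]^pq.1.2 V))).trans
      (map_smul (altAct K A (U × V) (shuffles pq.1.1 d)) (MulOpposite.op _) _)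

variable {g : A ⊗[K] A} (hM : ActsBy (U × V) g) {t : A →ₗ[K] K} (hg : IsGoldman t g)
  (hU : ActsBy U g) (hV : ActsBy V g)

include hM hg hU hV

lemma ActsBy.shuffleMap_toAlt (pq : Finset.HasAntidiagonal.antidiagonal d)
    (x : ⨂[K]^pq.1.1 U) (y : ⨂[K]^pq.1.2 V) :
    shuffleMap K A U V pq (altTmul (toAlt K A U _ x) (toAlt K A V _ y))
      = antisymm K A (U × V) d
        (juxtapose K A U V (Finset.HasAntidiagonal.mem_antidiagonal.1 pq.2) (x ⊗ₜ y)) :=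
  hM.altAct_juxtapose_antisymm hg hU hV _ x y

lemma ActsBy.shuffleMap_mem (pq : Finset.HasAntidiagonal.antidiagonal d)
    (z : AltSummand K A U V d pq) : shuffleMap K A U V pq z ∈ Alt K A (U × V) d := by
  induction z using altSummand_induction with
  | add x y hx hy => rw [map_add]; exact add_mem hx hy
  | tmul x y => exact hM.shuffleMap_toAlt hg hU hV pq x y ▸ LinearMap.mem_range_self _ _

/-- The shuffle product as a morphism of right `A^{⊗ d}`-modules. -/
def ActsBy.shuffleHom (pq : Finset.HasAntidiagonal.antidiagonal d) :
    AltSummand K A U V d pq →ₗ[(⨂[K]^d A)ᵐᵒᵖ] Alt K A (U × V) d where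
  toFun z := ⟨shuffleMap K A U V pq z, hM.shuffleMap_mem hg hU hV pq z⟩
  map_add' x y := Subtype.ext (map_add _ x y)
  map_smul' a z := Subtype.ext (shuffleMap_smul pq a z)

/-- The sum of the shuffle products. -/
def ActsBy.shuffleSum (d : ℕ) :
    (⨁ pq, AltSummand K A U V d pq) →ₗ[(⨂[K]^d A)ᵐᵒᵖ] Alt K A (U × V) d :=
  DirectSum.toModule _ _ _ fun pq => hM.shuffleHom hg hU hV pq

lemma ActsBy.shuffleSum_of (pq : Finset.HasAntidiagonal.antidiagonal d)
    (z : AltSummand K A U V d pq) :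
    (hM.shuffleSum hg hU hV d (DirectSum.of _ pq z) : ⨂[K]^d (U × V))
      = shuffleMap K A U V pq z :=
  congrArg Subtype.val (DirectSum.toModule_lof (⨂[K]^d A)ᵐᵒᵖ
    (φ := fun pq => hM.shuffleHom hg hU hV pq) pq z)

/-- The block projections recover the components of an element from its image under the sum of
the shuffle products. -/
lemma ActsBy.blockProj_shuffleSum (z : ⨁ pq, AltSummand K A U V d pq)
    (pq : Finset.HasAntidiagonal.antidiagonal d) :
    blockProj K A U V (Finset.HasAntidiagonal.mem_antidiagonal.1 pq.2)
        (hM.shuffleSum hg hU hV d z : ⨂[K]^d (U × V)) = altIncl K A U V pq (z pq) := by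
  induction z using DirectSum.induction_on with
  | zero => simp
  | add x y hx hy => rw [map_add, Submodule.coe_add, map_add, hx, hy, DirectSum.add_apply, map_add]
  | of pq' z =>
    rw [hM.shuffleSum_of hg hU hV, shuffleMap_apply]
    by_cases hpq : pq' = pq
    · subst hpq
      rw [hM.blockProj_altAct_shuffles, DirectSum.of_eq_same]
    · rw [hM.blockProj_altAct_shuffles_of_ne, DirectSum.of_eq_of_ne _ _ _ (Ne.symm hpq), map_zero]
      intro h
      have h1 := Finset.HasAntidiagonal.mem_antidiagonal.1 pq.2
      have h2 := Finset.HasAntidiagonal.mem_antidiagonal.1 pq'.2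
      exact hpq (Subtype.ext (Prod.ext h (by omega)))

/-- The sum of the shuffle products is an isomorphism: the block projections show injectivity, and
for surjectivity a permutation moves the factors from `U` to the front. -/
theorem ActsBy.shuffleSum_bijective [IsSemisimpleRing K] (d : ℕ) :
    Function.Bijective (hM.shuffleSum hg hU hV d) := by
  constructor
  · rw [injective_iff_map_eq_zero]
    intro z hz
    refine DFinsupp.ext fun pq => altIncl_injective pq ?_
    rw [← hM.blockProj_shuffleSum hg hU hV z pq, hz]
    simp
  · have key : ∀ (p q : ℕ) (h : p + q = d) (w : (⨂[K]^p U) ⊗[K] (⨂[K]^q V)),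
        toAlt K A (U × V) d (juxtapose K A U V h w)
          ∈ LinearMap.range (hM.shuffleSum hg hU hV d) := by
      intro p q h w
      induction w using TensorProduct.induction_on with
      | zero => rw [map_zero, map_zero]; exact zero_mem _
      | add x y hx hy => rw [map_add, map_add]; exact add_mem hx hy
      | tmul x y =>
        let pq : Finset.HasAntidiagonal.antidiagonal d :=
          ⟨(p, q), Finset.HasAntidiagonal.mem_antidiagonal.2 h⟩
        refine ⟨DirectSum.of (AltSummand K A U V d) pq
          (altTmul (toAlt K A U p x) (toAlt K A V q y)), Subtype.ext ?_⟩
        rw [hM.shuffleSum_of hg hU hV]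
        exact hM.shuffleMap_toAlt hg hU hV pq x y
    intro u
    obtain ⟨x, rfl⟩ : ∃ x, toAlt K A (U × V) d x = u :=
      (antisymm K A (U × V) d).surjective_rangeRestrict u
    change toAlt K A (U × V) d x ∈ LinearMap.range (hM.shuffleSum hg hU hV d)
    rw [← sum_colorProj (A := A) x, map_sum]
    refine sum_mem fun c _ => ?_
    obtain ⟨p, q, h, w, hw⟩ := hM.exists_antisymm_colorProj c x
    have := key p q h w
    rwa [show toAlt K A (U × V) d (juxtapose K A U V h w)
      = toAlt K A (U × V) d (colorProj K A U V c x)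
      from Subtype.ext hw.symm] at this

end ShuffleEquiv

/-! ### Forms on alternating powers -/

section AltForm

variable {K : Type uK} [CommRing K] {ι : K →+* K} {A : Type uA} [Ring A] [Algebra K A]
  {V : Type uV} [AddCommGroup V] [Module K V] [Module Aᵐᵒᵖ V] [IsScalarTower K Aᵐᵒᵖ V]
  {σ : A →ₛₗ[ι] A} {d : ℕ}

instance (W : Type*) [AddCommGroup W] : AddCommGroup (Twist ι W) :=
  inferInstanceAs (AddCommGroup W)

lemma exists_semilinear_retraction [IsSemisimpleRing K] (hι : ∀ c, ι (ι c) = c)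
    {M N : Type*} [AddCommGroup M] [Module K M] [AddCommGroup N] [Module K N]
    (f : M →ₛₗ[ι] N) (hf : Function.Injective f) : ∃ r : N →ₛₗ[ι] M, ∀ x, r (f x) = x := by
  let F : M →ₗ[K] Twist ι N :=
    { toFun := fun x => (f x : N)
      map_add' := fun x y => map_add f x y
      map_smul' := fun c x => map_smulₛₗ f c x }
  obtain ⟨r, hr⟩ := IsSemisimpleModule.extension_property F hf LinearMap.id
  refine ⟨{ toFun := fun n => r (n : N), map_add' := fun x y => map_add r x y,
            map_smul' := fun c n => ?_ }, LinearMap.congr_fun hr⟩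
  have h1 : (show Twist ι N from (c • n : N)) = ι c • (show Twist ι N from n) := by
    change c • n = ι (ι c) • n
    rw [hι]
  exact (congrArg r h1).trans (map_smul r _ _)

omit [Module Aᵐᵒᵖ V] [IsScalarTower K Aᵐᵒᵖ V] in
/-- A nondegenerate sesquilinear form on a finite module recovers its arguments: the injective map
`x ↦ h(x, ·)` has a retraction, and functionals to `A` are determined by finitely many values. -/
lemma exists_reconstruction [IsSemisimpleRing K] [Module.Finite K A] [Module.Finite K V]
    (hι : ∀ c, ι (ι c) = c) (h : V →ₛₗ[ι] V →ₗ[K] A) (hn : ∀ x, (∀ y, h x y = 0) → x = 0) :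
    ∃ (S : Type) (_ : Fintype S) (ξ : S → A →ₗ[K] K) (w u : S → V),
      ∀ x, ∑ s, ι (ξ s (h x (w s))) • u s = x := by
  have := Module.projective_of_isSemisimpleRing K A
  have := Module.projective_of_isSemisimpleRing K V
  obtain ⟨m, a, α, ha⟩ := exists_dual_basis K A
  obtain ⟨n, v, f, hf⟩ := exists_dual_basis K V
  have hh : Function.Injective h := by
    rw [injective_iff_map_eq_zero]
    exact fun x hx => hn x fun y => by rw [hx, LinearMap.zero_apply]
  obtain ⟨r, hr⟩ := exists_semilinear_retraction hι h hh
  refine ⟨Fin m × Fin n, inferInstance, fun s => α s.1, fun s => v s.2,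
    fun s => r ((f s.2).smulRight (a s.1)), fun x => ?_⟩
  have h2 : h x = ∑ s : Fin m × Fin n, α s.1 (h x (v s.2)) • (f s.2).smulRight (a s.1) := by
    ext y
    rw [LinearMap.sum_apply, Fintype.sum_prod_type]
    conv_lhs => rw [← ha (h x y)]
    refine Finset.sum_congr rfl fun i _ => ?_
    conv_lhs => rw [← hf y]
    simp [map_sum, Finset.sum_smul, mul_comm, smul_smul]
  have h3 := congrArg r h2
  rw [hr, map_sum] at h3
  exact (h3.trans (Finset.sum_congr rfl fun s _ => map_smulₛₗ r _ _)).symm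

omit [Module Aᵐᵒᵖ V] [IsScalarTower K Aᵐᵒᵖ V] in
/-- The tensor power of a nondegenerate sesquilinear form is nondegenerate. -/
lemma formPow_nondegenerate [IsSemisimpleRing K] [Module.Finite K A] [Module.Finite K V]
    (hι : ∀ c, ι (ι c) = c) (h : V →ₛₗ[ι] V →ₗ[K] A) (hn : ∀ x, (∀ y, h x y = 0) → x = 0)
    (x : ⨂[K]^d V) (hx : ∀ y, formPow h d x y = 0) : x = 0 := by
  classical
  obtain ⟨S, _, ξ, w, u, hS⟩ := exists_reconstruction hι h hn
  let Ξ : (Fin d → S) → (⨂[K]^d A →ₗ[K] K) := fun s => PiTensorProduct.lift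
    ((MultilinearMap.mkPiAlgebra K (Fin d) K).compLinearMap fun i => ξ (s i))
  have key : ∀ x : ⨂[K]^d V, ∑ s : Fin d → S,
      ι (Ξ s (formPow h d x (PiTensorProduct.tprod K fun i => w (s i)))) •
        PiTensorProduct.tprod K (fun i => u (s i)) = x := by
    intro x
    induction x using PiTensorProduct.induction_on with
    | add x y hx hy =>
      simp only [map_add, LinearMap.add_apply, add_smul, Finset.sum_add_distrib, hx, hy]
    | smul_tprod r x =>
      have h1 := MultilinearMap.map_sum (PiTensorProduct.tprod K)
        (fun (i : Fin d) (s : S) => ι (ξ s (h (x i) (w s))) • u s)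
      simp only [hS, MultilinearMap.map_smul_univ] at h1
      have h2 : ∀ s, Ξ s (formPow h d (PiTensorProduct.tprod K x)
          (PiTensorProduct.tprod K fun i => w (s i))) = ∏ i, ξ (s i) (h (x i) (w (s i))) := by
        intro s
        rw [formPow_tprod]
        exact PiTensorProduct.lift.tprod _
      refine Eq.trans ?_ (congrArg (r • ·) h1.symm)
      refine Eq.trans (Finset.sum_congr rfl fun s _ => ?_) Finset.smul_sum.symm
      rw [map_smulₛₗ, LinearMap.smul_apply, map_smul, h2, smul_eq_mul, map_mul, hι, map_prod,
        mul_smul]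
  rw [← key x]
  exact Finset.sum_eq_zero fun s _ => by rw [hx, map_zero, map_zero, zero_smul]

variable [IsArtinianRing K] [IsReduced K] [IsAzumaya K A]
  {t : A →ₗ[K] K} {g : A ⊗[K] A} (hg : IsGoldman t g) (hV : ActsBy V g) (ht : IsSplitTrace t)
  (hι : ∀ c, ι (ι c) = c) (hσ : IsInvolution σ) {h : V →ₛₗ[ι] V →ₗ[K] A}
  (hh : ∀ (x y : V) (a b : A),
      h (MulOpposite.op a • x) (MulOpposite.op b • y) = σ a * h x y * b)

include hg hV ht hι hσ hh

/-- The anti-symmetrizer is self-adjoint. -/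
lemma ActsBy.formPow_antisymm (x y : ⨂[K]^d V) :
    formPow h d (antisymm K A V d x) y = formPow h d x (antisymm K A V d y) := by
  rw [antisymm_apply, antisymm_apply, map_sum, map_sum, LinearMap.sum_apply]
  refine Fintype.sum_equiv (Equiv.inv _) _ _ fun π => ?_
  have h1 : ι (permSign K π) = permSign K π := by simp [permSign]
  rw [Equiv.inv_apply, permSign_inv, map_smulₛₗ, LinearMap.smul_apply, map_smul, h1,
    hV.formPow_goldmanAct hg ht hι hσ hh]

/-- The form `Alt^d(h)` is well defined. -/
lemma ActsBy.altForm_toAlt (x y : ⨂[K]^d V) :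
    altForm h d (toAlt K A V d x) (toAlt K A V d y) = formPow h d (antisymm K A V d x) y ∧
    altForm h d (toAlt K A V d x) (toAlt K A V d y) = formPow h d x (antisymm K A V d y) := by
  have := IsArtinianRing.isSemisimpleRing_of_isReduced K
  have := Module.projective_of_isSemisimpleRing K (Alt K A V d)
  obtain ⟨s, hs⟩ := Module.projective_lifting_property ((toAlt K A V d).restrictScalars K)
    LinearMap.id (antisymm K A V d).surjective_rangeRestrict
  refine Classical.epsilon_spec (p := fun b : Alt K A V d →ₛₗ[ι] Alt K A V d →ₗ[K] ⨂[K]^d A =>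
    ∀ x y : ⨂[K]^d V,
      b (toAlt K A V d x) (toAlt K A V d y) = formPow h d (antisymm K A V d x) y ∧
      b (toAlt K A V d x) (toAlt K A V d y) = formPow h d x (antisymm K A V d y))
    ⟨((formPow h d).comp ((Alt K A V d).subtype.restrictScalars K)).compl₂ s, fun x y => ?_⟩ x y
  have h1 : antisymm K A V d (s (toAlt K A V d y)) = antisymm K A V d y :=
    congrArg Subtype.val (LinearMap.congr_fun hs (toAlt K A V d y))
  have h2 : formPow h d (antisymm K A V d x) (s (toAlt K A V d y))
      = formPow h d x (antisymm K A V d y) := by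
    rw [hV.formPow_antisymm hg ht hι hσ hh, h1]
  exact ⟨h2.trans (hV.formPow_antisymm hg ht hι hσ hh x y).symm, h2⟩

omit hh in
/-- `Alt^d(h)` is `ε^d`-hermitian. -/
theorem ActsBy.isHermitian_altForm [Module.Finite K V] {ε : K} (hh : IsHermitian σ ε h) :
    IsHermitian (semilinearPow σ d) (ε ^ d) (altForm (A := A) h d) := by
  have := IsArtinianRing.isSemisimpleRing_of_isReduced K
  have := IsAzumaya.toFinite (R := K) (A := A)
  have H := hV.altForm_toAlt (d := d) hg ht hι hσ hh.sesquilinear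
  have hsurj : ∀ u : Alt K A V d, ∃ x, toAlt K A V d x = u :=
    (antisymm K A V d).surjective_rangeRestrict
  refine ⟨fun u v a b => ?_, fun u v => ?_, fun u hu => ?_⟩
  · obtain ⟨x, rfl⟩ := hsurj u
    obtain ⟨y, rfl⟩ := hsurj v
    rw [← map_smul (toAlt K A V d), ← map_smul (toAlt K A V d), (H _ _).1, (H _ _).1,
      map_smul (antisymm K A V d)]
    exact formPow_tensorRightMul hh.sesquilinear a b _ y
  · obtain ⟨x, rfl⟩ := hsurj u
    obtain ⟨y, rfl⟩ := hsurj v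
    rw [(H x y).1, (H y x).2, formPow_hermitian hh.hermitian hι]
  · obtain ⟨x, rfl⟩ := hsurj u
    refine Subtype.ext (formPow_nondegenerate hι h hh.nondegenerate _ fun y => ?_)
    exact ((H x y).1).symm.trans (hu _)

end AltForm

/-! ### The isometry -/

section Isometry

variable {K : Type uK} [CommRing K] {ι : K →+* K} {A : Type uA} [Ring A] [Algebra K A]
  {U : Type uU} [AddCommGroup U] [Module K U] [Module Aᵐᵒᵖ U] [IsScalarTower K Aᵐᵒᵖ U]
  {V : Type uV} [AddCommGroup V] [Module K V] [Module Aᵐᵒᵖ V] [IsScalarTower K Aᵐᵒᵖ V]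
  {σ : A →ₛₗ[ι] A} {p q d : ℕ} {h : U →ₛₗ[ι] U →ₗ[K] A} {h' : V →ₛₗ[ι] V →ₗ[K] A}

omit [Module Aᵐᵒᵖ U] [IsScalarTower K Aᵐᵒᵖ U] [Module Aᵐᵒᵖ V] [IsScalarTower K Aᵐᵒᵖ V] in
lemma orthSum_apply (x y : U × V) : orthSum h h' x y = h x.1 y.1 + h' x.2 y.2 := rfl

omit [IsScalarTower K Aᵐᵒᵖ U] [IsScalarTower K Aᵐᵒᵖ V] in
lemma isHermitian_orthSum {ε : K} (hh : IsHermitian σ ε h) (hh' : IsHermitian σ ε h') :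
    IsHermitian σ ε (orthSum h h') := by
  refine ⟨fun x y a b => ?_, fun x y => ?_, fun x hx => Prod.ext ?_ ?_⟩
  · simp only [orthSum_apply, Prod.smul_fst, Prod.smul_snd, hh.sesquilinear, hh'.sesquilinear,
      mul_add, add_mul]
  · simp only [orthSum_apply, map_add, hh.hermitian, hh'.hermitian, smul_add]
  · exact hh.nondegenerate _ fun y => by simpa [orthSum_apply] using hx (y, 0)
  · exact hh'.nondegenerate _ fun y => by simpa [orthSum_apply] using hx (0, y)

/-- Both projections of `U ⊕ V` are self-adjoint for an orthogonal sum. -/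
lemma formPow_orthSum_colorProj (c : Fin d → Bool) (x y : ⨂[K]^d (U × V)) :
    formPow (orthSum h h') d (colorProj K A U V c x) y
      = formPow (orthSum h h') d x (colorProj K A U V c y) := by
  induction x using PiTensorProduct.induction_on with
  | add x x' hx hx' => simp only [map_add, LinearMap.add_apply, hx, hx']
  | smul_tprod r x =>
  induction y using PiTensorProduct.induction_on with
  | add x x' hx hx' => simp only [map_add, hx, hx']
  | smul_tprod s y =>
  simp only [map_smul, map_smulₛₗ, LinearMap.smul_apply, colorProj, mapPow_tprod, formPow_tprod]
  congr 3
  funext i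
  cases c i <;> simp [summandProj, orthSum_apply]

lemma formPow_orthSum_juxtapose (e : p + q = d) (x x' : ⨂[K]^p U) (y y' : ⨂[K]^q V) :
    formPow (orthSum h h') d (juxtapose K A U V e (x ⊗ₜ y)) (juxtapose K A U V e (x' ⊗ₜ y'))
      = concat K A e (formPow h p x x' ⊗ₜ formPow h' q y y') := by
  simp only [juxtapose, LinearMap.comp_apply, TensorProduct.map_tmul, LinearEquiv.coe_coe]
  induction x using PiTensorProduct.induction_on with
  | add a b ha hb => simp only [TensorProduct.add_tmul, map_add, LinearMap.add_apply, ha, hb]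
  | smul_tprod r x =>
  induction x' using PiTensorProduct.induction_on with
  | add a b ha hb => simp only [TensorProduct.add_tmul, map_add, ha, hb]
  | smul_tprod r' x' =>
  induction y using PiTensorProduct.induction_on with
  | add a b ha hb => simp only [TensorProduct.tmul_add, map_add, LinearMap.add_apply, ha, hb]
  | smul_tprod s y =>
  induction y' using PiTensorProduct.induction_on with
  | add a b ha hb => simp only [TensorProduct.tmul_add, map_add, ha, hb]
  | smul_tprod s' y' =>
  have key : PiTensorProduct.tprod K (fun i => orthSum h h'
      (Sum.elim (fun i => LinearMap.inl Aᵐᵒᵖ U V (x i)) (fun i => LinearMap.inr Aᵐᵒᵖ U V (y i))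
        ((finSumFinEquiv.trans (finCongr e)).symm i))
      (Sum.elim (fun i => LinearMap.inl Aᵐᵒᵖ U V (x' i)) (fun i => LinearMap.inr Aᵐᵒᵖ U V (y' i))
        ((finSumFinEquiv.trans (finCongr e)).symm i)))
      = PiTensorProduct.tprod K fun i => Sum.elim (fun i => h (x i) (x' i))
        (fun i => h' (y i) (y' i)) ((finSumFinEquiv.trans (finCongr e)).symm i) := by
    congr 1
    funext i
    rcases (finSumFinEquiv.trans (finCongr e)).symm i with j | j <;> simp [orthSum_apply]
  simp only [← TensorProduct.smul_tmul', TensorProduct.tmul_smul, map_smul, map_smulₛₗ,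
    LinearMap.smul_apply, mapPow_tprod, concat_tprod, formPow_tprod, key]
  simp only [smul_smul]
  congr 1
  ring

variable [IsArtinianRing K] [IsReduced K] [IsAzumaya K A]
  {t : A →ₗ[K] K} {g : A ⊗[K] A} (hM : ActsBy (U × V) g) (hg : IsGoldman t g)
  (hU : ActsBy U g) (hV : ActsBy V g) (ht : IsSplitTrace t)
  (hι : ∀ c, ι (ι c) = c) (hσ : IsInvolution σ)

include hM hg hU hV ht hι hσ

/-- The sum of the shuffle products is an isometry: the form on `(U ⊕ V)^{⊗ d}` is the orthogonal
sum of its restrictions to the tensor products of summands. -/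
theorem ActsBy.altForm_shuffleSum {ε : K} (hh : IsHermitian σ ε h) (hh' : IsHermitian σ ε h')
    (z z' : ⨁ pq, AltSummand K A U V d pq) :
    altForm (orthSum h h') d (hM.shuffleSum hg hU hV d z) (hM.shuffleSum hg hU hV d z')
      = altSumForm h h' d z z' := by
  have hs := (isHermitian_orthSum hh hh').sesquilinear
  induction z' using DirectSum.induction_on with
  | zero => rw [map_zero, map_zero, map_zero]
  | add x y hx hy => rw [map_add, map_add, map_add, hx, hy]
  | of pq z' =>
    have hpq := Finset.HasAntidiagonal.mem_antidiagonal.1 pq.2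
    rw [altSumForm_apply, Finset.sum_eq_single pq]
    rotate_left
    · intro pq' _ hne
      rw [DirectSum.of_eq_of_ne _ _ _ hne, map_zero]
    · exact fun hne => (hne (Finset.mem_univ _)).elim
    rw [DirectSum.of_eq_same]
    induction z' using altSummand_induction with
    | add x y hx hy => rw [map_add, map_add, map_add, map_add, hx, hy]
    | tmul x' y' =>
      have h1 : hM.shuffleSum hg hU hV d (DirectSum.of (AltSummand K A U V d) pq
          (altTmul (toAlt K A U _ x') (toAlt K A V _ y')))
          = toAlt K A (U × V) d (juxtapose K A U V hpq (x' ⊗ₜ y')) :=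
        Subtype.ext ((hM.shuffleSum_of hg hU hV pq _).trans
          (hM.shuffleMap_toAlt hg hU hV pq x' y'))
      have h2 : ∀ (u : Alt K A (U × V) d) w, altForm (orthSum h h') d u (toAlt K A (U × V) d w)
          = formPow (orthSum h h') d (u : ⨂[K]^d (U × V)) w := by
        rintro ⟨_, x, rfl⟩ w
        exact (hM.altForm_toAlt hg ht hι hσ hs x w).1
      rw [h1, h2, ← colorProj_juxtapose, ← formPow_orthSum_colorProj, ← juxtapose_blockProj hpq,
        hM.blockProj_shuffleSum hg hU hV z pq]
      induction z pq using altSummand_induction with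
      | add x y hx hy =>
        simp only [map_add, LinearMap.add_apply, hx, hy]
      | tmul x y =>
        rw [altIncl_altTmul, formPow_orthSum_juxtapose, altSummandForm_tmul,
          (hU.altForm_toAlt hg ht hι hσ hh.sesquilinear x x').1,
          (hV.altForm_toAlt hg ht hι hσ hh'.sesquilinear y y').1]
        rfl

end Isometry

/-- On the tensor powers of every finite module, permutations act through `permHom g d`, where `g`
is the Goldman element of `A` itself. -/
lemma actsBy_of_isSplitTrace {K : Type uK} [CommRing K] [IsArtinianRing K] [IsReduced K]
    {A : Type uA} [Ring A] [Algebra K A] [Module.Finite K A]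
    {V : Type uV} [AddCommGroup V] [Module K V] [Module Aᵐᵒᵖ V] [IsScalarTower K Aᵐᵒᵖ V]
    [Module.Finite K V] {t : A →ₗ[K] K} {g : A ⊗[K] A} (hg : IsGoldman t g)
    (ht : IsSplitTrace t) {a₀ : A} (ha₀ : t a₀ = 1) : ActsBy V g := by
  have := IsArtinianRing.isSemisimpleRing_of_isReduced K
  have := Module.projective_of_isSemisimpleRing K V
  obtain ⟨h1, h2⟩ := endAct₂_goldman (V := V) hg ht ha₀
  exact actsBy_of_endAct₂_eq hg h2 h1

/-- Hermitian forms are transported along isometries. -/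
lemma IsHermitian.of_linearEquiv {K : Type*} [CommRing K] {ι : K →+* K} {R : Type*} [Ring R]
    [Algebra K R] {M N : Type*} [AddCommGroup M] [Module K M] [Module Rᵐᵒᵖ M] [AddCommGroup N]
    [Module K N] [Module Rᵐᵒᵖ N] {σ : R →ₛₗ[ι] R} {ε : K} {h : M →ₛₗ[ι] M →ₗ[K] R}
    {h' : N →ₛₗ[ι] N →ₗ[K] R} (hh' : IsHermitian σ ε h') (Φ : M ≃ₗ[Rᵐᵒᵖ] N)
    (hΦ : ∀ x y, h' (Φ x) (Φ y) = h x y) : IsHermitian σ ε h where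
  sesquilinear x y a b := by
    rw [← hΦ, map_smul Φ, map_smul Φ, hh'.sesquilinear, hΦ]
  hermitian x y := by rw [← hΦ, ← hΦ, hh'.hermitian]
  nondegenerate x hx := by
    rw [← Φ.map_eq_zero_iff]
    refine hh'.nondegenerate _ fun y => ?_
    obtain ⟨y, rfl⟩ := Φ.surjective y
    rw [hΦ, hx]

end AzumayaAlt

end

theorem mainTheorem8 {k : Type*} [Field k] (hk : (2 : k) ≠ 0)
    {K : Type*} [CommRing K] [Nontrivial K] [Algebra k K] [Algebra.Etale k K]
    (ι : K ≃ₐ[k] K) (hι : ∀ z, ι (ι z) = z)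
    (hfix : ∀ z, ι z = z → z ∈ Set.range (algebraMap k K))
    {A : Type*} [Ring A] [Algebra K A] [IsAzumaya K A]
    {U : Type*} [AddCommGroup U] [Module K U] [Module Aᵐᵒᵖ U] [IsScalarTower K Aᵐᵒᵖ U]
    [Module.Finite K U]
    {V : Type*} [AddCommGroup V] [Module K V] [Module Aᵐᵒᵖ V] [IsScalarTower K Aᵐᵒᵖ V]
    [Module.Finite K V]
    (d : ℕ) :
    ∃ Φ : (⨁ pq, AzumayaAlt.AltSummand K A U V d pq) ≃ₗ[(⨂[K]^d A)ᵐᵒᵖ]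
        AzumayaAlt.Alt K A (U × V) d,
      -- `Φ` is induced by the shuffle product of the shuffle algebra of `U ⊕ V`
      (∀ (pq : Finset.HasAntidiagonal.antidiagonal d)
        (x : AzumayaAlt.Alt K A U pq.1.1) (y : AzumayaAlt.Alt K A V pq.1.2),
        (Φ (DirectSum.of (AzumayaAlt.AltSummand K A U V d) pq (AzumayaAlt.altTmul x y)) :
          ⨂[K]^d (U × V)) =
        AzumayaAlt.shuffleProd K A (U × V) (Finset.HasAntidiagonal.mem_antidiagonal.1 pq.2)
          (PiTensorProduct.map (fun _ => LinearMap.inl K U V) (x : ⨂[K]^pq.1.1 U))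
          (PiTensorProduct.map (fun _ => LinearMap.inr K U V) (y : ⨂[K]^pq.1.2 V))) ∧
      -- and it is an isometry of `ε ^ d`-hermitian modules
      (∀ σ : A →ₛₗ[(ι : K →+* K)] A, AzumayaAlt.IsInvolution σ →
        ∀ ε : K, ε * ι ε = 1 →
        ∀ h : U →ₛₗ[(ι : K →+* K)] U →ₗ[K] A, AzumayaAlt.IsHermitian σ ε h →
        ∀ h' : V →ₛₗ[(ι : K →+* K)] V →ₗ[K] A, AzumayaAlt.IsHermitian σ ε h' →
        AzumayaAlt.IsHermitian (AzumayaAlt.semilinearPow σ d) (ε ^ d)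
          (AzumayaAlt.altSumForm h h' d) ∧
        AzumayaAlt.IsHermitian (AzumayaAlt.semilinearPow σ d) (ε ^ d)
          (AzumayaAlt.altForm (AzumayaAlt.orthSum h h') d) ∧
        ∀ z z', AzumayaAlt.altForm (AzumayaAlt.orthSum h h') d (Φ z) (Φ z') =
          AzumayaAlt.altSumForm h h' d z z') := by
  have : Module.Finite k K := Algebra.FormallyUnramified.finite_of_free k K
  have : IsArtinianRing K := IsArtinianRing.of_finite k K
  have : IsReduced K := Algebra.FormallyUnramified.isReduced_of_field k K
  have : IsSemisimpleRing K := IsArtinianRing.isSemisimpleRing_of_isReduced K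
  have h2 : IsUnit (2 : K) := by
    rw [← map_ofNat (algebraMap k K) 2]
    exact (isUnit_iff_ne_zero.2 hk).map (algebraMap k K)
  have : Module.Finite K A := IsAzumaya.toFinite
  obtain ⟨t, ht⟩ := AzumayaAlt.exists_isSplitTrace K h2 A
  obtain ⟨g, hg⟩ := ht.exists_isGoldman
  obtain ⟨a₀, ha₀⟩ := ht.exists_eq_one
  have hU : AzumayaAlt.ActsBy U g := AzumayaAlt.actsBy_of_isSplitTrace hg ht ha₀
  have hV : AzumayaAlt.ActsBy V g := AzumayaAlt.actsBy_of_isSplitTrace hg ht ha₀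
  have hM : AzumayaAlt.ActsBy (U × V) g := AzumayaAlt.actsBy_of_isSplitTrace hg ht ha₀
  refine ⟨LinearEquiv.ofBijective _ (hM.shuffleSum_bijective hg hU hV d),
    fun pq x y => hM.shuffleSum_of hg hU hV pq _, fun σ hσ ε hε h hh h' hh' => ?_⟩
  have H := hM.isHermitian_altForm (d := d) hg ht hι hσ (AzumayaAlt.isHermitian_orthSum hh hh')
  have hΦ := hM.altForm_shuffleSum (d := d) hg hU hV ht hι hσ hh hh'
  exact ⟨H.of_linearEquiv (LinearEquiv.ofBijective _ (hM.shuffleSum_bijective hg hU hV d)) hΦ,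
    H, hΦ⟩
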